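/- Let $h,k\ge 1$ be integers, $n=h+k$, $\alpha>0$, and write points of $\mathbb{R}^n=\mathbb{R}^h\times\mathbb{R}^k$ as $(x,y)$. For an open set $A\subset\mathbb{R}^d$ and $m\in\mathbb{N}$ let $\mathcal F_m(A)=\{\varphi\in C^1_c(A;\mathbb{R}^m):\max_A|\varphi|\le 1\}$, where $|\cdot|$ is the Euclidean norm. The $\alpha$-perimeter of a Lebesgue measurable set $E\subset\mathbb{R}^n$ is $$P_\alpha(E)=\sup_{\varphi\in\mathcal F_n(\mathbb{R}^n)}\int_E\Big(\sum_{i=1}^h\partial_{x_i}\varphi_i+|x|^\alpha\sum_{j=1}^k\partial_{y_j}\varphi_{h+j}\Big)\,dx\,dy\in[0,\infty].$$ Let $\omega_m$ be the Lebesgue measure of the unit ball of $\mathbb{R}^m$, $c_{hk}=hk\,\omega_h\omega_k$, and $\mathbb{R}^+=(0,\infty)$. (i) Let $E\subset\mathbb{R}^n$ be a bounded open set with $P_\alpha(E)<\infty$ that is $x$- and $y$-spherically symmetric with generating set $G$, i.e. $G\subset[0,\infty)\times[0,\infty)$ and $E=\{(x,y):(|x|,|y|)\in G\}$. Then $$P_\alpha(E)=c_{hk}\sup_{\psi\in\mathcal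 F_2(\mathbb{R}^+\times\mathbb{R}^+)}\int_G\Big(s^{k-1}\partial_r\big(r^{h-1}\psi_1\big)+r^{h-1+\alpha}\partial_s\big(s^{k-1}\psi_2\big)\Big)\,dr\,ds .$$ (ii) If, in addition, $E$ has Lipschitz boundary, then the outer unit normal $N^G=(N^G_r,N^G_s)$ to $G$ exists at $\mathcal H^1$-a.e. point of $\partial G$, the integrand below is $\mathcal H^1$-integrable on $\partial G$, and $$P_\alpha(E)=c_{hk}\int_{\partial G}\big|(N^G_r,r^\alpha N^G_s)\big|\,r^{h-1}s^{k-1}\,d\mathcal H^1(r,s),$$ where $\partial G$ is the boundary of $G$ in $\mathbb{R}^+\times\mathbb{R}^+$. (iii) Let $E\subset\mathbb{R}^n$ be a Lebesgue measurable set with $P_\alpha(E)<\infty$ that is $x$-spherically symmetric with generating set $F$, i.e. $F\subset[0,\infty)\times\mathbb{R}^k$ and $E=\{(x,y):(|x|,y)\in F\}$. Then $$P_\alpha(E)=h\,\omega_h\sup_{\psi\in\mathcal F_{1+k}(\mathbb{R}^+\times\mathbb{R}^k)}\int_F\Big(\partial_r\big(r^{h-1}\psi_1\big)+r^{h-1+\alpha}\sum_{j=1}^k\partial_{y_j}\psi_{1+j}\Big)\,dr\,dy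 .$$ -/

import Mathlib

open MeasureTheory Topology
open scoped RealInnerProductSpace ENNReal

noncomputable section

/-- The space `ℝ^h × ℝ^k = ℝ^n` of points `z = (x, y)` with its Euclidean structure
(`x = z.fst`, `y = z.snd`). Its `volume` is the Lebesgue measure. -/
abbrev GrushinSpace (h k : ℕ) : Type :=
  WithLp 2 (EuclideanSpace ℝ (Fin h) × EuclideanSpace ℝ (Fin k))

/-- The Euclidean space `ℝ × ℝ^k` of points `p = (r, y)` with `r = p.fst`, `y = p.snd`. -/
abbrev HalfReduced (k : ℕ) : Type := WithLp 2 (ℝ × EuclideanSpace ℝ (Fin k))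

/-- The Euclidean plane of points `p = (r, s)` with `r = p.fst`, `s = p.snd`. -/
abbrev RSPlane : Type := WithLp 2 (ℝ × ℝ)

/-- The test fields on the open set `A`: maps of class `C¹` with compact support contained in `A`
(extended by zero outside `A`) and with Euclidean norm at most `1` everywhere. -/
def testFields {V W : Type*} [NormedAddCommGroup V] [NormedSpace ℝ V]
    [NormedAddCommGroup W] [NormedSpace ℝ W] (A : Set V) : Set (V → W) :=
  {φ | ContDiff ℝ 1 φ ∧ HasCompactSupport φ ∧ tsupport φ ⊆ A ∧ ∀ z, ‖φ z‖ ≤ 1}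

/-- The `α`-divergence `∑ᵢ ∂φᵢ/∂xᵢ + |x|^α ∑ⱼ ∂φ_{h+j}/∂yⱼ` of a vector field on `ℝ^h × ℝ^k`. -/
def alphaDiv {h k : ℕ} (α : ℝ) (φ : GrushinSpace h k → GrushinSpace h k)
    (z : GrushinSpace h k) : ℝ :=
  (∑ i : Fin h, (fderiv ℝ φ z (WithLp.toLp 2 (EuclideanSpace.single i 1, 0))).fst i) +
    ‖z.fst‖ ^ α *
      ∑ j : Fin k, (fderiv ℝ φ z (WithLp.toLp 2 (0, EuclideanSpace.single j 1))).snd j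

/-- The `α`-perimeter of `E` in `ℝ^n`: the supremum of `∫_E div_α φ` over all test fields `φ` on
`ℝ^n`, with values in `[0, ∞]`. (The zero field is admissible, so that discarding negative values
does not change the supremum.) -/
def alphaPerimeter {h k : ℕ} (α : ℝ) (E : Set (GrushinSpace h k)) : ℝ≥0∞ :=
  ⨆ φ ∈ testFields (W := GrushinSpace h k) (Set.univ : Set (GrushinSpace h k)),
    ENNReal.ofReal (∫ z in E, alphaDiv α φ z)

/-- `ω_m`, the Lebesgue measure of the open unit ball of `ℝ^m`. -/
def unitBallVolume (m : ℕ) : ℝ :=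
  (volume (Metric.ball (0 : EuclideanSpace ℝ (Fin m)) 1)).toReal

/-- `c_{hk} = h k ω_h ω_k`. -/
def symmConst (h k : ℕ) : ℝ := h * k * unitBallVolume h * unitBallVolume k

/-- `E` is `x`- and `y`-spherically symmetric with generating set `G ⊆ [0,∞) × [0,∞)`. -/
def IsXYSymmetricWith {h k : ℕ} (E : Set (GrushinSpace h k)) (G : Set RSPlane) : Prop :=
  (∀ p ∈ G, 0 ≤ p.fst ∧ 0 ≤ p.snd) ∧ E = {z | WithLp.toLp 2 (‖z.fst‖, ‖z.snd‖) ∈ G}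

/-- `E` is `x`-spherically symmetric with generating set `F ⊆ [0,∞) × ℝ^k`. -/
def IsXSymmetricWith {h k : ℕ} (E : Set (GrushinSpace h k)) (F : Set (HalfReduced k)) : Prop :=
  (∀ p ∈ F, 0 ≤ p.fst) ∧ E = {z | WithLp.toLp 2 (‖z.fst‖, z.snd) ∈ F}

/-- The open quadrant `(0,∞) × (0,∞)`. -/
def openQuadrant : Set RSPlane := {p | 0 < p.fst ∧ 0 < p.snd}

/-- The open half-space `(0,∞) × ℝ^k`. -/
def openHalf (k : ℕ) : Set (HalfReduced k) := {p | 0 < p.fst}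

/-- `s^{k-1} ∂_r (r^{h-1} ψ₁) + r^{h-1+α} ∂_s (s^{k-1} ψ₂)` at `p = (r, s)`. -/
def planeDiv (h k : ℕ) (α : ℝ) (ψ : RSPlane → RSPlane) (p : RSPlane) : ℝ :=
  p.snd ^ (k - 1) * deriv (fun r : ℝ => r ^ (h - 1) * (ψ (WithLp.toLp 2 (r, p.snd))).fst) p.fst +
    p.fst ^ ((h : ℝ) - 1 + α) *
      deriv (fun s : ℝ => s ^ (k - 1) * (ψ (WithLp.toLp 2 (p.fst, s))).snd) p.snd

/-- `∂_r (r^{h-1} ψ₁) + r^{h-1+α} ∑ⱼ ∂_{yⱼ} ψ_{1+j}` at `p = (r, y)`. -/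
def halfDiv (h : ℕ) {k : ℕ} (α : ℝ) (ψ : HalfReduced k → HalfReduced k)
    (p : HalfReduced k) : ℝ :=
  deriv (fun r : ℝ => r ^ (h - 1) * (ψ (WithLp.toLp 2 (r, p.snd))).fst) p.fst +
    p.fst ^ ((h : ℝ) - 1 + α) *
      ∑ j : Fin k, (fderiv ℝ ψ p (WithLp.toLp 2 (0, EuclideanSpace.single j 1))).snd j

/-- `A` has Lipschitz boundary: near each of its boundary points, in suitable Cartesian
coordinates, `A` is the region strictly below the graph of a Lipschitz function `g`. The coordinate
axis of the graph is spanned by the unit vector `v`, and `z - ⟪z, v⟫ v` is the orthogonal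
projection of `z` to the hyperplane orthogonal to `v`. -/
def HasLipschitzBoundary {V : Type*} [NormedAddCommGroup V] [InnerProductSpace ℝ V]
    (A : Set V) : Prop :=
  ∀ p ∈ frontier A, ∃ (v : V) (K : NNReal) (g : V → ℝ), ‖v‖ = 1 ∧ LipschitzWith K g ∧
    ∀ᶠ z in 𝓝 p, (z ∈ A ↔ ⟪z, v⟫ < g (z - ⟪z, v⟫ • v))

/-- `ν` is the outer unit normal to `A` at `p`: the half-space `{z : ⟪z - p, ν⟫ ≤ 0}` is tangent to
`A` at `p`, that is, close to `p` every point outside an arbitrarily thin double cone around the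
hyperplane `p + ν^⊥` belongs to `A` if it lies on the inner side, and to the complement of `A` if it
lies on the outer side. Where `A` is the region below the graph of a Lipschitz function `g`, such a
`ν` exists over exactly the points of differentiability of `g`, and then it is the normalization of
`(-∇g, 1)`. -/
def IsOuterUnitNormal {V : Type*} [NormedAddCommGroup V] [InnerProductSpace ℝ V]
    (A : Set V) (p ν : V) : Prop :=
  ‖ν‖ = 1 ∧ ∀ ε > (0 : ℝ), ∀ᶠ z in 𝓝 p,
    (⟪z - p, ν⟫ < -(ε * ‖z - p‖) → z ∈ A) ∧ (ε * ‖z - p‖ < ⟪z - p, ν⟫ → z ∉ A)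

open Classical in
/-- The outer unit normal to `A` at `p` (which is unique where it exists), and `0` where there is
none. -/
def outerNormal {V : Type*} [NormedAddCommGroup V] [InnerProductSpace ℝ V]
    (A : Set V) (p : V) : V :=
  if H : ∃ ν, IsOuterUnitNormal A p ν then H.choose else 0

/-- The boundary of `G` in the open quadrant `(0,∞) × (0,∞)`. -/
def quadrantBoundary (G : Set RSPlane) : Set RSPlane := frontier G ∩ openQuadrant

/-- `|(N_r, r^α N_s)| r^{h-1} s^{k-1}` at `p = (r, s)`, where `(N_r, N_s)` is the outer unit normal
to `G`. -/
def boundaryIntegrand (h k : ℕ) (α : ℝ) (G : Set RSPlane) (p : RSPlane) : ℝ :=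
  ‖(WithLp.toLp 2 ((outerNormal G p).fst, p.fst ^ α * (outerNormal G p).snd) : RSPlane)‖ *
    p.fst ^ (h - 1) * p.snd ^ (k - 1)

end

/-! ### Parametric integrals over compact spaces -/

section ParametricIntegral

variable {P V S : Type*} [NormedAddCommGroup P] [NormedSpace ℝ P] [FiniteDimensional ℝ P]
  [NormedAddCommGroup V] [NormedSpace ℝ V]
  [TopologicalSpace S] [CompactSpace S] [MeasurableSpace S] [OpensMeasurableSpace S]
  [SecondCountableTopologyEither S V] [SecondCountableTopologyEither S (P →L[ℝ] V)]

/-! Both symmetrizations come from one reduction. Let a set in `ℝ^d × W` be spherically symmetric in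
the first variable. For a test field `φ`, let `ψ` be its mean over the unit sphere: at `(r, w)`,
average over `θ` the projection of `φ(rθ, w)` to the plane-like space spanned by `θ` and `W`. The
lift `(r, w) ↦ (rθ, w)` is isometric and its adjoint is contractive, so `|ψ| ≤ 1`. The flux identity
`d/dr (r^{d-1} ∫ u(rθ)·θ dθ) = r^{d-1} ∫ (div u)(rθ) dθ` and polar coordinates turn the integral of
the divergence of `φ` over the set into `d ω_d` times the integral of the radial divergence of `ψ`
over the generating set. Conversely, a field `ψ` supported in `r > 0` lifts to a field with radial
first component, and its mean is `ψ` again.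

The mean need not have support away from `r = 0`, so it is multiplied by a cutoff `χ_n(r)`. This
produces an error with factor `χ_n' ψ₁`. The component `ψ₁` vanishes at `r = 0`, since `θ` has mean
zero on the sphere, hence `|ψ₁| ≤ C r`. As `r χ_n'` is bounded uniformly in `n`, dominated
convergence removes the error.

`iSup_fullDiv_eq_mul_iSup_radialDiv` states this for a first order operator with coefficients
depending on `(|x|, w)` and for fields whose support is constrained in `w`. Applied in `x`, it gives
the formula on `(0,∞) × ℝ^k`. Applied once more in `y`, after exchanging the factors, it gives the
formula on the quadrant.

For the boundary formula, a Lipschitz domain `E` is locally invariant under a cone of translations.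
Combining these with the reflection of `E` across the plane spanned by one direction in each factor
yields a cone of translations for `G`, so `G` locally lies below a Lipschitz graph
(`exists_subgraph_generating`). Gauss–Green below such a graph follows from Fubini along translates
of the graph and the length formula for Lipschitz curves (`hausdorffMeasure_restrict_range`), and a
partition of unity globalizes it. The supremum over `ψ` becomes that of `∫ ⟪ψ, V⟫ dH¹`, with `V` the
weighted normal. By duality (`lintegral_enorm_eq_iSup_testFields`) it equals `∫ |V| dH¹`, and
finiteness of the perimeter makes the integrand integrable. -/

theorem hasFDerivAt_integral_of_compactSpace (μ : Measure S) [IsFiniteMeasure μ]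
    {f : P → S → V} {f' : P → S → P →L[ℝ] V}
    (hf : ∀ p, Continuous (f p)) (hf' : Continuous (Function.uncurry f'))
    (h : ∀ p s, HasFDerivAt (fun q => f q s) (f' p s) p) (p : P) :
    HasFDerivAt (fun q => ∫ s, f q s ∂μ) (∫ s, f' p s ∂μ) p := by
  have := FiniteDimensional.proper ℝ P
  obtain ⟨C, hC⟩ := ((isCompact_closedBall p 1).prod (isCompact_univ (X := S))).exists_bound_of_continuousOn
    hf'.continuousOn
  have hc : Continuous (f' p) := hf'.comp (by fun_prop : Continuous fun s => (p, s))
  refine hasFDerivAt_integral_of_dominated_of_fderiv_le (bound := fun _ => C)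
    (Metric.closedBall_mem_nhds p one_pos) ?_ ?_ ?_ ?_ (integrable_const C) ?_
  · exact .of_forall fun q => (hf q).aestronglyMeasurable
  · exact (hf p).integrable_of_hasCompactSupport (HasCompactSupport.of_compactSpace _)
  · exact hc.aestronglyMeasurable
  · exact .of_forall fun s q hq => hC (q, s) ⟨hq, trivial⟩
  · exact .of_forall fun s q _ => h q s

theorem contDiff_one_integral_of_compactSpace (μ : Measure S) [IsFiniteMeasure μ]
    {f : P → S → V} {f' : P → S → P →L[ℝ] V}
    (hf : ∀ p, Continuous (f p)) (hf' : Continuous (Function.uncurry f'))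
    (h : ∀ p s, HasFDerivAt (fun q => f q s) (f' p s) p) :
    ContDiff ℝ 1 (fun q => ∫ s, f q s ∂μ) := by
  have H := hasFDerivAt_integral_of_compactSpace μ hf hf' h
  rw [contDiff_one_iff_fderiv]
  refine ⟨fun p => (H p).differentiableAt, ?_⟩
  have : fderiv ℝ (fun q => ∫ s, f q s ∂μ) = fun p => ∫ s, f' p s ∂μ := by
    ext1 p; exact (H p).fderiv
  rw [this]
  have := continuous_parametric_integral_of_continuous (μ := μ) hf' (isCompact_univ (X := S))
  simpa using this

variable {Z : Type*} [NormedAddCommGroup Z] [NormedSpace ℝ Z]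

/-- The spherical mean of a field is an integral of this kind, with `κ s` the lift along a direction
and `π s` its adjoint. As both are linear, differentiation only falls on `φ`. -/
theorem integral_conj_fderiv (μ : Measure S) [IsFiniteMeasure μ]
    {π : S → Z →L[ℝ] P} {κ : S → P →L[ℝ] Z} (hπ : Continuous π) (hκ : Continuous κ)
    {φ : Z → Z} (hφ : ContDiff ℝ 1 φ) :
    ContDiff ℝ 1 (fun p => ∫ s, π s (φ (κ s p)) ∂μ) ∧
      ∀ p v, fderiv ℝ (fun p => ∫ s, π s (φ (κ s p)) ∂μ) p v =
        ∫ s, π s (fderiv ℝ φ (κ s p) (κ s v)) ∂μ := by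
  have hφc := hφ.continuous
  have hφd := hφ.continuous_fderiv one_ne_zero
  have h1 : ∀ p, Continuous fun s => π s (φ (κ s p)) := fun p => by fun_prop
  have h2 : Continuous (Function.uncurry fun p s => π s ∘L fderiv ℝ φ (κ s p) ∘L κ s) := by
    simp only [Function.uncurry_def]; fun_prop
  have h3 : ∀ p s, HasFDerivAt (fun p => π s (φ (κ s p))) (π s ∘L fderiv ℝ φ (κ s p) ∘L κ s) p :=
    fun p s => (π s).hasFDerivAt.comp p
      ((hφ.differentiable one_ne_zero _).hasFDerivAt.comp p (κ s).hasFDerivAt)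
  refine ⟨contDiff_one_integral_of_compactSpace μ h1 h2 h3, fun p v => ?_⟩
  rw [(hasFDerivAt_integral_of_compactSpace μ h1 h2 h3 p).fderiv,
    ContinuousLinearMap.integral_apply]
  · rfl
  · exact (h2.comp (by fun_prop : Continuous fun s => (p, s))).integrable_of_hasCompactSupport
      (HasCompactSupport.of_compactSpace _)

end ParametricIntegral

/-! ### Polar coordinates -/

section Polar

variable {d : ℕ}

/-- The radial measure `r^{d-1} dr` on `(0,∞)`. -/
noncomputable def radialMeasure (d : ℕ) : Measure ℝ :=
  (volume.restrict (Set.Ioi (0 : ℝ))).withDensity fun r => ENNReal.ofReal (r ^ (d - 1))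

instance : SFinite (radialMeasure d) := by unfold radialMeasure; infer_instance

/-- The polar homeomorphism parametrizes the complement of the origin by the sphere and the subtype
of positive reals. Both are pushed to the ambient spaces; only the origin is lost, a null set
because `d ≥ 1`. -/
theorem map_smul_toSphere_prod_radialMeasure (hd : 1 ≤ d) :
    ((volume : Measure (EuclideanSpace ℝ (Fin d))).toSphere.prod (radialMeasure d)).map
      (fun q => q.2 • (q.1 : EuclideanSpace ℝ (Fin d))) = volume := by
  have : Nonempty (Fin d) := ⟨⟨0, hd⟩⟩
  have : Nontrivial (EuclideanSpace ℝ (Fin d)) := inferInstance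
  set X := EuclideanSpace ℝ (Fin d)
  have h1 := (volume : Measure X).measurePreserving_homeomorphUnitSphereProd
  have h2 : radialMeasure d = (Measure.volumeIoiPow (Module.finrank ℝ X - 1)).map Subtype.val := by
    have hfin : Module.finrank ℝ X = d := by simp [X]
    rw [hfin, Measure.volumeIoiPow, radialMeasure]
    ext s hs
    have he : MeasurableEmbedding (Subtype.val : Set.Ioi (0 : ℝ) → ℝ) :=
      MeasurableEmbedding.subtype_coe measurableSet_Ioi
    have hl := he.lintegral_map (μ := (Measure.comap Subtype.val volume).restrict
      (Subtype.val ⁻¹' s)) (fun r : ℝ => ENNReal.ofReal (r ^ (d - 1)))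
    rw [he.map_apply, withDensity_apply _ hs, withDensity_apply _ (he.measurable hs), ← hl,
      ← he.restrict_map, he.map_comap, Subtype.range_coe]
  rw [h2]
  have h3 : (volume : Measure X).toSphere.prod
      ((Measure.volumeIoiPow (Module.finrank ℝ X - 1)).map Subtype.val) =
      ((volume : Measure X).toSphere.prod (Measure.volumeIoiPow (Module.finrank ℝ X - 1))).map
        (Prod.map id Subtype.val) := by
    have := Measure.map_prod_map (volume : Measure X).toSphere
      (Measure.volumeIoiPow (Module.finrank ℝ X - 1)) measurable_id
      (measurable_subtype_coe : Measurable (Subtype.val : Set.Ioi (0 : ℝ) → ℝ))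
    rw [Measure.map_id] at this
    exact this
  have hm : Measurable (fun q : Metric.sphere (0 : X) 1 × ℝ => q.2 • (q.1 : X)) := by fun_prop
  have he : MeasurableEmbedding (Subtype.val : ({0}ᶜ : Set X) → X) :=
    MeasurableEmbedding.subtype_coe (measurableSet_singleton 0).compl
  rw [h3, ← h1.map_eq, Measure.map_map hm (by fun_prop),
    Measure.map_map (hm.comp (by fun_prop)) h1.measurable]
  have h4 : ((fun q : Metric.sphere (0 : X) 1 × ℝ => q.2 • (q.1 : X)) ∘
      (Prod.map id Subtype.val)) ∘ (homeomorphUnitSphereProd X) = Subtype.val := by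
    ext1 x
    have hx : ‖(x : X)‖ ≠ 0 := norm_ne_zero_iff.2 x.2
    simp [smul_smul, hx]
  rw [h4, he.map_comap, Subtype.range_coe, restrict_compl_singleton]

end Polar

/-! ### Spherical lifts and averages -/

/-- Points `(x, w)` with `x ∈ ℝ^d`. -/
abbrev SphereSpace (d : ℕ) (W : Type*) : Type _ := WithLp 2 (EuclideanSpace ℝ (Fin d) × W)

/-- Points `(r, w)` with `r` the radial variable. -/
abbrev RadialSpace (W : Type*) : Type _ := WithLp 2 (ℝ × W)

/-- The surface measure on the unit sphere of `ℝ^d`. -/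
noncomputable abbrev sphereMeasure (d : ℕ) :
    Measure (Metric.sphere (0 : EuclideanSpace ℝ (Fin d)) 1) :=
  (volume : Measure (EuclideanSpace ℝ (Fin d))).toSphere

section Lift

variable {d : ℕ} {W : Type*} [NormedAddCommGroup W] [InnerProductSpace ℝ W]

/-- The linear map `(r, w) ↦ (r θ, w)`. -/
noncomputable def polarLift (W : Type*) [NormedAddCommGroup W] [InnerProductSpace ℝ W]
    (θ : EuclideanSpace ℝ (Fin d)) : RadialSpace W →L[ℝ] SphereSpace d W :=
  ContinuousLinearMap.smulRightL ℝ (RadialSpace W) (SphereSpace d W) (WithLp.fstL 2 ℝ ℝ W)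
      ((WithLp.prodContinuousLinearEquiv 2 ℝ (EuclideanSpace ℝ (Fin d)) W).symm
        (ContinuousLinearMap.inl ℝ _ W θ)) +
    ((WithLp.prodContinuousLinearEquiv 2 ℝ (EuclideanSpace ℝ (Fin d)) W).symm.toContinuousLinearMap ∘L
      ContinuousLinearMap.inr ℝ (EuclideanSpace ℝ (Fin d)) W) ∘L WithLp.sndL 2 ℝ ℝ W

@[simp] theorem polarLift_fst (θ : EuclideanSpace ℝ (Fin d)) (p : RadialSpace W) :
    (polarLift W θ p).fst = p.fst • θ := by simp [polarLift]

@[simp] theorem polarLift_snd (θ : EuclideanSpace ℝ (Fin d)) (p : RadialSpace W) :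
    (polarLift W θ p).snd = p.snd := by simp [polarLift]

theorem polarLift_eq (θ : EuclideanSpace ℝ (Fin d)) (p : RadialSpace W) :
    polarLift W θ p = WithLp.toLp 2 (p.fst • θ, p.snd) := by
  apply WithLp.ofLp_injective
  ext1
  · exact polarLift_fst θ p
  · exact polarLift_snd θ p

theorem continuous_polarLift : Continuous (polarLift (d := d) W) := by
  unfold polarLift; fun_prop

theorem norm_polarLift (θ : Metric.sphere (0 : EuclideanSpace ℝ (Fin d)) 1) (p : RadialSpace W) :
    ‖polarLift W (θ : EuclideanSpace ℝ (Fin d)) p‖ = ‖p‖ := by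
  have : ‖(θ : EuclideanSpace ℝ (Fin d))‖ = 1 := by simp
  rw [WithLp.prod_norm_eq_of_L2, WithLp.prod_norm_eq_of_L2]
  simp [norm_smul, this]

theorem polarLift_mem_iff {E : Set (SphereSpace d W)} {F : Set (RadialSpace W)}
    (hEF : E = {z | WithLp.toLp 2 (‖z.fst‖, z.snd) ∈ F})
    (θ : Metric.sphere (0 : EuclideanSpace ℝ (Fin d)) 1) {p : RadialSpace W} (hp : 0 ≤ p.fst) :
    polarLift W (θ : EuclideanSpace ℝ (Fin d)) p ∈ E ↔ p ∈ F := by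
  have h1 : ‖(θ : EuclideanSpace ℝ (Fin d))‖ = 1 := by simp
  have : (WithLp.toLp 2 (p.fst, p.snd) : RadialSpace W) = p := rfl
  simp [hEF, norm_smul, h1, abs_of_nonneg hp, this]

variable [FiniteDimensional ℝ W]

/-- The adjoint `(x, w) ↦ (⟪x, θ⟫, w)` of `polarLift`. -/
noncomputable def polarProj (W : Type*) [NormedAddCommGroup W] [InnerProductSpace ℝ W]
    [FiniteDimensional ℝ W] (θ : EuclideanSpace ℝ (Fin d)) :
    SphereSpace d W →L[ℝ] RadialSpace W :=
  haveI : CompleteSpace W := FiniteDimensional.complete ℝ W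
  ContinuousLinearMap.adjoint (polarLift W θ)

theorem inner_polarProj (θ : EuclideanSpace ℝ (Fin d)) (z : SphereSpace d W) (p : RadialSpace W) :
    ⟪polarProj W θ z, p⟫ = ⟪z, polarLift W θ p⟫ := by
  have : CompleteSpace W := FiniteDimensional.complete ℝ W
  exact ContinuousLinearMap.adjoint_inner_left _ _ _

theorem polarProj_eq (θ : EuclideanSpace ℝ (Fin d)) (z : SphereSpace d W) :
    polarProj W θ z = WithLp.toLp 2 (⟪z.fst, θ⟫, z.snd) := by
  refine ext_inner_right ℝ fun p => ?_
  rw [inner_polarProj, polarLift_eq]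
  simp [inner_smul_right, WithLp.prod_inner_apply]

@[simp] theorem polarProj_fst (θ : EuclideanSpace ℝ (Fin d)) (z : SphereSpace d W) :
    (polarProj W θ z).fst = ⟪z.fst, θ⟫ := by rw [polarProj_eq]; rfl

@[simp] theorem polarProj_snd (θ : EuclideanSpace ℝ (Fin d)) (z : SphereSpace d W) :
    (polarProj W θ z).snd = z.snd := by rw [polarProj_eq]; rfl

theorem continuous_polarProj : Continuous (polarProj (d := d) W) := by
  have : CompleteSpace W := FiniteDimensional.complete ℝ W
  exact ContinuousLinearMap.adjoint.continuous.comp continuous_polarLift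

/-- The adjoint of an isometric map is a contraction: `|πz|² = ⟪z, κπz⟫ ≤ |z| |πz|`. -/
theorem norm_polarProj_le (θ : Metric.sphere (0 : EuclideanSpace ℝ (Fin d)) 1)
    (z : SphereSpace d W) : ‖polarProj W (θ : EuclideanSpace ℝ (Fin d)) z‖ ≤ ‖z‖ := by
  have h := inner_polarProj (θ : EuclideanSpace ℝ (Fin d)) z (polarProj W θ z)
  have h2 := real_inner_le_norm z (polarLift W (θ : EuclideanSpace ℝ (Fin d)) (polarProj W θ z))
  rw [norm_polarLift, ← h, real_inner_self_eq_norm_sq] at h2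
  by_contra! hlt
  nlinarith [norm_nonneg z]

end Lift

section PolarIntegral

variable {d : ℕ} {W : Type*} [NormedAddCommGroup W] [InnerProductSpace ℝ W]
  [FiniteDimensional ℝ W] [MeasurableSpace W] [BorelSpace W]

theorem map_polarLift (hd : 1 ≤ d) :
    ((sphereMeasure d).prod ((radialMeasure d).prod (volume : Measure W))).map
      (fun q => polarLift W (q.1 : EuclideanSpace ℝ (Fin d)) (WithLp.toLp 2 q.2)) = volume := by
  have hm : Measurable (fun q : Metric.sphere (0 : EuclideanSpace ℝ (Fin d)) 1 × ℝ =>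
      q.2 • (q.1 : EuclideanSpace ℝ (Fin d))) := by fun_prop
  have h1 : ((sphereMeasure d).prod (radialMeasure d)).prod (volume : Measure W) =
      ((sphereMeasure d).prod ((radialMeasure d).prod volume)).map MeasurableEquiv.prodAssoc.symm :=
    ((measurePreserving_prodAssoc _ _ _).symm _).map_eq.symm
  have h2 := Measure.map_prod_map ((sphereMeasure d).prod (radialMeasure d)) (volume : Measure W)
    hm measurable_id
  rw [map_smul_toSphere_prod_radialMeasure hd, Measure.map_id, h1, Measure.map_map (by fun_prop)
    (MeasurableEquiv.measurable _)] at h2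
  rw [← (WithLp.volume_preserving_toLp (EuclideanSpace ℝ (Fin d)) W).map_eq,
    Measure.volume_eq_prod, h2, Measure.map_map (by fun_prop)
      ((hm.prodMap measurable_id).comp (MeasurableEquiv.measurable _))]
  congr 1
  ext1 q
  simp [polarLift_eq, MeasurableEquiv.prodAssoc]

theorem measurable_polarLift :
    Measurable (fun q : Metric.sphere (0 : EuclideanSpace ℝ (Fin d)) 1 × (ℝ × W) =>
      polarLift W (q.1 : EuclideanSpace ℝ (Fin d)) (WithLp.toLp 2 q.2)) := by
  have : Continuous (fun q : Metric.sphere (0 : EuclideanSpace ℝ (Fin d)) 1 × (ℝ × W) =>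
      polarLift W (q.1 : EuclideanSpace ℝ (Fin d)) (WithLp.toLp 2 q.2)) :=
    (continuous_polarLift.comp (by fun_prop)).clm_apply (by fun_prop)
  exact this.measurable

theorem radialMeasure_prod_eq :
    (radialMeasure d).prod (volume : Measure W) =
      ((volume : Measure (ℝ × W)).restrict (Set.Ioi 0 ×ˢ Set.univ)).withDensity
        fun q => ENNReal.ofReal (q.1 ^ (d - 1)) := by
  unfold radialMeasure
  rw [prod_withDensity_left (by fun_prop), Measure.volume_eq_prod, ← Measure.prod_restrict,
    Measure.restrict_univ]

theorem ae_fst_ne_zero : ∀ᵐ p : RadialSpace W, p.fst ≠ 0 := by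
  have h : ∀ᵐ q : ℝ × W, q.1 ≠ 0 := by
    have : ∀ᵐ r : ℝ, r ≠ 0 := by simp [ae_iff, measure_singleton]
    exact Measure.quasiMeasurePreserving_fst.ae this
  exact (WithLp.volume_preserving_ofLp ℝ W).quasiMeasurePreserving.ae h

/-- The set of points of `F` with positive radial variable, as a set of pairs. -/
def posPairs (F : Set (RadialSpace W)) : Set (ℝ × W) :=
  {q | 0 < q.1 ∧ WithLp.toLp 2 q ∈ F}

theorem ae_radialMeasure_prod {q : ℝ × W → Prop}
    (h : ∀ᵐ x ∂((radialMeasure d).prod (volume : Measure W)), q x) :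
    ∀ᵐ x : ℝ × W, 0 < x.1 → q x := by
  rw [radialMeasure_prod_eq, ae_withDensity_iff (by fun_prop),
    ae_restrict_iff' (measurableSet_Ioi.prod .univ)] at h
  filter_upwards [h] with x hx h0
  refine hx ⟨h0, trivial⟩ ?_
  simpa using pow_pos h0 _

/-- Nothing is assumed about the measurability of `F`. By Fubini there is one direction `θ` along
which `E` and a measurable version `E'` have a.e. equal slices; by symmetry the slice of `E` is the
part of `F` with `r > 0`. -/
theorem nullMeasurableSet_posPairs {E : Set (SphereSpace d W)} {F : Set (RadialSpace W)}
    (hd : 1 ≤ d) (hE : NullMeasurableSet E volume)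
    (hEF : E = {z | WithLp.toLp 2 (‖z.fst‖, z.snd) ∈ F}) :
    NullMeasurableSet (posPairs F) volume := by
  have : Nonempty (Fin d) := ⟨⟨0, hd⟩⟩
  obtain ⟨E', hE', hEE'⟩ := hE
  have h1 : ∀ᵐ z : SphereSpace d W, z ∈ E ↔ z ∈ E' := hEE'.mem_iff
  rw [← map_polarLift hd] at h1
  have h2 := Measure.ae_ae_of_ae_prod (ae_of_ae_map measurable_polarLift.aemeasurable h1)
  have : (ae (sphereMeasure d)).NeBot := ae_neBot.2 (Measure.toSphere_ne_zero _)
  obtain ⟨θ, hθ⟩ := h2.exists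
  have h3 : ∀ᵐ x : ℝ × W, 0 < x.1 →
      (polarLift W (θ : EuclideanSpace ℝ (Fin d)) (WithLp.toLp 2 x) ∈ E ↔
        polarLift W (θ : EuclideanSpace ℝ (Fin d)) (WithLp.toLp 2 x) ∈ E') := by
    exact ae_radialMeasure_prod hθ
  have hf : Measurable fun q : ℝ × W =>
      polarLift W (θ : EuclideanSpace ℝ (Fin d)) (WithLp.toLp 2 q) :=
    (show Continuous _ by fun_prop).measurable
  refine ⟨{q | 0 < q.1} ∩ {q | polarLift W (θ : EuclideanSpace ℝ (Fin d)) (WithLp.toLp 2 q) ∈ E'},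
    (measurableSet_lt measurable_const measurable_fst).inter (hf hE'), ?_⟩
  refine Filter.eventuallyEq_set.2 ?_
  filter_upwards [h3] with q hq
  refine and_congr_right fun h0 => ?_
  rw [← polarLift_mem_iff hEF θ (p := WithLp.toLp 2 q) h0.le]
  exact hq h0

theorem ae_eq_preimage_posPairs {F : Set (RadialSpace W)} (hF : ∀ p ∈ F, 0 ≤ p.fst) :
    F =ᵐ[volume] WithLp.ofLp ⁻¹' posPairs F := by
  filter_upwards [ae_fst_ne_zero (W := W)] with p hp
  apply propext
  change p ∈ F ↔ 0 < p.fst ∧ p ∈ F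
  exact ⟨fun h => ⟨lt_of_le_of_ne (hF p h) hp.symm, h⟩, fun h => h.2⟩

theorem nullMeasurableSet_generating {E : Set (SphereSpace d W)} {F : Set (RadialSpace W)}
    (hd : 1 ≤ d) (hE : NullMeasurableSet E volume) (hF : ∀ p ∈ F, 0 ≤ p.fst)
    (hEF : E = {z | WithLp.toLp 2 (‖z.fst‖, z.snd) ∈ F}) : NullMeasurableSet F volume :=
  ((nullMeasurableSet_posPairs hd hE hEF).preimage
    (WithLp.volume_preserving_ofLp ℝ W).quasiMeasurePreserving).congr
    (ae_eq_preimage_posPairs hF).symm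

/-- The indicator of `E` is constant on each sphere, with the value of the indicator of `F`, so it
leaves the integral in `θ`. -/
theorem setIntegral_eq_setIntegral_sphere {E : Set (SphereSpace d W)} {F : Set (RadialSpace W)}
    (hd : 1 ≤ d) (hE : NullMeasurableSet E volume) (hF : ∀ p ∈ F, 0 ≤ p.fst)
    (hEF : E = {z | WithLp.toLp 2 (‖z.fst‖, z.snd) ∈ F})
    {f : SphereSpace d W → ℝ} (hf : Integrable f) :
    ∫ z in E, f z = ∫ p in F, p.fst ^ (d - 1) *
      ∫ θ, f (polarLift W (θ : EuclideanSpace ℝ (Fin d)) p) ∂sphereMeasure d := by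
  have hN := nullMeasurableSet_posPairs hd hE hEF
  set κ := fun q : Metric.sphere (0 : EuclideanSpace ℝ (Fin d)) 1 × (ℝ × W) =>
      polarLift W (q.1 : EuclideanSpace ℝ (Fin d)) (WithLp.toLp 2 q.2) with hκ
  have hint : Integrable (E.indicator f) := hf.integrableOn.integrable_indicator₀ hE
  have hmap := map_polarLift (W := W) hd
  have hi2 : Integrable (E.indicator f ∘ κ)
      ((sphereMeasure d).prod ((radialMeasure d).prod volume)) := by
    refine Integrable.comp_measurable ?_ measurable_polarLift
    rw [hmap]; exact hint
  rw [← integral_indicator₀ hE, ← hmap, integral_map measurable_polarLift.aemeasurable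
    (by rw [hmap]; exact hint.aestronglyMeasurable)]
  change ∫ q, (E.indicator f ∘ κ) q ∂((sphereMeasure d).prod ((radialMeasure d).prod volume)) = _
  rw [integral_prod_symm _ hi2, radialMeasure_prod_eq,
    integral_withDensity_eq_integral_toReal_smul (by fun_prop) (by simp),
    setIntegral_congr_set (ae_eq_preimage_posPairs hF),
    ← (WithLp.volume_preserving_ofLp ℝ W).setIntegral_preimage_emb
      (MeasurableEquiv.toLp 2 (ℝ × W)).symm.measurableEmbedding]
  have hsub : WithLp.ofLp ⁻¹' posPairs F ⊆
      (WithLp.ofLp ⁻¹' (Set.Ioi 0 ×ˢ Set.univ) : Set (RadialSpace W)) :=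
    fun p hp => ⟨hp.1, trivial⟩
  have hN' : NullMeasurableSet (WithLp.ofLp ⁻¹' posPairs F : Set (RadialSpace W)) volume :=
    hN.preimage (WithLp.volume_preserving_ofLp ℝ W).quasiMeasurePreserving
  have hM' : MeasurableSet (WithLp.ofLp ⁻¹' (Set.Ioi 0 ×ˢ Set.univ) : Set (RadialSpace W)) :=
    (MeasurableEquiv.toLp 2 (ℝ × W)).symm.measurable (measurableSet_Ioi.prod .univ)
  rw [← integral_indicator₀ hN', ← integral_indicator hM']
  congr 1
  ext1 p
  by_cases h0 : 0 < p.fst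
  · have hp : p ∈ (WithLp.ofLp ⁻¹' (Set.Ioi 0 ×ˢ Set.univ) : Set (RadialSpace W)) := ⟨h0, trivial⟩
    rw [Set.indicator_of_mem hp, ENNReal.toReal_ofReal (by simpa using pow_nonneg h0.le _)]
    by_cases hpF : p ∈ F
    · rw [Set.indicator_of_mem (show p ∈ WithLp.ofLp ⁻¹' posPairs F from ⟨h0, hpF⟩), smul_eq_mul]
      congr 1
      refine integral_congr_ae (.of_forall fun θ => ?_)
      exact Set.indicator_of_mem ((polarLift_mem_iff hEF θ h0.le).2 hpF) f
    · rw [Set.indicator_of_notMem (show p ∉ WithLp.ofLp ⁻¹' posPairs F from fun h => hpF h.2)]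
      have : ∀ θ : Metric.sphere (0 : EuclideanSpace ℝ (Fin d)) 1,
          E.indicator f (κ (θ, p.ofLp)) = 0 := fun θ =>
        Set.indicator_of_notMem (fun h => hpF ((polarLift_mem_iff hEF θ h0.le).1 h)) f
      simp [this]
  · rw [Set.indicator_of_notMem (fun h => h0 h.1), Set.indicator_of_notMem (fun h => h0 h.1)]

end PolarIntegral

/-! ### Flux through spheres -/

section Flux

variable {d : ℕ}

theorem integral_eq_integral_sphere (hd : 1 ≤ d) {f : EuclideanSpace ℝ (Fin d) → ℝ}
    (hf : Integrable f) :
    ∫ x, f x = ∫ r in Set.Ioi (0 : ℝ), r ^ (d - 1) *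
      ∫ θ, f (r • (θ : EuclideanSpace ℝ (Fin d))) ∂sphereMeasure d := by
  have hm : Measurable (fun q : Metric.sphere (0 : EuclideanSpace ℝ (Fin d)) 1 × ℝ =>
      q.2 • (q.1 : EuclideanSpace ℝ (Fin d))) := by fun_prop
  have hmap := map_smul_toSphere_prod_radialMeasure hd
  have hi : Integrable (f ∘ fun q : Metric.sphere (0 : EuclideanSpace ℝ (Fin d)) 1 × ℝ =>
      q.2 • (q.1 : EuclideanSpace ℝ (Fin d))) ((sphereMeasure d).prod (radialMeasure d)) := by
    refine Integrable.comp_measurable ?_ hm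
    rw [hmap]; exact hf
  rw [← hmap, integral_map hm.aemeasurable (by rw [hmap]; exact hf.aestronglyMeasurable)]
  change ∫ q, (f ∘ fun q : Metric.sphere (0 : EuclideanSpace ℝ (Fin d)) 1 × ℝ =>
      q.2 • (q.1 : EuclideanSpace ℝ (Fin d))) q ∂((sphereMeasure d).prod (radialMeasure d)) = _
  rw [integral_prod_symm _ hi, radialMeasure,
    integral_withDensity_eq_integral_toReal_smul (by fun_prop) (by simp)]
  refine setIntegral_congr_fun measurableSet_Ioi fun r hr => ?_
  simp only [smul_eq_mul]
  rw [ENNReal.toReal_ofReal (pow_nonneg (le_of_lt hr) _)]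
  rfl

/-- The divergence of a vector field on `ℝ^d`. -/
noncomputable def euclideanDiv (u : EuclideanSpace ℝ (Fin d) → EuclideanSpace ℝ (Fin d))
    (x : EuclideanSpace ℝ (Fin d)) : ℝ :=
  ∑ i, fderiv ℝ u x (EuclideanSpace.single i 1) i

theorem continuous_euclideanDiv
    {u : EuclideanSpace ℝ (Fin d) → EuclideanSpace ℝ (Fin d)} (hu : ContDiff ℝ 1 u) :
    Continuous (euclideanDiv u) := by
  unfold euclideanDiv
  have := hu.continuous_fderiv one_ne_zero
  fun_prop

theorem hasCompactSupport_euclideanDiv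
    {u : EuclideanSpace ℝ (Fin d) → EuclideanSpace ℝ (Fin d)} (hc : HasCompactSupport u) :
    HasCompactSupport (euclideanDiv u) := by
  refine (hc.fderiv ℝ).mono fun x hx => ?_
  contrapose! hx
  simp only [Function.mem_support, not_not] at hx
  simp [euclideanDiv, hx]

theorem integral_mul_euclideanDiv
    {u : EuclideanSpace ℝ (Fin d) → EuclideanSpace ℝ (Fin d)} (hu : ContDiff ℝ 1 u)
    (hc : HasCompactSupport u) {g : EuclideanSpace ℝ (Fin d) → ℝ} (hg : ContDiff ℝ 1 g) :
    ∫ x, g x * euclideanDiv u x = - ∫ x, fderiv ℝ g x (u x) := by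
  have hgc := hg.continuous
  have hgd := hg.continuous_fderiv one_ne_zero
  have huc := hu.continuous
  have hud := hu.continuous_fderiv one_ne_zero
  have hdu : Differentiable ℝ u := hu.differentiable one_ne_zero
  have hcomp : ∀ i x, fderiv ℝ (fun y => u y i) x (EuclideanSpace.single i 1) =
      fderiv ℝ u x (EuclideanSpace.single i 1) i := by
    intro i x
    have := ((EuclideanSpace.proj (𝕜 := ℝ) i).hasFDerivAt.comp x (hdu x).hasFDerivAt).fderiv
    have h2 : (⇑(EuclideanSpace.proj (𝕜 := ℝ) i) ∘ u) = fun y => u y i := rfl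
    rw [h2] at this
    rw [this]; rfl
  have hci : ∀ i, HasCompactSupport fun x => u x i := fun i =>
    hc.comp_left (g := fun v : EuclideanSpace ℝ (Fin d) => v i) rfl
  have hcf : HasCompactSupport (fderiv ℝ u) := hc.fderiv ℝ
  have hi1 : ∀ i, Integrable fun x => g x * fderiv ℝ u x (EuclideanSpace.single i 1) i := by
    intro i
    refine Continuous.integrable_of_hasCompactSupport (by fun_prop) ?_
    exact (hcf.comp_left (g := fun L : EuclideanSpace ℝ (Fin d) →L[ℝ] EuclideanSpace ℝ (Fin d) =>
      L (EuclideanSpace.single i 1) i) rfl).mul_left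
  have hi2 : ∀ i, Integrable fun x => fderiv ℝ g x (EuclideanSpace.single i 1) * u x i := by
    intro i
    exact Continuous.integrable_of_hasCompactSupport (by fun_prop) (hci i).mul_left
  have hi3 : ∀ i, Integrable fun x => g x * u x i := by
    intro i
    exact Continuous.integrable_of_hasCompactSupport (by fun_prop) (hci i).mul_left
  have key : ∀ i, ∫ x, g x * fderiv ℝ u x (EuclideanSpace.single i 1) i =
      - ∫ x, fderiv ℝ g x (EuclideanSpace.single i 1) * u x i := by
    intro i
    have := integral_mul_fderiv_eq_neg_fderiv_mul_of_integrable (μ := volume) (f := g)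
      (g := fun x => u x i) (v := EuclideanSpace.single i 1) (hi2 i)
      (by simpa only [hcomp] using hi1 i) (hi3 i)
      (fun x _ => hg.differentiable one_ne_zero x)
      (fun x _ => ((EuclideanSpace.proj (𝕜 := ℝ) i).differentiableAt.comp x (hdu x)))
    simpa only [hcomp] using this
  have hsum : ∀ x, fderiv ℝ g x (u x) =
      ∑ i, fderiv ℝ g x (EuclideanSpace.single i 1) * u x i := by
    intro x
    have hx : u x = ∑ i, (u x i) • EuclideanSpace.single i (1 : ℝ) := by
      ext j; simp [Finset.sum_apply, Pi.single_apply]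
    conv_lhs => rw [hx]
    simp [map_sum, mul_comm]
  simp only [euclideanDiv, Finset.mul_sum, hsum]
  rw [integral_finsetSum _ fun i _ => hi1 i, integral_finsetSum _ fun i _ => hi2 i,
    ← Finset.sum_neg_distrib]
  exact Finset.sum_congr rfl fun i _ => key i

theorem contDiff_comp_norm {X : Type*} [NormedAddCommGroup X] [InnerProductSpace ℝ X]
    {g : ℝ → ℝ} (hg : ContDiff ℝ 1 g) (hs : tsupport g ⊆ Set.Ioi 0) :
    ContDiff ℝ 1 fun x : X => g ‖x‖ := by
  rw [contDiff_iff_contDiffAt]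
  intro x
  rcases eq_or_ne x 0 with rfl | hx
  · have h0 : (0 : ℝ) ∉ tsupport g := fun h => lt_irrefl (0 : ℝ) (hs h)
    have h1 : ∀ᶠ r in 𝓝 ‖(0 : X)‖, g r = 0 := by
      rw [norm_zero]; exact notMem_tsupport_iff_eventuallyEq.1 h0
    have h2 : (fun x : X => g ‖x‖) =ᶠ[𝓝 0] fun _ => 0 := continuous_norm.continuousAt.eventually h1
    exact contDiffAt_const.congr_of_eventuallyEq h2
  · exact hg.contDiffAt.comp x (contDiffAt_norm ℝ hx)

theorem fderiv_comp_norm_smul {X : Type*} [NormedAddCommGroup X] [InnerProductSpace ℝ X]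
    {g : ℝ → ℝ} (hg : ContDiff ℝ 1 g) {r : ℝ} (hr : 0 < r) {θ : X} (hθ : ‖θ‖ = 1) (v : X) :
    fderiv ℝ (fun x : X => g ‖x‖) (r • θ) v = deriv g r * ⟪v, θ⟫ := by
  have hn : ‖r • θ‖ = r := by rw [norm_smul, hθ, Real.norm_of_nonneg hr.le, mul_one]
  have hx : r • θ ≠ 0 := by rw [← norm_ne_zero_iff, hn]; exact hr.ne'
  have hd : DifferentiableAt ℝ (fun x : X => ‖x‖) (r • θ) :=
    (contDiffAt_norm ℝ hx (n := 1)).differentiableAt one_ne_zero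
  -- The gradient of the norm is read off by comparing two expressions for the derivative of its
  -- square.
  have h1 := (hd.hasFDerivAt.pow 2).fderiv
  have h2 : fderiv ℝ (fun x : X => ‖x‖) (r • θ) v = ⟪v, θ⟫ := by
    have h3 := congrArg (fun L => L v) h1
    simp only [fderiv_norm_sq_apply] at h3
    simp [hn] at h3
    rw [real_inner_comm] at h3
    have : r * ⟪v, θ⟫ = r * fderiv ℝ (fun x : X => ‖x‖) (r • θ) v := by linarith
    exact (mul_left_cancel₀ hr.ne' this).symm
  have hgd : HasDerivAt g (deriv g r) ‖r • θ‖ := by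
    rw [hn]; exact (hg.differentiable one_ne_zero r).hasDerivAt
  have := (hgd.comp_hasFDerivAt (r • θ) hd.hasFDerivAt).fderiv
  have h5 : fderiv ℝ (fun x : X => g ‖x‖) (r • θ) = fderiv ℝ (g ∘ fun x : X => ‖x‖) (r • θ) := rfl
  rw [h5, this]
  simp [h2]

theorem contDiff_flux {u : EuclideanSpace ℝ (Fin d) → EuclideanSpace ℝ (Fin d)}
    (hu : ContDiff ℝ 1 u) : ContDiff ℝ 1 fun r : ℝ =>
      ∫ θ, ⟪u (r • (θ : EuclideanSpace ℝ (Fin d))), (θ : EuclideanSpace ℝ (Fin d))⟫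
        ∂sphereMeasure d := by
  have huc := hu.continuous
  have hud := hu.continuous_fderiv one_ne_zero
  refine contDiff_one_integral_of_compactSpace _
    (f' := fun r θ => (innerSL ℝ (θ : EuclideanSpace ℝ (Fin d))) ∘L
      (fderiv ℝ u (r • (θ : EuclideanSpace ℝ (Fin d)))) ∘L
        (ContinuousLinearMap.toSpanSingleton ℝ (θ : EuclideanSpace ℝ (Fin d)))) ?_ ?_ ?_
  · intro p; fun_prop
  · have h1 : Continuous fun q : ℝ × Metric.sphere (0 : EuclideanSpace ℝ (Fin d)) 1 =>
        fderiv ℝ u (q.1 • (q.2 : EuclideanSpace ℝ (Fin d))) := by fun_prop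
    have h2 : Continuous fun q : ℝ × Metric.sphere (0 : EuclideanSpace ℝ (Fin d)) 1 =>
        innerSL ℝ (q.2 : EuclideanSpace ℝ (Fin d)) := by fun_prop
    have h3 : Continuous fun q : ℝ × Metric.sphere (0 : EuclideanSpace ℝ (Fin d)) 1 =>
        ContinuousLinearMap.toSpanSingleton ℝ (q.2 : EuclideanSpace ℝ (Fin d)) :=
      (ContinuousLinearMap.toSpanSingletonLIE ℝ (EuclideanSpace ℝ (Fin d))).continuous.comp
        (by fun_prop)
    exact h2.clm_comp (h1.clm_comp h3)
  · intro r θ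
    have h1 : HasFDerivAt (fun s : ℝ => s • (θ : EuclideanSpace ℝ (Fin d)))
        (ContinuousLinearMap.toSpanSingleton ℝ (θ : EuclideanSpace ℝ (Fin d))) r :=
      (ContinuousLinearMap.toSpanSingleton ℝ (θ : EuclideanSpace ℝ (Fin d))).hasFDerivAt
    have h2 := ((hu.differentiable one_ne_zero _).hasFDerivAt.comp r h1)
    have h3 := (innerSL ℝ (θ : EuclideanSpace ℝ (Fin d))).hasFDerivAt.comp r h2
    refine h3.congr_of_eventuallyEq (.of_forall fun s => ?_)
    simp [real_inner_comm]

/-- Testing against radial functions `g(|x|)` with `g` supported in `(0,∞)`: integration by parts in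
`ℝ^d`, written in polar coordinates, says that `D` is the weak derivative of the flux `m`. Since `m`
is `C¹` and `D` is continuous, the two derivatives agree at every `r > 0`. This plays the role of
the divergence theorem on balls. -/
theorem hasDerivAt_flux (hd : 1 ≤ d)
    {u : EuclideanSpace ℝ (Fin d) → EuclideanSpace ℝ (Fin d)} (hu : ContDiff ℝ 1 u)
    (hc : HasCompactSupport u) {r : ℝ} (hr : 0 < r) :
    HasDerivAt (fun r : ℝ => r ^ (d - 1) *
      ∫ θ, ⟪u (r • (θ : EuclideanSpace ℝ (Fin d))), (θ : EuclideanSpace ℝ (Fin d))⟫ ∂sphereMeasure d)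
      (r ^ (d - 1) * ∫ θ, euclideanDiv u (r • (θ : EuclideanSpace ℝ (Fin d))) ∂sphereMeasure d)
      r := by
  set m : ℝ → ℝ := fun r => r ^ (d - 1) *
    ∫ θ, ⟪u (r • (θ : EuclideanSpace ℝ (Fin d))), (θ : EuclideanSpace ℝ (Fin d))⟫ ∂sphereMeasure d
    with hm
  set D : ℝ → ℝ := fun r =>
    r ^ (d - 1) * ∫ θ, euclideanDiv u (r • (θ : EuclideanSpace ℝ (Fin d))) ∂sphereMeasure d with hD
  have hmC : ContDiff ℝ 1 m := (contDiff_id.pow _).mul (contDiff_flux hu)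
  have hdiv := continuous_euclideanDiv hu
  have hDc : Continuous D := by
    have h1 : Continuous fun r : ℝ =>
        ∫ θ, euclideanDiv u (r • (θ : EuclideanSpace ℝ (Fin d))) ∂sphereMeasure d := by
      have := continuous_parametric_integral_of_continuous (μ := sphereMeasure d)
        (f := fun (r : ℝ) θ => euclideanDiv u (r • (θ : EuclideanSpace ℝ (Fin d))))
        (by simp only [Function.uncurry_def]; fun_prop)
        (isCompact_univ (X := Metric.sphere (0 : EuclideanSpace ℝ (Fin d)) 1))
      simpa using this
    exact (continuous_pow _).mul h1
  have hmd : Continuous (deriv m) := hmC.continuous_deriv le_rfl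
  have hae : ∀ᵐ s : ℝ, s ∈ Set.Ioi (0 : ℝ) → D s - deriv m s = 0 := by
    refine isOpen_Ioi.ae_eq_zero_of_integral_contDiff_smul_eq_zero
      ((hDc.sub hmd).locallyIntegrable.locallyIntegrableOn _) fun g hg hgc hgs => ?_
    have hg1 : ContDiff ℝ 1 g := hg.of_le (by exact_mod_cast le_top)
    have hgcont := hg1.continuous
    have hgd : Continuous (deriv g) := hg1.continuous_deriv le_rfl
    have hz : ∀ s, s ∉ Set.Ioi (0 : ℝ) → g s = 0 := fun s hs =>
      image_eq_zero_of_notMem_tsupport fun h => hs (hgs h)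
    have hz' : ∀ s, s ∉ Set.Ioi (0 : ℝ) → deriv g s = 0 := fun s hs =>
      image_eq_zero_of_notMem_tsupport fun h => hs (hgs (tsupport_deriv_subset h))
    have hG : ContDiff ℝ 1 fun x : EuclideanSpace ℝ (Fin d) => g ‖x‖ := contDiff_comp_norm hg1 hgs
    have hGd := hG.continuous_fderiv one_ne_zero
    have huc := hu.continuous
    have h1 := integral_mul_euclideanDiv hu hc hG
    have hI1 : Integrable fun x : EuclideanSpace ℝ (Fin d) => g ‖x‖ * euclideanDiv u x :=
      Continuous.integrable_of_hasCompactSupport (by fun_prop)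
        (hasCompactSupport_euclideanDiv hc).mul_left
    have hI2 : Integrable fun x : EuclideanSpace ℝ (Fin d) =>
        fderiv ℝ (fun x : EuclideanSpace ℝ (Fin d) => g ‖x‖) x (u x) := by
      refine Continuous.integrable_of_hasCompactSupport (by fun_prop) (hc.mono fun x hx => ?_)
      contrapose! hx
      simp only [Function.mem_support, not_not] at hx
      simp [hx]
    rw [integral_eq_integral_sphere hd hI1, integral_eq_integral_sphere hd hI2] at h1
    have e1 : ∫ s in Set.Ioi (0 : ℝ), s ^ (d - 1) * ∫ θ, g ‖s • (θ : EuclideanSpace ℝ (Fin d))‖ *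
        euclideanDiv u (s • (θ : EuclideanSpace ℝ (Fin d))) ∂sphereMeasure d =
        ∫ s, g s * D s := by
      rw [← setIntegral_eq_integral_of_forall_compl_eq_zero (s := Set.Ioi (0 : ℝ))
        (f := fun s => g s * D s) (fun s hs => by simp [hz s hs])]
      refine setIntegral_congr_fun measurableSet_Ioi fun s hs => ?_
      have hs0 : (0 : ℝ) < s := hs
      simp only [norm_smul, hD, Real.norm_of_nonneg hs0.le, norm_eq_of_mem_sphere, mul_one]
      rw [integral_const_mul]; ring
    have e2 : ∫ s in Set.Ioi (0 : ℝ), s ^ (d - 1) * ∫ θ, fderiv ℝ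
        (fun x : EuclideanSpace ℝ (Fin d) => g ‖x‖) (s • (θ : EuclideanSpace ℝ (Fin d)))
        (u (s • (θ : EuclideanSpace ℝ (Fin d)))) ∂sphereMeasure d = ∫ s, deriv g s * m s := by
      rw [← setIntegral_eq_integral_of_forall_compl_eq_zero (s := Set.Ioi (0 : ℝ))
        (f := fun s => deriv g s * m s) (fun s hs => by simp [hz' s hs])]
      refine setIntegral_congr_fun measurableSet_Ioi fun s hs => ?_
      have hs0 : (0 : ℝ) < s := hs
      have : ∀ θ : Metric.sphere (0 : EuclideanSpace ℝ (Fin d)) 1, fderiv ℝ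
        (fun x : EuclideanSpace ℝ (Fin d) => g ‖x‖) (s • (θ : EuclideanSpace ℝ (Fin d)))
        (u (s • (θ : EuclideanSpace ℝ (Fin d)))) = deriv g s *
          ⟪u (s • (θ : EuclideanSpace ℝ (Fin d))), (θ : EuclideanSpace ℝ (Fin d))⟫ := fun θ =>
        fderiv_comp_norm_smul hg1 hs0 (by simp) _
      simp only [this, hm]
      rw [integral_const_mul]; ring
    rw [e1, e2] at h1
    have hmc := hmC.continuous
    have h2 := integral_mul_deriv_eq_deriv_mul_of_integrable (u := g) (v := m) (u' := deriv g)
      (v' := deriv m) (fun x _ => (hg1.differentiable one_ne_zero x).hasDerivAt)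
      (fun x _ => (hmC.differentiable one_ne_zero x).hasDerivAt)
      ((hgcont.mul hmd).integrable_of_hasCompactSupport hgc.mul_right)
      ((hgd.mul hmc).integrable_of_hasCompactSupport hgc.deriv.mul_right)
      ((hgcont.mul hmc).integrable_of_hasCompactSupport hgc.mul_right)
    simp only [smul_eq_mul, mul_sub]
    have h3 := integral_sub (μ := volume) ((hgcont.mul hDc).integrable_of_hasCompactSupport hgc.mul_right)
      ((hgcont.mul hmd).integrable_of_hasCompactSupport hgc.mul_right)
    simp only [Pi.mul_apply] at h3
    rw [h3, h1, h2, sub_self]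
  have heq : Set.EqOn (deriv m) D (Set.Ioi 0) := by
    refine Measure.eqOn_open_of_ae_eq (μ := volume) ?_ isOpen_Ioi hmd.continuousOn hDc.continuousOn
    refine (ae_restrict_iff' measurableSet_Ioi).2 ?_
    filter_upwards [hae] with s hs hs0
    linarith [hs hs0]
  have := (hmC.differentiable one_ne_zero r).hasDerivAt
  rwa [heq hr] at this

/-- The integral of the odd function `⟪v, x⟫` over the unit ball is zero, and in polar coordinates
it is `∫₀¹ r^d dr ≠ 0` times the integral over the sphere. -/
theorem integral_sphere_coe (hd : 1 ≤ d) (v : EuclideanSpace ℝ (Fin d)) :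
    ∫ θ, ⟪v, (θ : EuclideanSpace ℝ (Fin d))⟫ ∂sphereMeasure d = 0 := by
  set f : EuclideanSpace ℝ (Fin d) → ℝ :=
    (Metric.closedBall 0 1).indicator fun x => ⟪v, x⟫ with hf
  have hint : Integrable f := by
    rw [hf, integrable_indicator_iff Metric.isClosed_closedBall.measurableSet]
    exact (show Continuous fun x => ⟪v, x⟫ by fun_prop).continuousOn.integrableOn_compact
      (isCompact_closedBall _ _)
  have hodd : ∀ x, f (-x) = - f x := fun x => by
    by_cases hx : ‖x‖ ≤ 1 <;> simp [hf, hx]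
  have h0 : ∫ x, f x = 0 := by
    have := integral_neg_eq_self f volume
    simp only [hodd, integral_neg] at this
    linarith
  rw [integral_eq_integral_sphere hd hint] at h0
  have h1 : ∫ r in Set.Ioi (0 : ℝ), r ^ (d - 1) *
      ∫ θ, f (r • (θ : EuclideanSpace ℝ (Fin d))) ∂sphereMeasure d =
      (∫ r in Set.Ioc (0 : ℝ) 1, r ^ d) *
        ∫ θ, ⟪v, (θ : EuclideanSpace ℝ (Fin d))⟫ ∂sphereMeasure d := by
    rw [← integral_mul_const, ← integral_indicator measurableSet_Ioc,
      ← integral_indicator measurableSet_Ioi]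
    congr 1
    ext1 r
    by_cases h0 : 0 < r
    · by_cases h1 : r ≤ 1
      · have : ∀ θ : Metric.sphere (0 : EuclideanSpace ℝ (Fin d)) 1,
          f (r • (θ : EuclideanSpace ℝ (Fin d))) = r * ⟪v, (θ : EuclideanSpace ℝ (Fin d))⟫ := by
          intro θ
          simp [hf, norm_smul, abs_of_pos h0, h1, inner_smul_right]
        simp only [Set.indicator, Set.mem_Ioi, h0, Set.mem_Ioc, h1, this, integral_const_mul,
          and_self, if_true]
        rw [← mul_assoc, ← pow_succ, Nat.sub_add_cancel hd]
      · have : ∀ θ : Metric.sphere (0 : EuclideanSpace ℝ (Fin d)) 1,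
          f (r • (θ : EuclideanSpace ℝ (Fin d))) = 0 := by
          intro θ
          simp [hf, norm_smul, abs_of_pos h0, h1]
        simp [Set.indicator, h0, h1, this]
    · simp [Set.indicator, h0]
  rw [h1] at h0
  refine (mul_eq_zero.1 h0).resolve_left ?_
  rw [← intervalIntegral.integral_of_le zero_le_one, integral_pow, one_pow,
    zero_pow (Nat.succ_ne_zero d), sub_zero]
  positivity

end Flux

/-! ### Weighted divergences and their spherical averages -/

section Average

variable {d : ℕ} {W : Type*} [NormedAddCommGroup W] [InnerProductSpace ℝ W]

/-- The inclusion `w ↦ (0, w)`. -/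
noncomputable def inrL (V W : Type*) [NormedAddCommGroup V] [NormedSpace ℝ V]
    [NormedAddCommGroup W] [InnerProductSpace ℝ W] : W →L[ℝ] WithLp 2 (V × W) :=
  (WithLp.prodContinuousLinearEquiv 2 ℝ V W).symm.toContinuousLinearMap ∘L
    ContinuousLinearMap.inr ℝ V W

@[simp] theorem inrL_apply {V : Type*} [NormedAddCommGroup V] [NormedSpace ℝ V] (w : W) :
    inrL V W w = WithLp.toLp 2 (0, w) := rfl

/-- The second component of a field on `V × W` together with its partial derivative along `W`. -/
noncomputable def sndJet {V : Type*} [NormedAddCommGroup V] [InnerProductSpace ℝ V]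
    (φ : WithLp 2 (V × W) → WithLp 2 (V × W)) (z : WithLp 2 (V × W)) : W × (W →L[ℝ] W) :=
  ((φ z).snd, WithLp.sndL 2 ℝ V W ∘L fderiv ℝ φ z ∘L inrL V W)

/-- A point `(x, w)` in polar coordinates, `(|x|, w)`. -/
noncomputable def radialPoint (z : SphereSpace d W) : RadialSpace W :=
  WithLp.toLp 2 (‖z.fst‖, z.snd)

/-- The divergence in the first variable. -/
noncomputable def fstDiv (φ : SphereSpace d W → SphereSpace d W) (z : SphereSpace d W) : ℝ :=
  ∑ i : Fin d, (fderiv ℝ φ z (WithLp.toLp 2 (EuclideanSpace.single i 1, 0))).fst i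

/-- The first order operator `A(|x|, w) div_x φ₁ + B(|x|, w)(φ₂, ∂_w φ₂)`. -/
noncomputable def fullDiv (A : RadialSpace W → ℝ) (B : RadialSpace W → (W × (W →L[ℝ] W)) →L[ℝ] ℝ)
    (φ : SphereSpace d W → SphereSpace d W) (z : SphereSpace d W) : ℝ :=
  A (radialPoint z) * fstDiv φ z + B (radialPoint z) (sndJet φ z)

/-- The radial counterpart `A ∂_r(r^{d-1}ψ₁) + r^{d-1} B(ψ₂, ∂_w ψ₂)` of `fullDiv`. -/
noncomputable def radialDiv (d : ℕ) (A : RadialSpace W → ℝ)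
    (B : RadialSpace W → (W × (W →L[ℝ] W)) →L[ℝ] ℝ)
    (ψ : RadialSpace W → RadialSpace W) (p : RadialSpace W) : ℝ :=
  A p * deriv (fun r : ℝ => r ^ (d - 1) * (ψ (WithLp.toLp 2 (r, p.snd))).fst) p.fst +
    p.fst ^ (d - 1) * B p (sndJet ψ p)

theorem continuous_sndJet {V : Type*} [NormedAddCommGroup V] [InnerProductSpace ℝ V]
    {φ : WithLp 2 (V × W) → WithLp 2 (V × W)} (hφ : ContDiff ℝ 1 φ) :
    Continuous (sndJet φ) := by
  have h1 := hφ.continuous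
  have h2 := hφ.continuous_fderiv one_ne_zero
  unfold sndJet
  fun_prop

theorem sndJet_eq_zero {V : Type*} [NormedAddCommGroup V] [InnerProductSpace ℝ V]
    {φ : WithLp 2 (V × W) → WithLp 2 (V × W)} {z : WithLp 2 (V × W)} (hz : z ∉ tsupport φ) :
    sndJet φ z = 0 := by
  have h1 : φ z = 0 := image_eq_zero_of_notMem_tsupport hz
  have h2 : fderiv ℝ φ z = 0 :=
    image_eq_zero_of_notMem_tsupport fun h => hz (tsupport_fderiv_subset ℝ h)
  simp [sndJet, h1, h2]

theorem continuous_fstDiv {φ : SphereSpace d W → SphereSpace d W} (hφ : ContDiff ℝ 1 φ) :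
    Continuous (fstDiv φ) := by
  have h2 := hφ.continuous_fderiv one_ne_zero
  unfold fstDiv
  refine continuous_finsetSum _ fun i _ => ?_
  have h3 : Continuous fun z : SphereSpace d W =>
      (WithLp.fstL 2 ℝ (EuclideanSpace ℝ (Fin d)) W)
        (fderiv ℝ φ z (WithLp.toLp 2 (EuclideanSpace.single i 1, 0))) := by fun_prop
  exact (EuclideanSpace.proj (𝕜 := ℝ) i).continuous.comp h3

theorem fstDiv_eq_zero {φ : SphereSpace d W → SphereSpace d W} {z : SphereSpace d W}
    (hz : z ∉ tsupport φ) : fstDiv φ z = 0 := by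
  have h2 : fderiv ℝ φ z = 0 :=
    image_eq_zero_of_notMem_tsupport fun h => hz (tsupport_fderiv_subset ℝ h)
  simp [fstDiv, h2]

theorem continuous_radialPoint : Continuous (radialPoint (d := d) (W := W)) := by
  unfold radialPoint; fun_prop

section

variable {A : RadialSpace W → ℝ} {B : RadialSpace W → (W × (W →L[ℝ] W)) →L[ℝ] ℝ}

theorem continuous_fullDiv (hA : Continuous A) (hB : Continuous B)
    {φ : SphereSpace d W → SphereSpace d W} (hφ : ContDiff ℝ 1 φ) :
    Continuous (fullDiv A B φ) :=
  ((hA.comp continuous_radialPoint).mul (continuous_fstDiv hφ)).add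
    ((hB.comp continuous_radialPoint).clm_apply (continuous_sndJet hφ))

theorem hasCompactSupport_fullDiv {φ : SphereSpace d W → SphereSpace d W}
    (hc : HasCompactSupport φ) : HasCompactSupport (fullDiv A B φ) := by
  refine HasCompactSupport.intro hc fun z hz => ?_
  simp [fullDiv, fstDiv_eq_zero hz, sndJet_eq_zero hz]

theorem deriv_pow_mul_fst {ψ : RadialSpace W → RadialSpace W} (hψ : ContDiff ℝ 1 ψ) (n : ℕ)
    (p : RadialSpace W) :
    deriv (fun r : ℝ => r ^ n * (ψ (WithLp.toLp 2 (r, p.snd))).fst) p.fst =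
      fderiv ℝ (fun q : RadialSpace W => q.fst ^ n * (ψ q).fst) p (WithLp.toLp 2 (1, 0)) := by
  have h1 : ContDiff ℝ 1 fun q : RadialSpace W => q.fst ^ n * (ψ q).fst :=
    ((WithLp.fstL 2 ℝ ℝ W).contDiff.pow n).mul ((WithLp.fstL 2 ℝ ℝ W).contDiff.comp hψ)
  have h2 : HasDerivAt (fun r : ℝ => (WithLp.toLp 2 (r, p.snd) : RadialSpace W))
      (WithLp.toLp 2 (1, 0)) p.fst := by
    have := ((WithLp.prodContinuousLinearEquiv 2 ℝ ℝ W).symm.toContinuousLinearMap.hasFDerivAt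
      (x := (p.fst, p.snd))).comp_hasDerivAt p.fst
        ((hasDerivAt_id p.fst).prodMk (hasDerivAt_const p.fst p.snd))
    exact this
  have h3 : (WithLp.toLp 2 (p.fst, p.snd) : RadialSpace W) = p := rfl
  have h4 := (h1.differentiable one_ne_zero (WithLp.toLp 2 (p.fst, p.snd))).hasFDerivAt
  have := (h4.comp_hasDerivAt p.fst h2).deriv
  rw [h3] at this
  exact this

theorem continuous_radialDiv (hA : Continuous A) (hB : Continuous B)
    {ψ : RadialSpace W → RadialSpace W} (hψ : ContDiff ℝ 1 ψ) :
    Continuous (radialDiv d A B ψ) := by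
  have h1 : ContDiff ℝ 1 fun q : RadialSpace W => q.fst ^ (d - 1) * (ψ q).fst :=
    ((WithLp.fstL 2 ℝ ℝ W).contDiff.pow _).mul ((WithLp.fstL 2 ℝ ℝ W).contDiff.comp hψ)
  have h2 := h1.continuous_fderiv one_ne_zero
  have h3 := continuous_sndJet hψ
  unfold radialDiv
  simp only [deriv_pow_mul_fst hψ]
  fun_prop

theorem radialDiv_congr {ψ χ : RadialSpace W → RadialSpace W} {p : RadialSpace W}
    (h : ψ =ᶠ[𝓝 p] χ) : radialDiv d A B ψ p = radialDiv d A B χ p := by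
  have h1 : (fun r : ℝ => r ^ (d - 1) * (ψ (WithLp.toLp 2 (r, p.snd))).fst) =ᶠ[𝓝 p.fst]
      fun r : ℝ => r ^ (d - 1) * (χ (WithLp.toLp 2 (r, p.snd))).fst := by
    have hc : ContinuousAt (fun r : ℝ => (WithLp.toLp 2 (r, p.snd) : RadialSpace W)) p.fst := by
      fun_prop
    filter_upwards [hc.eventually h] with r hr
    rw [hr]
  simp only [radialDiv, sndJet, h1.deriv_eq, h.fderiv_eq, h.eq_of_nhds]

theorem radialDiv_eq_zero {ψ : RadialSpace W → RadialSpace W} {p : RadialSpace W}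
    (hp : p ∉ tsupport ψ) : radialDiv d A B ψ p = 0 := by
  rw [radialDiv_congr (notMem_tsupport_iff_eventuallyEq.1 hp)]
  have h0 : ((0, 0) : W × (W →L[ℝ] W)) = 0 := rfl
  simp [radialDiv, sndJet, h0]

theorem hasCompactSupport_radialDiv {ψ : RadialSpace W → RadialSpace W}
    (hc : HasCompactSupport ψ) : HasCompactSupport (radialDiv d A B ψ) :=
  HasCompactSupport.intro hc fun _ hp => radialDiv_eq_zero hp

end

variable [FiniteDimensional ℝ W]

/-- The spherical average of a field on `ℝ^d × W`, a field on `ℝ × W`. -/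
noncomputable def sphereAverage (φ : SphereSpace d W → SphereSpace d W) (p : RadialSpace W) :
    RadialSpace W :=
  ((sphereMeasure d).real Set.univ)⁻¹ • ∫ θ, polarProj W (θ : EuclideanSpace ℝ (Fin d))
    (φ (polarLift W (θ : EuclideanSpace ℝ (Fin d)) p)) ∂sphereMeasure d

variable {φ : SphereSpace d W → SphereSpace d W}

theorem continuous_polarLift_prod :
    Continuous fun q : RadialSpace W × Metric.sphere (0 : EuclideanSpace ℝ (Fin d)) 1 =>
      polarLift W (q.2 : EuclideanSpace ℝ (Fin d)) q.1 :=
  (continuous_polarLift.comp (by fun_prop)).clm_apply continuous_fst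

theorem continuous_average_integrand (hφ : Continuous φ) :
    Continuous fun q : RadialSpace W × Metric.sphere (0 : EuclideanSpace ℝ (Fin d)) 1 =>
      polarProj W (q.2 : EuclideanSpace ℝ (Fin d))
        (φ (polarLift W (q.2 : EuclideanSpace ℝ (Fin d)) q.1)) :=
  (continuous_polarProj.comp (by fun_prop)).clm_apply (hφ.comp continuous_polarLift_prod)

theorem integrable_average_integrand (hφ : Continuous φ) (p : RadialSpace W) :
    Integrable (fun θ : Metric.sphere (0 : EuclideanSpace ℝ (Fin d)) 1 =>
      polarProj W (θ : EuclideanSpace ℝ (Fin d))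
        (φ (polarLift W (θ : EuclideanSpace ℝ (Fin d)) p))) (sphereMeasure d) :=
  ((continuous_average_integrand hφ).comp
    (by fun_prop : Continuous fun θ => (p, θ))).integrable_of_hasCompactSupport
    (HasCompactSupport.of_compactSpace _)

theorem fst_sphereAverage (hφ : Continuous φ) (p : RadialSpace W) :
    (sphereAverage φ p).fst = ((sphereMeasure d).real Set.univ)⁻¹ *
      ∫ θ, ⟪(φ (polarLift W (θ : EuclideanSpace ℝ (Fin d)) p)).fst,
        (θ : EuclideanSpace ℝ (Fin d))⟫ ∂sphereMeasure d := by
  change WithLp.fstL 2 ℝ ℝ W (((sphereMeasure d).real Set.univ)⁻¹ • ∫ θ,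
      polarProj W (θ : EuclideanSpace ℝ (Fin d)) (φ (polarLift W (θ : EuclideanSpace ℝ (Fin d))
        p)) ∂sphereMeasure d) = _
  rw [map_smul, ← ContinuousLinearMap.integral_comp_comm _ (integrable_average_integrand hφ p)]
  simp

theorem contDiff_sphereAverage (hφ : ContDiff ℝ 1 φ) : ContDiff ℝ 1 (sphereAverage φ) :=
  (integral_conj_fderiv (sphereMeasure d) (continuous_polarProj.comp continuous_subtype_val)
    (continuous_polarLift.comp continuous_subtype_val) hφ).1.const_smul _

theorem fderiv_sphereAverage_apply (hφ : ContDiff ℝ 1 φ) (p v : RadialSpace W) :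
    fderiv ℝ (sphereAverage φ) p v = ((sphereMeasure d).real Set.univ)⁻¹ •
      ∫ θ, polarProj W (θ : EuclideanSpace ℝ (Fin d))
        (fderiv ℝ φ (polarLift W (θ : EuclideanSpace ℝ (Fin d)) p)
          (polarLift W (θ : EuclideanSpace ℝ (Fin d)) v)) ∂sphereMeasure d := by
  have h := integral_conj_fderiv (sphereMeasure d)
    (continuous_polarProj.comp continuous_subtype_val)
    (continuous_polarLift.comp continuous_subtype_val) hφ
  have h1 := (((h.1.differentiable one_ne_zero p).hasFDerivAt).const_smul
    ((sphereMeasure d).real Set.univ)⁻¹).fderiv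
  have h2 := congrArg (fun L => L v) h1
  refine h2.trans ?_
  rw [_root_.smul_apply, h.2 p v]
  rfl

theorem polarLift_inrL (θ : EuclideanSpace ℝ (Fin d)) (w : W) :
    polarLift W θ (inrL ℝ W w) = inrL (EuclideanSpace ℝ (Fin d)) W w := by
  rw [polarLift_eq]; simp

/-- Lift and projection act as the identity on the `W` factor, so the second component and its
derivative along `W` are averaged without any twist by `θ`. -/
theorem sndJet_sphereAverage (hφ : ContDiff ℝ 1 φ) (p : RadialSpace W) :
    sndJet (sphereAverage φ) p = ((sphereMeasure d).real Set.univ)⁻¹ •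
      ∫ θ, sndJet φ (polarLift W (θ : EuclideanSpace ℝ (Fin d)) p) ∂sphereMeasure d := by
  have : CompleteSpace W := FiniteDimensional.complete ℝ W
  have hp : Continuous fun θ : Metric.sphere (0 : EuclideanSpace ℝ (Fin d)) 1 => (p, θ) := by
    fun_prop
  have hi0 : Integrable (fun θ : Metric.sphere (0 : EuclideanSpace ℝ (Fin d)) 1 =>
      sndJet φ (polarLift W (θ : EuclideanSpace ℝ (Fin d)) p)) (sphereMeasure d) :=
    (((continuous_sndJet hφ).comp continuous_polarLift_prod).comp hp).integrable_of_hasCompactSupport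
      (HasCompactSupport.of_compactSpace _)
  have hi1 := integrable_average_integrand hφ.continuous p
  refine Prod.ext ?_ ?_
  · rw [Prod.smul_fst, fst_integral hi0]
    change WithLp.sndL 2 ℝ ℝ W (((sphereMeasure d).real Set.univ)⁻¹ • ∫ θ,
      polarProj W (θ : EuclideanSpace ℝ (Fin d)) (φ (polarLift W (θ : EuclideanSpace ℝ (Fin d))
        p)) ∂sphereMeasure d) = _
    rw [map_smul, ← ContinuousLinearMap.integral_comp_comm _ hi1]
    simp [sndJet]
  · rw [Prod.smul_snd, snd_integral hi0]
    ext1 w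
    rw [_root_.smul_apply, ContinuousLinearMap.integral_apply hi0.snd]
    have hi3 : Integrable (fun θ : Metric.sphere (0 : EuclideanSpace ℝ (Fin d)) 1 =>
        polarProj W (θ : EuclideanSpace ℝ (Fin d))
          (fderiv ℝ φ (polarLift W (θ : EuclideanSpace ℝ (Fin d)) p)
            (polarLift W (θ : EuclideanSpace ℝ (Fin d)) (inrL ℝ W w)))) (sphereMeasure d) := by
      refine Continuous.integrable_of_hasCompactSupport ?_ (HasCompactSupport.of_compactSpace _)
      exact (continuous_polarProj.comp continuous_subtype_val).clm_apply
        ((((hφ.continuous_fderiv one_ne_zero).comp continuous_polarLift_prod).comp hp).clm_apply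
          ((continuous_polarLift.comp continuous_subtype_val).clm_apply continuous_const))
    change WithLp.sndL 2 ℝ ℝ W (fderiv ℝ (sphereAverage φ) p (inrL ℝ W w)) = _
    rw [fderiv_sphereAverage_apply hφ, map_smul, ← ContinuousLinearMap.integral_comp_comm _ hi3]
    simp [sndJet, polarLift_inrL, - inrL_apply]

/-- With `w` frozen, the radial component of the mean is the normalized flux of the slice `x ↦ φ₁(x,
w)`, so the flux identity on `ℝ^d` applies. -/
theorem deriv_flux_sphereAverage (hd : 1 ≤ d) (hφ : ContDiff ℝ 1 φ) (hc : HasCompactSupport φ)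
    {p : RadialSpace W} (hp : 0 < p.fst) :
    deriv (fun r : ℝ => r ^ (d - 1) * (sphereAverage φ (WithLp.toLp 2 (r, p.snd))).fst) p.fst =
      ((sphereMeasure d).real Set.univ)⁻¹ * (p.fst ^ (d - 1) *
        ∫ θ, fstDiv φ (polarLift W (θ : EuclideanSpace ℝ (Fin d)) p) ∂sphereMeasure d) := by
  set u : EuclideanSpace ℝ (Fin d) → EuclideanSpace ℝ (Fin d) :=
    fun x => (φ (WithLp.toLp 2 (x, p.snd))).fst with hu
  have hj : ContDiff ℝ 1 fun x : EuclideanSpace ℝ (Fin d) =>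
      (WithLp.toLp 2 (x, p.snd) : SphereSpace d W) :=
    (WithLp.prodContinuousLinearEquiv 2 ℝ (EuclideanSpace ℝ (Fin d)) W).symm.contDiff.comp
      (contDiff_id.prodMk contDiff_const)
  have huC : ContDiff ℝ 1 u := (WithLp.fstL 2 ℝ (EuclideanSpace ℝ (Fin d)) W).contDiff.comp
    (hφ.comp hj)
  have huc : HasCompactSupport u := by
    refine HasCompactSupport.intro (hc.isCompact.image
      (WithLp.fstL 2 ℝ (EuclideanSpace ℝ (Fin d)) W).continuous) fun x hx => ?_
    have : φ (WithLp.toLp 2 (x, p.snd)) = 0 := by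
      refine image_eq_zero_of_notMem_tsupport fun h => hx ⟨_, h, rfl⟩
    simp [hu, this]
  have h := hasDerivAt_flux hd huC huc hp
  have hdiv : ∀ θ : Metric.sphere (0 : EuclideanSpace ℝ (Fin d)) 1,
      euclideanDiv u (p.fst • (θ : EuclideanSpace ℝ (Fin d))) =
        fstDiv φ (polarLift W (θ : EuclideanSpace ℝ (Fin d)) p) := by
    intro θ
    rw [polarLift_eq]
    refine Finset.sum_congr rfl fun i _ => ?_
    set x := p.fst • (θ : EuclideanSpace ℝ (Fin d))
    have h1 : HasFDerivAt (fun x : EuclideanSpace ℝ (Fin d) =>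
        (WithLp.toLp 2 (x, p.snd) : SphereSpace d W)) _ x :=
      ((WithLp.prodContinuousLinearEquiv 2 ℝ (EuclideanSpace ℝ (Fin d))
        W).symm.toContinuousLinearMap.hasFDerivAt (x := (x, p.snd))).comp x
        (HasFDerivAt.prodMk (f₁ := fun x => x) (hasFDerivAt_id x) (hasFDerivAt_const p.snd x))
    have h2 := ((WithLp.fstL 2 ℝ (EuclideanSpace ℝ (Fin d)) W).hasFDerivAt.comp x
      ((hφ.differentiable one_ne_zero _).hasFDerivAt.comp x h1)).fderiv
    change fderiv ℝ u x = _ at h2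
    rw [h2]
    rfl
  have hfst : ∀ r : ℝ, (sphereAverage φ (WithLp.toLp 2 (r, p.snd))).fst =
      ((sphereMeasure d).real Set.univ)⁻¹ * ∫ θ, ⟪u (r • (θ : EuclideanSpace ℝ (Fin d))),
        (θ : EuclideanSpace ℝ (Fin d))⟫ ∂sphereMeasure d := by
    intro r
    rw [fst_sphereAverage hφ.continuous]
    simp [hu, polarLift_eq]
  simp only [hfst, ← hdiv]
  have h' := h.const_mul ((sphereMeasure d).real Set.univ)⁻¹
  rw [← h'.deriv]
  congr 1
  ext1 r
  ring

theorem norm_sphereAverage_le (hd : 1 ≤ d) (hb : ∀ z, ‖φ z‖ ≤ 1) (p : RadialSpace W) :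
    ‖sphereAverage φ p‖ ≤ 1 := by
  have : Nonempty (Fin d) := ⟨⟨0, hd⟩⟩
  have hpos : 0 < (sphereMeasure d).real Set.univ := by
    have : sphereMeasure d ≠ 0 := Measure.toSphere_ne_zero _
    have h2 : NeZero (sphereMeasure d) := ⟨this⟩
    exact measureReal_univ_pos
  have h := norm_integral_le_of_norm_le_const (μ := sphereMeasure d) (C := 1)
    (.of_forall fun θ => (norm_polarProj_le θ
      (φ (polarLift W (θ : EuclideanSpace ℝ (Fin d)) p))).trans (hb _))
  rw [sphereAverage, norm_smul, norm_inv, Real.norm_of_nonneg hpos.le, inv_mul_le_iff₀ hpos]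
  simpa using h

/-- The support of the mean may reach `r ≤ 0`; only compactness and the projection to `W` are
controlled. The latter is what preserves a constraint of the form `w ∈ O`. -/
theorem tsupport_sphereAverage_subset (hc : HasCompactSupport φ) :
    ∃ K : Set (RadialSpace W), IsCompact K ∧ tsupport (sphereAverage φ) ⊆ K ∧
      ∀ p ∈ K, ∃ z ∈ tsupport φ, z.snd = p.snd := by
  obtain ⟨R, hR⟩ := hc.isCompact.isBounded.exists_norm_le
  set K0 : Set (ℝ × W) := Set.Icc (-R) R ×ˢ
    ((WithLp.sndL 2 ℝ (EuclideanSpace ℝ (Fin d)) W) '' tsupport φ) with hK0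
  have hK0c : IsCompact K0 := isCompact_Icc.prod
    (hc.isCompact.image (WithLp.sndL 2 ℝ (EuclideanSpace ℝ (Fin d)) W).continuous)
  have hKc : IsCompact ((WithLp.prodContinuousLinearEquiv 2 ℝ ℝ W).symm '' K0) :=
    hK0c.image (WithLp.prodContinuousLinearEquiv 2 ℝ ℝ W).symm.continuous
  refine ⟨_, hKc, ?_, ?_⟩
  · refine closure_minimal (fun p hp => ?_) hKc.isClosed
    have hex : ∃ θ : Metric.sphere (0 : EuclideanSpace ℝ (Fin d)) 1,
        φ (polarLift W (θ : EuclideanSpace ℝ (Fin d)) p) ≠ 0 := by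
      by_contra! hcon
      exact hp (by simp [sphereAverage, hcon])
    obtain ⟨θ, hθ⟩ := hex
    have hmem : polarLift W (θ : EuclideanSpace ℝ (Fin d)) p ∈ tsupport φ :=
      subset_tsupport _ hθ
    refine ⟨(p.fst, p.snd), ⟨?_, _, hmem, by simp⟩, rfl⟩
    have h1 := hR _ hmem
    have h2 : ‖(polarLift W (θ : EuclideanSpace ℝ (Fin d)) p).fst‖ ≤ R := by
      refine le_trans ?_ h1
      rw [WithLp.prod_norm_eq_of_L2]
      exact Real.le_sqrt_of_sq_le (by nlinarith [sq_nonneg ‖(polarLift W (θ : EuclideanSpace ℝ (Fin d)) p).snd‖])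
    simp only [polarLift_fst, norm_smul, norm_eq_of_mem_sphere, mul_one, Real.norm_eq_abs] at h2
    exact abs_le.1 h2
  · rintro _ ⟨q, ⟨-, z, hz, hzq⟩, rfl⟩
    exact ⟨z, hz, hzq⟩

theorem sphereAverage_fst_zero (hd : 1 ≤ d) (hφ : ContDiff ℝ 1 φ) (w : W) :
    (sphereAverage φ (WithLp.toLp 2 (0, w))).fst = 0 := by
  rw [fst_sphereAverage hφ.continuous]
  simp [polarLift_eq, integral_sphere_coe hd]

/-- The radial component vanishes at `r = 0`, and the mean is Lipschitz, being `C¹` with compact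
support. This linear decay absorbs the factor `n` in the derivative of the cutoff. -/
theorem exists_fst_sphereAverage_le (hd : 1 ≤ d) (hφ : ContDiff ℝ 1 φ) (hc : HasCompactSupport φ) :
    ∃ C : ℝ, 0 ≤ C ∧ ∀ p, |(sphereAverage φ p).fst| ≤ C * |p.fst| := by
  obtain ⟨K, hK, hsub, -⟩ := tsupport_sphereAverage_subset hc
  have hcs : HasCompactSupport (sphereAverage φ) := hK.of_isClosed_subset (isClosed_tsupport _) hsub
  obtain ⟨C, hC⟩ := (contDiff_sphereAverage hφ).lipschitzWith_of_hasCompactSupport hcs one_ne_zero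
  refine ⟨C, C.2, fun p => ?_⟩
  have h1 := hC.dist_le_mul p (WithLp.toLp 2 (0, p.snd))
  have h2 := sphereAverage_fst_zero hd hφ p.snd
  have h3 : ‖p - WithLp.toLp 2 (0, p.snd)‖ = |p.fst| := by
    rw [WithLp.prod_norm_eq_of_L2]
    simp [Real.sqrt_sq_eq_abs]
  rw [dist_eq_norm, dist_eq_norm, h3] at h1
  refine le_trans ?_ h1
  rw [WithLp.prod_norm_eq_of_L2]
  refine Real.le_sqrt_of_sq_le ?_
  rw [WithLp.sub_fst, h2, sub_zero, Real.norm_eq_abs]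
  exact le_add_of_nonneg_right (sq_nonneg _)

variable {A : RadialSpace W → ℝ} {B : RadialSpace W → (W × (W →L[ℝ] W)) →L[ℝ] ℝ}

/-- The coefficients depend only on `(|x|, w)`, hence are constant on the sphere of integration.
What remains is the flux identity for the first component and plain averaging of the jet of the
second. -/
theorem radialDiv_sphereAverage (hd : 1 ≤ d) (hφ : ContDiff ℝ 1 φ) (hc : HasCompactSupport φ)
    {p : RadialSpace W} (hp : 0 < p.fst) :
    p.fst ^ (d - 1) *
      ∫ θ, fullDiv A B φ (polarLift W (θ : EuclideanSpace ℝ (Fin d)) p) ∂sphereMeasure d =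
      (sphereMeasure d).real Set.univ * radialDiv d A B (sphereAverage φ) p := by
  have : Nonempty (Fin d) := ⟨⟨0, hd⟩⟩
  have : CompleteSpace W := FiniteDimensional.complete ℝ W
  have hpos : 0 < (sphereMeasure d).real Set.univ := by
    have : sphereMeasure d ≠ 0 := Measure.toSphere_ne_zero _
    have h2 : NeZero (sphereMeasure d) := ⟨this⟩
    exact measureReal_univ_pos
  have hrad : ∀ θ : Metric.sphere (0 : EuclideanSpace ℝ (Fin d)) 1,
      radialPoint (polarLift W (θ : EuclideanSpace ℝ (Fin d)) p) = p := by
    intro θ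
    have h3 : (WithLp.toLp 2 (p.fst, p.snd) : RadialSpace W) = p := rfl
    simp [radialPoint, norm_smul, abs_of_pos hp, h3]
  have hcp : Continuous fun θ : Metric.sphere (0 : EuclideanSpace ℝ (Fin d)) 1 => (p, θ) := by
    fun_prop
  have hi0 : Integrable (fun θ : Metric.sphere (0 : EuclideanSpace ℝ (Fin d)) 1 =>
      sndJet φ (polarLift W (θ : EuclideanSpace ℝ (Fin d)) p)) (sphereMeasure d) :=
    (((continuous_sndJet hφ).comp continuous_polarLift_prod).comp hcp).integrable_of_hasCompactSupport
      (HasCompactSupport.of_compactSpace _)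
  have hi1 : Integrable (fun θ : Metric.sphere (0 : EuclideanSpace ℝ (Fin d)) 1 =>
      fstDiv φ (polarLift W (θ : EuclideanSpace ℝ (Fin d)) p)) (sphereMeasure d) :=
    (((continuous_fstDiv hφ).comp continuous_polarLift_prod).comp hcp).integrable_of_hasCompactSupport
      (HasCompactSupport.of_compactSpace _)
  simp only [fullDiv, radialDiv, hrad]
  rw [deriv_flux_sphereAverage hd hφ hc hp, sndJet_sphereAverage hφ, map_smul,
    ← ContinuousLinearMap.integral_comp_comm _ hi0,
    integral_add (hi1.const_mul _) ((B p).integrable_comp hi0), integral_const_mul, smul_eq_mul]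
  field_simp

end Average

/-! ### Reduction of suprema over fields to radial fields -/

section Reduction

variable {d : ℕ} {W : Type*} [NormedAddCommGroup W] [InnerProductSpace ℝ W]

theorem sphereMeasure_real_univ :
    (sphereMeasure d).real Set.univ = d * unitBallVolume d := by
  rw [Measure.toSphere_real_apply_univ, finrank_euclideanSpace_fin]
  rfl

/-- The field on `ℝ^d × W` with radial first component induced by a field on `(0,∞) × W`. -/
noncomputable def radialLift (ψ : RadialSpace W → RadialSpace W) (z : SphereSpace d W) :
    SphereSpace d W :=
  WithLp.toLp 2 ((ψ (radialPoint z)).fst • (‖z.fst‖⁻¹ • z.fst), (ψ (radialPoint z)).snd)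

theorem radialPoint_polarLift (θ : Metric.sphere (0 : EuclideanSpace ℝ (Fin d)) 1)
    {p : RadialSpace W} (hp : 0 ≤ p.fst) :
    radialPoint (polarLift W (θ : EuclideanSpace ℝ (Fin d)) p) = p := by
  have h3 : (WithLp.toLp 2 (p.fst, p.snd) : RadialSpace W) = p := rfl
  simp [radialPoint, norm_smul, abs_of_nonneg hp, h3]

theorem norm_radialLift_le {ψ : RadialSpace W → RadialSpace W} (hb : ∀ p, ‖ψ p‖ ≤ 1)
    (z : SphereSpace d W) : ‖radialLift ψ z‖ ≤ 1 := by
  refine le_trans ?_ (hb (radialPoint z))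
  rw [WithLp.prod_norm_eq_of_L2, WithLp.prod_norm_eq_of_L2]
  apply Real.sqrt_le_sqrt
  have h1 : ‖(radialLift ψ z).fst‖ ≤ ‖(ψ (radialPoint z)).fst‖ := by
    have h2 : ‖z.fst‖⁻¹ * ‖z.fst‖ ≤ 1 := inv_mul_le_one
    change ‖(ψ (radialPoint z)).fst • (‖z.fst‖⁻¹ • z.fst)‖ ≤ _
    rw [norm_smul, norm_smul, norm_inv, norm_norm]
    exact mul_le_of_le_one_right (norm_nonneg _) h2
  have h3 : ‖(radialLift ψ z).snd‖ = ‖(ψ (radialPoint z)).snd‖ := rfl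
  rw [h3]
  gcongr

theorem tsupport_radialLift_subset (ψ : RadialSpace W → RadialSpace W) :
    tsupport (radialLift (d := d) ψ) ⊆ radialPoint ⁻¹' tsupport ψ := by
  refine closure_minimal (fun z hz => ?_) ((isClosed_tsupport _).preimage continuous_radialPoint)
  by_contra hcon
  exact hz (by simp [radialLift, image_eq_zero_of_notMem_tsupport hcon])

/-- The direction `x/|x|` is singular only at `x = 0`, and the lifted field vanishes near that set
because the support of `ψ` stays in `r > 0`. -/
theorem contDiff_radialLift {ψ : RadialSpace W → RadialSpace W} (hψ : ContDiff ℝ 1 ψ)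
    (hs : ∀ p ∈ tsupport ψ, 0 < p.fst) : ContDiff ℝ 1 (radialLift (d := d) ψ) := by
  rw [contDiff_iff_contDiffAt]
  intro z
  rcases eq_or_ne z.fst 0 with hz | hz
  · have h1 : z ∉ tsupport (radialLift (d := d) ψ) := fun h => by
      have := hs _ (tsupport_radialLift_subset ψ h)
      simp [radialPoint, hz] at this
    exact contDiffAt_const.congr_of_eventuallyEq (notMem_tsupport_iff_eventuallyEq.1 h1)
  · have hf : ContDiffAt ℝ 1 (fun z : SphereSpace d W => z.fst) z :=
      (WithLp.fstL 2 ℝ (EuclideanSpace ℝ (Fin d)) W).contDiff.contDiffAt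
    have hsnd : ContDiffAt ℝ 1 (fun z : SphereSpace d W => z.snd) z :=
      (WithLp.sndL 2 ℝ (EuclideanSpace ℝ (Fin d)) W).contDiff.contDiffAt
    have hn : ContDiffAt ℝ 1 (fun z : SphereSpace d W => ‖z.fst‖) z := hf.norm ℝ hz
    have hrad : ContDiffAt ℝ 1 (radialPoint (d := d) (W := W)) z :=
      (WithLp.prodContinuousLinearEquiv 2 ℝ ℝ W).symm.contDiff.contDiffAt.comp z (hn.prodMk hsnd)
    have hc : ContDiffAt ℝ 1 (fun z : SphereSpace d W => ψ (radialPoint z)) z :=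
      hψ.contDiffAt.comp z hrad
    have hc1 : ContDiffAt ℝ 1 (fun z : SphereSpace d W => (ψ (radialPoint z)).fst) z :=
      (WithLp.fstL 2 ℝ ℝ W).contDiff.contDiffAt.comp z hc
    have hc2 : ContDiffAt ℝ 1 (fun z : SphereSpace d W => (ψ (radialPoint z)).snd) z :=
      (WithLp.sndL 2 ℝ ℝ W).contDiff.contDiffAt.comp z hc
    exact (WithLp.prodContinuousLinearEquiv 2 ℝ
      (EuclideanSpace ℝ (Fin d)) W).symm.contDiff.contDiffAt.comp z
      ((hc1.smul ((hn.inv (norm_ne_zero_iff.2 hz)).smul hf)).prodMk hc2)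

variable [FiniteDimensional ℝ W]

theorem hasCompactSupport_radialLift {ψ : RadialSpace W → RadialSpace W}
    (hc : HasCompactSupport ψ) : HasCompactSupport (radialLift (d := d) ψ) := by
  obtain ⟨R, hR⟩ := hc.isCompact.isBounded.exists_norm_le
  have : ProperSpace (SphereSpace d W) := FiniteDimensional.proper ℝ _
  refine (isCompact_closedBall (0 : SphereSpace d W) R).of_isClosed_subset (isClosed_tsupport _)
    fun z hz => ?_
  have h1 := hR _ (tsupport_radialLift_subset ψ hz)
  have h2 : ‖radialPoint z‖ = ‖z‖ := by
    rw [WithLp.prod_norm_eq_of_L2, WithLp.prod_norm_eq_of_L2]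
    simp [radialPoint]
  simpa [h2] using h1

theorem radialLift_mem_testFields {O : Set W} {ψ : RadialSpace W → RadialSpace W}
    (hψ : ψ ∈ testFields (W := RadialSpace W) {p : RadialSpace W | 0 < p.fst ∧ p.snd ∈ O}) :
    radialLift ψ ∈ testFields (W := SphereSpace d W) {z : SphereSpace d W | z.snd ∈ O} :=
  ⟨contDiff_radialLift hψ.1 fun p hp => (hψ.2.2.1 hp).1, hasCompactSupport_radialLift hψ.2.1,
    fun z hz => (hψ.2.2.1 (tsupport_radialLift_subset ψ hz)).2, norm_radialLift_le hψ.2.2.2⟩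

/-- Averaging inverts lifting on `r > 0`, so the integral identity for means also handles the fields
that come from the reduced space. -/
theorem sphereAverage_radialLift (hd : 1 ≤ d) (ψ : RadialSpace W → RadialSpace W)
    {p : RadialSpace W} (hp : 0 < p.fst) :
    sphereAverage (radialLift (d := d) ψ) p = ψ p := by
  have : Nonempty (Fin d) := ⟨⟨0, hd⟩⟩
  have hpos : 0 < (sphereMeasure d).real Set.univ := by
    have : sphereMeasure d ≠ 0 := Measure.toSphere_ne_zero _
    have h2 : NeZero (sphereMeasure d) := ⟨this⟩
    exact measureReal_univ_pos
  have h : ∀ θ : Metric.sphere (0 : EuclideanSpace ℝ (Fin d)) 1,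
      polarProj W (θ : EuclideanSpace ℝ (Fin d)) (radialLift ψ
        (polarLift W (θ : EuclideanSpace ℝ (Fin d)) p)) = ψ p := by
    intro θ
    have h3 : (WithLp.toLp 2 ((ψ p).fst, (ψ p).snd) : RadialSpace W) = ψ p := rfl
    rw [polarProj_eq]
    simp [radialLift, radialPoint_polarLift θ hp.le, norm_smul, abs_of_pos hp, inner_smul_left,
      smul_smul, hp.ne', h3]
  simp only [sphereAverage, h, integral_const, smul_smul]
  rw [inv_mul_cancel₀ hpos.ne', one_smul]

variable [MeasurableSpace W] [BorelSpace W]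
  {A : RadialSpace W → ℝ} {B : RadialSpace W → (W × (W →L[ℝ] W)) →L[ℝ] ℝ}
  {E : Set (SphereSpace d W)} {F : Set (RadialSpace W)}

theorem setIntegral_fullDiv_eq (hd : 1 ≤ d) (hA : Continuous A) (hB : Continuous B)
    (hE : NullMeasurableSet E volume) (hF : ∀ p ∈ F, 0 ≤ p.fst)
    (hEF : E = {z | WithLp.toLp 2 (‖z.fst‖, z.snd) ∈ F})
    {φ : SphereSpace d W → SphereSpace d W} (hφ : ContDiff ℝ 1 φ) (hc : HasCompactSupport φ) :
    ∫ z in E, fullDiv A B φ z =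
      (d * unitBallVolume d) * ∫ p in F, radialDiv d A B (sphereAverage φ) p := by
  rw [setIntegral_eq_setIntegral_sphere hd hE hF hEF
    ((continuous_fullDiv hA hB hφ).integrable_of_hasCompactSupport (hasCompactSupport_fullDiv hc)),
    ← integral_const_mul, ← sphereMeasure_real_univ]
  refine setIntegral_congr_ae₀ (nullMeasurableSet_generating hd hE hF hEF) ?_
  filter_upwards [ae_fst_ne_zero (W := W)] with p hp hpF
  exact radialDiv_sphereAverage hd hφ hc (lt_of_le_of_ne (hF p hpF) hp.symm)

/-- At `t = n r - 1` the expression is `r χ_n'(r)` for the cutoff `χ_n(r) = smoothTransition (n r -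
1)`, so the bound is uniform in `n`. -/
theorem exists_bound_deriv_smoothTransition :
    ∃ M : ℝ, ∀ t : ℝ, |deriv Real.smoothTransition t * (t + 1)| ≤ M := by
  have hC : ContDiff ℝ 1 Real.smoothTransition := Real.smoothTransition.contDiff
  have h1 : Continuous fun t => deriv Real.smoothTransition t * (t + 1) := by
    have := hC.continuous_deriv le_rfl
    fun_prop
  have h2 : HasCompactSupport fun t => deriv Real.smoothTransition t * (t + 1) := by
    refine HasCompactSupport.intro (isCompact_Icc (a := (0 : ℝ)) (b := 1)) fun t ht => ?_
    rw [Set.mem_Icc, not_and_or, not_le, not_le] at ht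
    have : deriv Real.smoothTransition t = 0 := by
      rcases ht with ht | ht
      · have : Real.smoothTransition =ᶠ[𝓝 t] fun _ => 0 := by
          filter_upwards [eventually_lt_nhds ht] with s hs
          exact Real.smoothTransition.zero_of_nonpos hs.le
        rw [this.deriv_eq, deriv_const]
      · have : Real.smoothTransition =ᶠ[𝓝 t] fun _ => 1 := by
          filter_upwards [eventually_gt_nhds ht] with s hs
          exact Real.smoothTransition.one_of_one_le hs.le
        rw [this.deriv_eq, deriv_const]
    simp [this]
  obtain ⟨M, hM⟩ := h2.exists_bound_of_continuous h1
  exact ⟨M, hM⟩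

/-- A smooth cutoff, equal to `0` for `r ≤ 1/n` and to `1` for `r ≥ 2/n`. -/
noncomputable def radialCutoff (n : ℕ) (r : ℝ) : ℝ := Real.smoothTransition (n * r - 1)

theorem contDiff_radialCutoff (n : ℕ) : ContDiff ℝ 1 (radialCutoff n) :=
  (Real.smoothTransition.contDiff (n := 1)).comp (by fun_prop)

theorem deriv_radialCutoff (n : ℕ) (r : ℝ) :
    deriv (radialCutoff n) r = n * deriv Real.smoothTransition (n * r - 1) := by
  have hC : ContDiff ℝ 1 Real.smoothTransition := Real.smoothTransition.contDiff
  have h1 : HasDerivAt (fun r : ℝ => (n : ℝ) * r - 1) n r := by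
    simpa using ((hasDerivAt_id r).const_mul (n : ℝ)).sub_const 1
  have := ((hC.differentiable one_ne_zero (n * r - 1)).hasDerivAt.comp r h1).deriv
  change deriv (radialCutoff n) r = _ at this
  rw [this, mul_comm]

/-- The cut off field `χ_n(r) ψ`. -/
noncomputable def cutoffField (n : ℕ) (ψ : RadialSpace W → RadialSpace W) (p : RadialSpace W) :
    RadialSpace W := radialCutoff n p.fst • ψ p

theorem contDiff_cutoffField (n : ℕ) {ψ : RadialSpace W → RadialSpace W} (hψ : ContDiff ℝ 1 ψ) :
    ContDiff ℝ 1 (cutoffField n ψ) :=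
  ((contDiff_radialCutoff n).comp (WithLp.fstL 2 ℝ ℝ W).contDiff).smul hψ

theorem sndJet_cutoffField (n : ℕ) {ψ : RadialSpace W → RadialSpace W} (hψ : ContDiff ℝ 1 ψ)
    (p : RadialSpace W) :
    sndJet (cutoffField n ψ) p = radialCutoff n p.fst • sndJet ψ p := by
  have h1 : HasFDerivAt (fun q : RadialSpace W => radialCutoff n q.fst)
      (deriv (radialCutoff n) p.fst • WithLp.fstL 2 ℝ ℝ W) p :=
    ((contDiff_radialCutoff n).differentiable one_ne_zero p.fst).hasDerivAt.comp_hasFDerivAt p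
      (WithLp.fstL 2 ℝ ℝ W).hasFDerivAt
  have h2 := (h1.smul (hψ.differentiable one_ne_zero p).hasFDerivAt).fderiv
  change fderiv ℝ (cutoffField n ψ) p = _ at h2
  refine Prod.ext rfl ?_
  ext1 w
  simp [sndJet, h2]

theorem radialDiv_cutoffField (n : ℕ) {ψ : RadialSpace W → RadialSpace W} (hψ : ContDiff ℝ 1 ψ)
    (p : RadialSpace W) :
    radialDiv d A B (cutoffField n ψ) p = radialCutoff n p.fst * radialDiv d A B ψ p +
      A p * p.fst ^ (d - 1) * (deriv (radialCutoff n) p.fst * (ψ p).fst) := by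
  have h0 : (WithLp.toLp 2 (p.fst, p.snd) : RadialSpace W) = p := rfl
  have h1 : HasDerivAt (radialCutoff n) (deriv (radialCutoff n) p.fst) p.fst :=
    ((contDiff_radialCutoff n).differentiable one_ne_zero p.fst).hasDerivAt
  have h2 : DifferentiableAt ℝ (fun r : ℝ => r ^ (d - 1) * (ψ (WithLp.toLp 2 (r, p.snd))).fst)
      p.fst := by
    have hj : ContDiff ℝ 1 fun r : ℝ => (WithLp.toLp 2 (r, p.snd) : RadialSpace W) :=
      (WithLp.prodContinuousLinearEquiv 2 ℝ ℝ W).symm.contDiff.comp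
        (contDiff_id.prodMk contDiff_const)
    have : ContDiff ℝ 1 fun r : ℝ => r ^ (d - 1) * (ψ (WithLp.toLp 2 (r, p.snd))).fst :=
      (contDiff_id.pow _).mul ((WithLp.fstL 2 ℝ ℝ W).contDiff.comp (hψ.comp hj))
    exact this.differentiable one_ne_zero _
  have h3 := (h1.mul h2.hasDerivAt).deriv
  have h4 : (fun r : ℝ => r ^ (d - 1) * (cutoffField n ψ (WithLp.toLp 2 (r, p.snd))).fst) =
      radialCutoff n * fun r : ℝ => r ^ (d - 1) * (ψ (WithLp.toLp 2 (r, p.snd))).fst := by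
    ext1 r
    simp [cutoffField]
    ring
  simp only [radialDiv, sndJet_cutoffField n hψ, h4, h3, h0, map_smul, smul_eq_mul]
  ring

theorem radialCutoff_nonneg (n : ℕ) (r : ℝ) : 0 ≤ radialCutoff n r :=
  Real.smoothTransition.nonneg _

theorem radialCutoff_le_one (n : ℕ) (r : ℝ) : radialCutoff n r ≤ 1 :=
  Real.smoothTransition.le_one _

theorem cutoffField_mem_testFields (hd : 1 ≤ d) {O : Set W}
    {φ : SphereSpace d W → SphereSpace d W}
    (hφ : φ ∈ testFields (W := SphereSpace d W) {z : SphereSpace d W | z.snd ∈ O}) (n : ℕ) :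
    cutoffField n (sphereAverage φ) ∈
      testFields (W := RadialSpace W) {p : RadialSpace W | 0 < p.fst ∧ p.snd ∈ O} := by
  obtain ⟨K, hK, hsub, hKφ⟩ := tsupport_sphereAverage_subset hφ.2.1
  have h1 : tsupport (cutoffField n (sphereAverage φ)) ⊆ K := by
    refine closure_minimal (fun p hp => hsub (subset_tsupport _ fun h => hp ?_)) hK.isClosed
    simp [cutoffField, h]
  -- For `n = 0` this closed set is empty and the cutoff is identically zero, so every `n` is
  -- admissible.
  have h2 : tsupport (cutoffField n (sphereAverage φ)) ⊆ {p | 1 ≤ n * p.fst} := by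
    refine closure_minimal (fun p hp => ?_) (isClosed_le continuous_const (by fun_prop))
    by_contra hcon
    refine hp ?_
    have : radialCutoff n p.fst = 0 := Real.smoothTransition.zero_of_nonpos (by
      simp only [Set.mem_ofPred_eq, not_le] at hcon; linarith)
    simp [cutoffField, this]
  refine ⟨contDiff_cutoffField n (contDiff_sphereAverage hφ.1),
    hK.of_isClosed_subset (isClosed_tsupport _) h1, fun p hp => ⟨?_, ?_⟩, fun p => ?_⟩
  · have h3 : 1 ≤ n * p.fst := h2 hp
    by_contra! hcon
    nlinarith [(Nat.cast_nonneg n : (0 : ℝ) ≤ n)]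
  · obtain ⟨z, hz, hzp⟩ := hKφ p (h1 hp)
    rw [← hzp]
    exact hφ.2.2.1 hz
  · rw [cutoffField, norm_smul, Real.norm_of_nonneg (radialCutoff_nonneg n _)]
    exact mul_le_one₀ (radialCutoff_le_one n _) (norm_nonneg _)
      (norm_sphereAverage_le hd hφ.2.2.2 p)

/-- The error term is dominated by `|A r^{d-1}| C M` on the support of the mean, by linear decay of
the radial component and the uniform bound on `r χ_n'`. At a fixed `r > 0` the cutoff is eventually
`1` near `r`, so the error is eventually zero there. -/
theorem tendsto_setIntegral_radialDiv_cutoffField (hd : 1 ≤ d) (hA : Continuous A)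
    (hB : Continuous B) (hF : ∀ p ∈ F, 0 ≤ p.fst) (hFm : NullMeasurableSet F volume)
    {φ : SphereSpace d W → SphereSpace d W} (hφ : ContDiff ℝ 1 φ) (hc : HasCompactSupport φ) :
    Filter.Tendsto (fun n => ∫ p in F, radialDiv d A B (cutoffField n (sphereAverage φ)) p)
      Filter.atTop (𝓝 (∫ p in F, radialDiv d A B (sphereAverage φ) p)) := by
  have hψ := contDiff_sphereAverage hφ
  have hψc : HasCompactSupport (sphereAverage φ) := by
    obtain ⟨K, hK, hsub, -⟩ := tsupport_sphereAverage_subset hc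
    exact hK.of_isClosed_subset (isClosed_tsupport _) hsub
  obtain ⟨C, hC0, hC⟩ := exists_fst_sphereAverage_le hd hφ hc
  obtain ⟨M, hM⟩ := exists_bound_deriv_smoothTransition
  have hD := continuous_radialDiv (d := d) hA hB hψ
  have hDc := hasCompactSupport_radialDiv (d := d) (A := A) (B := B) hψc
  set g : RadialSpace W → ℝ := fun p => |A p * p.fst ^ (d - 1)| with hg
  have hgc : Continuous g := by fun_prop
  have hbound : Integrable (fun p => |radialDiv d A B (sphereAverage φ) p| +
      (tsupport (sphereAverage φ)).indicator (fun p => g p * (C * M)) p) := by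
    refine (hD.integrable_of_hasCompactSupport hDc).abs.add ?_
    rw [integrable_indicator_iff (isClosed_tsupport _).measurableSet]
    exact (hgc.mul continuous_const).continuousOn.integrableOn_compact hψc
  refine tendsto_integral_of_dominated_convergence _ (fun n =>
    (continuous_radialDiv hA hB (contDiff_cutoffField n hψ)).aestronglyMeasurable)
    hbound.integrableOn (fun n => .of_forall fun p => ?_) ?_
  · rw [radialDiv_cutoffField n hψ, Real.norm_eq_abs]
    refine (abs_add_le _ _).trans (add_le_add ?_ ?_)
    · rw [abs_mul, abs_of_nonneg (radialCutoff_nonneg n _)]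
      exact mul_le_of_le_one_left (abs_nonneg _) (radialCutoff_le_one n _)
    · by_cases hp : p ∈ tsupport (sphereAverage φ)
      · rw [Set.indicator_of_mem hp, abs_mul]
        refine mul_le_mul_of_nonneg_left ?_ (abs_nonneg _)
        rw [abs_mul]
        have h1 := hM (n * p.fst - 1)
        have h2 : deriv Real.smoothTransition (n * p.fst - 1) * (n * p.fst - 1 + 1) =
          deriv (radialCutoff n) p.fst * p.fst := by rw [deriv_radialCutoff]; ring
        rw [h2, abs_mul] at h1
        calc |deriv (radialCutoff n) p.fst| * |(sphereAverage φ p).fst|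
            ≤ |deriv (radialCutoff n) p.fst| * (C * |p.fst|) :=
              mul_le_mul_of_nonneg_left (hC p) (abs_nonneg _)
          _ = C * (|deriv (radialCutoff n) p.fst| * |p.fst|) := by ring
          _ ≤ C * M := mul_le_mul_of_nonneg_left h1 hC0
      · simp [image_eq_zero_of_notMem_tsupport hp, Set.indicator_of_notMem hp]
  · have hae : ∀ᵐ p ∂(volume.restrict F), 0 < p.fst := by
      filter_upwards [ae_restrict_of_ae (ae_fst_ne_zero (W := W)),
        ae_restrict_mem₀ hFm] with p hp hpF
      exact lt_of_le_of_ne (hF p hpF) hp.symm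
    filter_upwards [hae] with p hp
    refine tendsto_const_nhds.congr' ?_
    have h1 : ∀ᶠ n : ℕ in Filter.atTop, 2 < n * p.fst := by
      filter_upwards [Filter.eventually_gt_atTop ⌈2 / p.fst⌉₊] with n hn
      have := Nat.lt_of_ceil_lt hn
      rwa [div_lt_iff₀ hp] at this
    filter_upwards [h1] with n hn
    have h2 : radialCutoff n p.fst = 1 := Real.smoothTransition.one_of_one_le (by linarith)
    have h3 : deriv (radialCutoff n) p.fst = 0 := by
      have : Real.smoothTransition =ᶠ[𝓝 (n * p.fst - 1)] fun _ => 1 := by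
        filter_upwards [eventually_gt_nhds (show 1 < n * p.fst - 1 by linarith)] with s hs
        exact Real.smoothTransition.one_of_one_le hs.le
      rw [deriv_radialCutoff, this.deriv_eq, deriv_const, mul_zero]
    rw [radialDiv_cutoffField n hψ, h2, h3]
    ring

/-- One inequality uses cut off means as competitors, the other uses radial lifts. The coefficients
`A`, `B` and the constraint set `O` are left free because the second application, in `y`, acts on an
operator and on fields already reduced in `x`. -/
theorem iSup_fullDiv_eq_mul_iSup_radialDiv (hd : 1 ≤ d) (hA : Continuous A) (hB : Continuous B)
    (O : Set W) (hE : NullMeasurableSet E volume) (hF : ∀ p ∈ F, 0 ≤ p.fst)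
    (hEF : E = {z | WithLp.toLp 2 (‖z.fst‖, z.snd) ∈ F}) :
    ⨆ φ ∈ testFields (W := SphereSpace d W) {z : SphereSpace d W | z.snd ∈ O},
        ENNReal.ofReal (∫ z in E, fullDiv A B φ z) =
      ENNReal.ofReal (d * unitBallVolume d) *
        ⨆ ψ ∈ testFields (W := RadialSpace W) {p : RadialSpace W | 0 < p.fst ∧ p.snd ∈ O},
          ENNReal.ofReal (∫ p in F, radialDiv d A B ψ p) := by
  have hS : (0 : ℝ) ≤ d * unitBallVolume d := by
    rw [← sphereMeasure_real_univ]; exact measureReal_nonneg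
  have hFm := nullMeasurableSet_generating hd hE hF hEF
  apply le_antisymm
  · refine iSup₂_le fun φ hφ => ?_
    have h1 := (tendsto_setIntegral_radialDiv_cutoffField (B := B) hd hA hB hF hFm hφ.1
      hφ.2.1).const_mul (d * unitBallVolume d)
    rw [← setIntegral_fullDiv_eq hd hA hB hE hF hEF hφ.1 hφ.2.1] at h1
    refine le_of_tendsto (ENNReal.tendsto_ofReal h1) (.of_forall fun n => ?_)
    rw [ENNReal.ofReal_mul hS]
    gcongr
    exact le_iSup₂_of_le _ (cutoffField_mem_testFields hd hφ n) le_rfl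
  · simp only [ENNReal.mul_iSup]
    refine iSup₂_le fun ψ hψ => ?_
    refine le_iSup₂_of_le _ (radialLift_mem_testFields hψ) ?_
    rw [← ENNReal.ofReal_mul hS]
    refine ENNReal.ofReal_le_ofReal (le_of_eq ?_)
    have hL := radialLift_mem_testFields (d := d) hψ
    rw [setIntegral_fullDiv_eq hd hA hB hE hF hEF hL.1 hL.2.1]
    congr 1
    refine setIntegral_congr_ae₀ hFm ?_
    filter_upwards [ae_fst_ne_zero (W := W)] with p hp hpF
    -- The mean of the lift equals `ψ` only for `r > 0`, but the operator at `p` sees only the germ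
    -- there.
    refine radialDiv_congr ?_
    have hpos : 0 < p.fst := lt_of_le_of_ne (hF p hpF) hp.symm
    have hev : ∀ᶠ q : RadialSpace W in 𝓝 p, 0 < q.fst :=
      (WithLp.fstL 2 ℝ ℝ W).continuous.continuousAt.eventually (eventually_gt_nhds hpos)
    filter_upwards [hev] with q hq
    exact (sphereAverage_radialLift hd ψ hq).symm

end Reduction

/-! ### Symmetric sets -/

section ConjugateFields

variable {V V' : Type*} [NormedAddCommGroup V] [NormedSpace ℝ V]
  [NormedAddCommGroup V'] [NormedSpace ℝ V']

theorem conj_mem_testFields (e : V ≃ₗᵢ[ℝ] V') {U : Set V'} {ψ : V' → V'}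
    (hψ : ψ ∈ testFields (W := V') U) : e.symm ∘ ψ ∘ e ∈ testFields (W := V) (e ⁻¹' U) := by
  have hs : tsupport (e.symm ∘ ψ ∘ e) ⊆ e ⁻¹' tsupport ψ := by
    refine closure_minimal (fun z hz => subset_tsupport ψ fun h => hz ?_)
      ((isClosed_tsupport ψ).preimage e.continuous)
    simp [h]
  refine ⟨e.symm.contDiff.comp (hψ.1.comp e.contDiff), ?_, hs.trans (Set.preimage_mono hψ.2.2.1),
    fun z => by simpa using hψ.2.2.2 (e z)⟩
  exact (e.toHomeomorph.isCompact_preimage.2 hψ.2.1).of_isClosed_subset (isClosed_tsupport _) hs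

theorem iSup_testFields_conj (e : V ≃ₗᵢ[ℝ] V') (U : Set V') (I : (V → V) → ℝ≥0∞) :
    ⨆ φ ∈ testFields (W := V) (e ⁻¹' U), I φ =
      ⨆ ψ ∈ testFields (W := V') U, I (e.symm ∘ ψ ∘ e) := by
  apply le_antisymm
  · refine iSup₂_le fun φ hφ => ?_
    have hφ' : φ ∈ testFields (W := V) (e.symm.symm ⁻¹' U) := hφ
    have h1 : e.symm.symm ∘ φ ∘ e.symm ∈ testFields (W := V') (e.symm ⁻¹' (e ⁻¹' U)) :=
      conj_mem_testFields e.symm hφ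
    have h2 : e.symm ⁻¹' (e ⁻¹' U) = U := by ext; simp
    rw [h2] at h1
    refine le_iSup₂_of_le _ h1 (le_of_eq ?_)
    congr 1
    ext1 z
    simp
  · exact iSup₂_le fun ψ hψ => le_iSup₂_of_le _ (conj_mem_testFields e hψ) le_rfl

end ConjugateFields

section Symmetric

variable {h k : ℕ} {α : ℝ}

/-- The functional `(w, L) ↦ r^α tr L`. -/
noncomputable def alphaTrace (k : ℕ) (α : ℝ) (p : HalfReduced k) :
    (EuclideanSpace ℝ (Fin k) × (EuclideanSpace ℝ (Fin k) →L[ℝ] EuclideanSpace ℝ (Fin k))) →L[ℝ] ℝ :=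
  p.fst ^ α • ∑ j : Fin k, EuclideanSpace.proj j ∘L
    ContinuousLinearMap.apply ℝ (EuclideanSpace ℝ (Fin k)) (EuclideanSpace.single j (1 : ℝ)) ∘L
      ContinuousLinearMap.snd ℝ _ _

theorem continuous_alphaTrace (hα : 0 < α) : Continuous (alphaTrace k α) := by
  unfold alphaTrace
  exact ((Real.continuous_rpow_const hα.le).comp
    (WithLp.fstL 2 ℝ ℝ (EuclideanSpace ℝ (Fin k))).continuous).smul continuous_const

theorem alphaDiv_eq_fullDiv (φ : GrushinSpace h k → GrushinSpace h k) (z : GrushinSpace h k) :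
    alphaDiv α φ z = fullDiv (fun _ => 1) (alphaTrace k α) φ z := by
  simp [alphaDiv, fullDiv, alphaTrace, fstDiv, sndJet, radialPoint]

theorem rpow_natCast_sub_one_add (hh : 1 ≤ h) {r : ℝ} (hr : 0 < r) :
    r ^ ((h : ℝ) - 1 + α) = r ^ (h - 1) * r ^ α := by
  rw [Real.rpow_add hr]
  congr 1
  rw [← Real.rpow_natCast]
  congr 1
  push_cast [hh]
  ring

theorem halfDiv_eq_radialDiv (hh : 1 ≤ h) (ψ : HalfReduced k → HalfReduced k) {p : HalfReduced k}
    (hp : 0 < p.fst) :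
    halfDiv h α ψ p = radialDiv h (fun _ => 1) (alphaTrace k α) ψ p := by
  simp [halfDiv, radialDiv, alphaTrace, sndJet, rpow_natCast_sub_one_add hh hp, mul_assoc]

/-- The reduction in `x` with `A = 1`, `B` equal to `r^α` times the trace, and no constraint on `y`.
Positivity of `α` gives continuity of `r^α` up to `r = 0`. -/
theorem alphaPerimeter_eq_of_isXSymmetricWith (hh : 1 ≤ h) (hα : 0 < α)
    {E : Set (GrushinSpace h k)} {F : Set (HalfReduced k)} (hE : NullMeasurableSet E volume)
    (hEF : IsXSymmetricWith E F) :
    alphaPerimeter α E = ENNReal.ofReal (h * unitBallVolume h) *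
      ⨆ ψ ∈ testFields (W := HalfReduced k) (openHalf k),
        ENNReal.ofReal (∫ p in F, halfDiv h α ψ p) := by
  have h1 := iSup_fullDiv_eq_mul_iSup_radialDiv (A := fun _ => (1 : ℝ)) hh continuous_const
    (continuous_alphaTrace (k := k) hα) Set.univ hE hEF.1 hEF.2
  have hFm := nullMeasurableSet_generating hh hE hEF.1 hEF.2
  have h2 : ∀ ψ : HalfReduced k → HalfReduced k, ∫ p in F, halfDiv h α ψ p =
      ∫ p in F, radialDiv h (fun _ => 1) (alphaTrace k α) ψ p := by
    intro ψ
    refine setIntegral_congr_ae₀ hFm ?_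
    filter_upwards [ae_fst_ne_zero (W := EuclideanSpace ℝ (Fin k))] with p hp hpF
    exact halfDiv_eq_radialDiv hh ψ (lt_of_le_of_ne (hEF.1 p hpF) hp.symm)
  have h3 : {z : GrushinSpace h k | z.snd ∈ Set.univ} = Set.univ := by simp
  have h4 : {p : HalfReduced k | 0 < p.fst ∧ p.snd ∈ Set.univ} = openHalf k := by
    simp [openHalf]
  rw [h3, h4] at h1
  simp only [alphaPerimeter, alphaDiv_eq_fullDiv, h2]
  exact h1

/-- The exchange of the two factors of an `L²` product. -/
noncomputable def swapL2 (V W : Type*) [NormedAddCommGroup V] [InnerProductSpace ℝ V]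
    [NormedAddCommGroup W] [InnerProductSpace ℝ W] : WithLp 2 (V × W) ≃ₗᵢ[ℝ] WithLp 2 (W × V) where
  toLinearEquiv := (WithLp.linearEquiv 2 ℝ (V × W)).trans
    ((LinearEquiv.prodComm ℝ V W).trans (WithLp.linearEquiv 2 ℝ (W × V)).symm)
  norm_map' z := by
    rw [WithLp.prod_norm_eq_of_L2, WithLp.prod_norm_eq_of_L2, add_comm]
    rfl

theorem swapL2_apply {V W : Type*} [NormedAddCommGroup V] [InnerProductSpace ℝ V]
    [NormedAddCommGroup W] [InnerProductSpace ℝ W] (z : WithLp 2 (V × W)) :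
    swapL2 V W z = WithLp.toLp 2 (z.snd, z.fst) := rfl

theorem swapL2_symm {V W : Type*} [NormedAddCommGroup V] [InnerProductSpace ℝ V]
    [NormedAddCommGroup W] [InnerProductSpace ℝ W] : (swapL2 V W).symm = swapL2 W V := rfl

/-- The weight `r^{h-1+α}` in the swapped coordinates `(s, r)`. -/
noncomputable def swappedWeight (h : ℕ) (α : ℝ) (q : RadialSpace ℝ) : ℝ :=
  q.snd ^ ((h : ℝ) - 1 + α)

/-- The functional `(w, L) ↦ (h-1) r^{h-2} w + r^{h-1} L 1` in the swapped coordinates `(s, r)`. -/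
noncomputable def swappedFunctional (h : ℕ) (q : RadialSpace ℝ) : (ℝ × (ℝ →L[ℝ] ℝ)) →L[ℝ] ℝ :=
  (((h - 1 : ℕ) : ℝ) * q.snd ^ (h - 1 - 1)) • ContinuousLinearMap.fst ℝ ℝ (ℝ →L[ℝ] ℝ) +
    (q.snd ^ (h - 1)) • (ContinuousLinearMap.apply ℝ ℝ (1 : ℝ) ∘L
      ContinuousLinearMap.snd ℝ ℝ (ℝ →L[ℝ] ℝ))

theorem continuous_swappedWeight (hh : 1 ≤ h) (hα : 0 < α) : Continuous (swappedWeight h α) := by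
  have h1 : (0 : ℝ) ≤ (h : ℝ) - 1 + α := by
    have : (1 : ℝ) ≤ h := by exact_mod_cast hh
    linarith
  exact (Real.continuous_rpow_const h1).comp (WithLp.sndL 2 ℝ ℝ ℝ).continuous

theorem continuous_swappedFunctional : Continuous (swappedFunctional h) := by
  have h1 : Continuous fun q : RadialSpace ℝ => q.snd := (WithLp.sndL 2 ℝ ℝ ℝ).continuous
  unfold swappedFunctional
  rw [continuous_clm_apply]
  intro v
  simp only [_root_.add_apply, _root_.smul_apply]
  fun_prop

theorem deriv_pow_mul_fst_eq {V : Type*} [NormedAddCommGroup V] [InnerProductSpace ℝ V]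
    {ψ : WithLp 2 (ℝ × V) → WithLp 2 (ℝ × V)} (hψ : ContDiff ℝ 1 ψ) (n : ℕ)
    (p : WithLp 2 (ℝ × V)) :
    deriv (fun r : ℝ => r ^ n * (ψ (WithLp.toLp 2 (r, p.snd))).fst) p.fst =
      n * p.fst ^ (n - 1) * (ψ p).fst +
        p.fst ^ n * (fderiv ℝ ψ p (WithLp.toLp 2 (1, 0))).fst := by
  rw [deriv_pow_mul_fst hψ]
  have h1 : HasFDerivAt (fun q : RadialSpace V => q.fst) (WithLp.fstL 2 ℝ ℝ V) p :=
    (WithLp.fstL 2 ℝ ℝ V).hasFDerivAt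
  have h2 := (WithLp.fstL 2 ℝ ℝ V).hasFDerivAt.comp p
    (hψ.differentiable one_ne_zero p).hasFDerivAt
  have h3 := ((h1.pow n).mul h2).fderiv
  change fderiv ℝ (fun q : RadialSpace V => q.fst ^ n * (ψ q).fst) p = _ at h3
  rw [h3]
  simp
  ring

theorem fderiv_conj_swapL2 {V W : Type*} [NormedAddCommGroup V] [InnerProductSpace ℝ V]
    [NormedAddCommGroup W] [InnerProductSpace ℝ W] {ψ : WithLp 2 (W × V) → WithLp 2 (W × V)}
    (hψ : ContDiff ℝ 1 ψ) (z v : WithLp 2 (V × W)) :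
    fderiv ℝ (swapL2 W V ∘ ψ ∘ swapL2 V W) z v =
      swapL2 W V (fderiv ℝ ψ (swapL2 V W z) (swapL2 V W v)) := by
  have h1 := (hψ.differentiable one_ne_zero (swapL2 V W z)).hasFDerivAt
  have h2 := ((swapL2 W V).toContinuousLinearEquiv.toContinuousLinearMap.hasFDerivAt.comp z
    (h1.comp z (swapL2 V W).toContinuousLinearEquiv.toContinuousLinearMap.hasFDerivAt)).fderiv
  have h3 := congrArg (fun L => L v) h2
  exact h3

/-- After the exchange `y` is the spherical variable and `r` plays the role of `w`. Expanding
`∂_r(r^{h-1}ψ₁)` by the product rule exhibits it as a functional of the value and derivative of that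
component; this is why `sndJet` records the value as well as the derivative. -/
theorem fullDiv_conj_swapL2 {ψ : HalfReduced k → HalfReduced k} (hψ : ContDiff ℝ 1 ψ)
    (z : SphereSpace k ℝ) :
    fullDiv (swappedWeight h α) (swappedFunctional h)
      ((swapL2 (EuclideanSpace ℝ (Fin k)) ℝ).symm ∘ ψ ∘ swapL2 (EuclideanSpace ℝ (Fin k)) ℝ) z =
      halfDiv h α ψ (swapL2 _ _ z) := by
  simp only [fullDiv, halfDiv, fstDiv, sndJet, deriv_pow_mul_fst_eq hψ, fderiv_conj_swapL2 hψ,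
    swappedWeight, swappedFunctional, radialPoint, swapL2_symm]
  simp [fderiv_conj_swapL2 hψ, swapL2_apply]
  ring

theorem radialDiv_conj_swapL2 {ψ : RSPlane → RSPlane} (hψ : ContDiff ℝ 1 ψ) (z : RSPlane) :
    radialDiv k (swappedWeight h α) (swappedFunctional h)
      ((swapL2 ℝ ℝ).symm ∘ ψ ∘ swapL2 ℝ ℝ) z = planeDiv h k α ψ (swapL2 _ _ z) := by
  simp only [radialDiv, planeDiv, sndJet, swappedWeight, swappedFunctional, swapL2_symm]
  have h1 := deriv_pow_mul_fst_eq hψ (h - 1) (swapL2 ℝ ℝ z)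
  simp only [swapL2_apply] at h1 ⊢
  simp only [h1]
  simp [fderiv_conj_swapL2 hψ, swapL2_apply]
  ring

/-- The reduction in `y`. The condition `r > 0` on the supports becomes the constraint set `O =
(0,∞)` for the variable that is not averaged. -/
theorem iSup_halfDiv_eq_mul_iSup_planeDiv (hh : 1 ≤ h) (hk : 1 ≤ k) (hα : 0 < α)
    {F : Set (HalfReduced k)} {G : Set RSPlane} (hFm : NullMeasurableSet F volume)
    (hG : ∀ p ∈ G, 0 ≤ p.fst ∧ 0 ≤ p.snd)
    (hFG : F = {p | WithLp.toLp 2 (p.fst, ‖p.snd‖) ∈ G}) :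
    ⨆ ψ ∈ testFields (W := HalfReduced k) (openHalf k),
        ENNReal.ofReal (∫ p in F, halfDiv h α ψ p) =
      ENNReal.ofReal (k * unitBallVolume k) *
        ⨆ ψ ∈ testFields (W := RSPlane) openQuadrant,
          ENNReal.ofReal (∫ p in G, planeDiv h k α ψ p) := by
  have hm : NullMeasurableSet (swapL2 (EuclideanSpace ℝ (Fin k)) ℝ ⁻¹' F) volume :=
    hFm.preimage (LinearIsometryEquiv.measurePreserving _).quasiMeasurePreserving
  have h1 := iSup_fullDiv_eq_mul_iSup_radialDiv (A := swappedWeight h α)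
    (B := swappedFunctional h) (E := swapL2 (EuclideanSpace ℝ (Fin k)) ℝ ⁻¹' F)
    (F := swapL2 ℝ ℝ ⁻¹' G) hk (continuous_swappedWeight hh hα)
    continuous_swappedFunctional (Set.Ioi 0) hm (fun p hp => (hG _ hp).2) (by
      rw [hFG]; rfl)
  have h2 : {z : SphereSpace k ℝ | z.snd ∈ Set.Ioi 0} =
      swapL2 (EuclideanSpace ℝ (Fin k)) ℝ ⁻¹' openHalf k := rfl
  have h3 : {p : RadialSpace ℝ | 0 < p.fst ∧ p.snd ∈ Set.Ioi 0} = swapL2 ℝ ℝ ⁻¹' openQuadrant := by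
    ext p; exact and_comm
  rw [h2, h3, iSup_testFields_conj, iSup_testFields_conj] at h1
  refine Eq.trans (iSup_congr fun ψ => iSup_congr fun hψ => ?_) (h1.trans ?_)
  · congr 1
    simp only [fullDiv_conj_swapL2 hψ.1]
    exact ((LinearIsometryEquiv.measurePreserving (swapL2 (EuclideanSpace ℝ (Fin k))
      ℝ)).setIntegral_preimage_emb
      (swapL2 _ _).toHomeomorph.measurableEmbedding (halfDiv h α ψ) F).symm
  · congr 1
    refine iSup_congr fun ψ => iSup_congr fun hψ => ?_
    congr 1
    simp only [radialDiv_conj_swapL2 hψ.1]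
    exact ((LinearIsometryEquiv.measurePreserving (swapL2 ℝ ℝ)).setIntegral_preimage_emb
      (swapL2 _ _).toHomeomorph.measurableEmbedding (planeDiv h k α ψ) G)

theorem alphaPerimeter_eq_of_isXYSymmetricWith (hh : 1 ≤ h) (hk : 1 ≤ k) (hα : 0 < α)
    {E : Set (GrushinSpace h k)} {G : Set RSPlane} (hE : IsOpen E) (hEG : IsXYSymmetricWith E G) :
    alphaPerimeter α E = ENNReal.ofReal (symmConst h k) *
      ⨆ ψ ∈ testFields (W := RSPlane) openQuadrant,
        ENNReal.ofReal (∫ p in G, planeDiv h k α ψ p) := by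
  have hEm : NullMeasurableSet E volume := hE.measurableSet.nullMeasurableSet
  have hX : IsXSymmetricWith E {p : HalfReduced k | WithLp.toLp 2 (p.fst, ‖p.snd‖) ∈ G} :=
    ⟨fun p hp => (hEG.1 _ hp).1, hEG.2⟩
  rw [alphaPerimeter_eq_of_isXSymmetricWith hh hα hEm hX,
    iSup_halfDiv_eq_mul_iSup_planeDiv hh hk hα (nullMeasurableSet_generating hh hEm hX.1 hX.2)
      hEG.1 rfl, ← mul_assoc, ← ENNReal.ofReal_mul (by unfold unitBallVolume; positivity)]
  congr 2
  unfold symmConst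
  ring

end Symmetric

/-! ### Length of Lipschitz curves -/

section Curve

open scoped NNReal

theorem le_of_forall_one_lt_le_coe_mul {x y : ℝ≥0∞} (hxy : ∀ t : ℝ≥0, 1 < t → x ≤ t * y) :
    x ≤ y := by
  rcases eq_or_ne y ⊤ with rfl | hy
  · exact le_top
  have h1 : Filter.Tendsto (fun t : ℝ≥0 => (t : ℝ≥0∞) * y) (𝓝[>] 1) (𝓝 (1 * y)) := by
    refine ENNReal.Tendsto.mul_const ?_ (Or.inr hy)
    exact (ENNReal.continuous_coe.tendsto 1).mono_left nhdsWithin_le_nhds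
  rw [one_mul] at h1
  exact ge_of_tendsto h1 (by filter_upwards [self_mem_nhdsWithin] with t ht using hxy t ht)

/-- Cut a set along the levels `t^n ≤ f < t^{n+1}`. On each piece both measures lie between `t^n μ`
and `t^{n+1} μ`, so they differ by a factor of at most `t`; sum over `n` and let `t` decrease to
`1`. -/
theorem withDensity_eq_of_mul_bounds {X : Type*} [MeasurableSpace X] {μ ρ : Measure X}
    {f : X → ℝ≥0∞} (hf : Measurable f) {D : Set X} (hD : MeasurableSet D) (hμD : μ Dᶜ = 0)
    (hρD : ρ Dᶜ = 0) (hf0 : ∀ x ∈ D, f x ≠ 0) (hftop : ∀ x ∈ D, f x ≠ ⊤)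
    (h : ∀ s ⊆ D, MeasurableSet s → ∀ a b : ℝ≥0, 0 < a → (∀ x ∈ s, a ≤ f x ∧ f x ≤ b) →
      a * μ s ≤ ρ s ∧ ρ s ≤ b * μ s) :
    ρ = μ.withDensity f := by
  have key : ∀ s ⊆ D, MeasurableSet s → ∀ t : ℝ≥0, 1 < t →
      ρ s ≤ t * μ.withDensity f s ∧ μ.withDensity f s ≤ t * ρ s := by
    intro s hs hsm t ht
    have ht0 : t ≠ 0 := (zero_lt_one.trans ht).ne'
    have hz0 : s ∩ f ⁻¹' {0} = ∅ := by
      ext x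
      simp only [Set.mem_inter_iff, Set.mem_preimage, Set.mem_singleton_iff,
        Set.mem_empty_iff_false, iff_false, not_and]
      exact fun hx => hf0 x (hs hx)
    have hzt : s ∩ f ⁻¹' {⊤} = ∅ := by
      ext x
      simp only [Set.mem_inter_iff, Set.mem_preimage, Set.mem_singleton_iff,
        Set.mem_empty_iff_false, iff_false, not_and]
      exact fun hx => hftop x (hs hx)
    have hρ := measure_eq_measure_preimage_add_measure_tsum_Ico_zpow ρ hf hsm ht
    have hμ := measure_eq_measure_preimage_add_measure_tsum_Ico_zpow (μ.withDensity f) hf hsm ht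
    simp only [hz0, hzt, measure_empty, zero_add] at hρ hμ
    have hpiece : ∀ n : ℤ, ρ (s ∩ f ⁻¹' Set.Ico ((t : ℝ≥0∞) ^ n) ((t : ℝ≥0∞) ^ (n + 1))) ≤
          t * μ.withDensity f (s ∩ f ⁻¹' Set.Ico ((t : ℝ≥0∞) ^ n) ((t : ℝ≥0∞) ^ (n + 1))) ∧
        μ.withDensity f (s ∩ f ⁻¹' Set.Ico ((t : ℝ≥0∞) ^ n) ((t : ℝ≥0∞) ^ (n + 1))) ≤
          t * ρ (s ∩ f ⁻¹' Set.Ico ((t : ℝ≥0∞) ^ n) ((t : ℝ≥0∞) ^ (n + 1))) := by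
      intro n
      set u := s ∩ f ⁻¹' Set.Ico ((t : ℝ≥0∞) ^ n) ((t : ℝ≥0∞) ^ (n + 1)) with hu
      have hum : MeasurableSet u := hsm.inter (hf measurableSet_Ico)
      have hc : ∀ m : ℤ, ((t ^ m : ℝ≥0) : ℝ≥0∞) = (t : ℝ≥0∞) ^ m := fun m => ENNReal.coe_zpow ht0 m
      have hb : ∀ x ∈ u, ((t ^ n : ℝ≥0) : ℝ≥0∞) ≤ f x ∧ f x ≤ ((t ^ (n + 1) : ℝ≥0) : ℝ≥0∞) := by
        intro x hx
        rw [hc, hc]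
        exact ⟨hx.2.1, hx.2.2.le⟩
      obtain ⟨h1, h2⟩ := h u (Set.inter_subset_left.trans hs) hum (t ^ n) (t ^ (n + 1))
        (zpow_pos (zero_lt_one.trans ht) n) hb
      have hstep : ((t ^ (n + 1) : ℝ≥0) : ℝ≥0∞) = t * ((t ^ n : ℝ≥0) : ℝ≥0∞) := by
        rw [← ENNReal.coe_mul, zpow_add_one₀ ht0, mul_comm]
      have h3 : ((t ^ n : ℝ≥0) : ℝ≥0∞) * μ u ≤ μ.withDensity f u := by
        rw [withDensity_apply _ hum, ← setLIntegral_const]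
        exact setLIntegral_mono hf fun x hx => (hb x hx).1
      have h4 : μ.withDensity f u ≤ ((t ^ (n + 1) : ℝ≥0) : ℝ≥0∞) * μ u := by
        rw [withDensity_apply _ hum, ← setLIntegral_const]
        exact setLIntegral_mono measurable_const fun x hx => (hb x hx).2
      constructor
      · calc ρ u ≤ t * (((t ^ n : ℝ≥0) : ℝ≥0∞) * μ u) := by rwa [← mul_assoc, ← hstep]
          _ ≤ _ := by gcongr
      · calc _ ≤ t * (((t ^ n : ℝ≥0) : ℝ≥0∞) * μ u) := by rwa [← mul_assoc, ← hstep]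
          _ ≤ _ := by gcongr
    constructor
    · rw [hρ, hμ, ← ENNReal.tsum_mul_left]
      exact ENNReal.tsum_le_tsum fun n => (hpiece n).1
    · rw [hρ, hμ, ← ENNReal.tsum_mul_left]
      exact ENNReal.tsum_le_tsum fun n => (hpiece n).2
  ext s hs
  have hwD : μ.withDensity f Dᶜ = 0 := withDensity_absolutelyContinuous μ f hμD
  rw [← measure_inter_add_sdiff s hD, ← measure_inter_add_sdiff (μ := μ.withDensity f) s hD,
    show ρ (s \ D) = 0 from measure_mono_null (fun x hx => hx.2) hρD,
    show μ.withDensity f (s \ D) = 0 from measure_mono_null (fun x hx => hx.2) hwD]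
  congr 1
  have hi : s ∩ D ⊆ D := Set.inter_subset_right
  exact le_antisymm (le_of_forall_one_lt_le_coe_mul fun t ht => (key _ hi (hs.inter hD) t ht).1)
    (le_of_forall_one_lt_le_coe_mul fun t ht => (key _ hi (hs.inter hD) t ht).2)

variable {P : Type*} [NormedAddCommGroup P] [NormedSpace ℝ P] [FiniteDimensional ℝ P]
  [MeasurableSpace P] [BorelSpace P]

/-- Partition `s` into countably many pieces on which `Γ` is nearly linear. On each piece `Γ` is
Lipschitz with constant `t b` and its inverse `π` with constant `t / a`, and on the line `H¹` is
Lebesgue measure. -/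
theorem hausdorffMeasure_image_bounds {Γ : ℝ → P} {π : P → ℝ} (hπ : Function.LeftInverse π Γ)
    (hΓ : Continuous Γ) {s : Set ℝ} (hs : MeasurableSet s) (hd : ∀ x ∈ s, DifferentiableAt ℝ Γ x) {a b : ℝ≥0}
    (ha : 0 < a) (hab : ∀ x ∈ s, a ≤ ‖deriv Γ x‖₊ ∧ ‖deriv Γ x‖₊ ≤ b) {t : ℝ≥0} (ht : 1 < t) :
    a * volume s ≤ t * μH[1] (Γ '' s) ∧ μH[1] (Γ '' s) ≤ t * b * volume s := by
  rcases s.eq_empty_or_nonempty with rfl | hne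
  · simp
  have ht0 : (0 : ℝ) < t := zero_lt_one.trans (by exact_mod_cast ht)
  have hemb : MeasurableEmbedding Γ := hΓ.measurableEmbedding hπ.injective
  obtain ⟨x0, hx0⟩ := hne
  have hle : a ≤ b := (hab x0 hx0).1.trans (hab x0 hx0).2
  -- With this error, `a - ε = a / t` gives the constant of the inverse, and `b + ε ≤ t b` gives
  -- that of `Γ`, because `a ≤ b`.
  set ε : ℝ≥0 := a * (1 - t⁻¹) with hε
  have htinv : t⁻¹ < 1 := inv_lt_one_of_one_lt₀ ht
  have hε0 : ε ≠ 0 := mul_ne_zero ha.ne' (tsub_pos_of_lt htinv).ne'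
  have hεr : (ε : ℝ) = a - a / t := by
    rw [hε, NNReal.coe_mul, NNReal.coe_sub htinv.le]
    push_cast
    ring
  obtain ⟨u, L, hdisj, hum, hcov, happ, hL⟩ :=
    exists_partition_approximatesLinearOn_of_hasFDerivWithinAt Γ s (fun x => fderiv ℝ Γ x)
      (fun x hx => (hd x hx).hasFDerivAt.hasFDerivWithinAt) (fun _ => ε) (fun _ => hε0)
  have hLn : ∀ n, a ≤ ‖L n 1‖₊ ∧ ‖L n 1‖₊ ≤ b := by
    intro n
    obtain ⟨y, hy, hLy⟩ := hL ⟨x0, hx0⟩ n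
    rw [hLy]
    exact hab y hy
  have hL1 : ∀ n (r : ℝ), ‖L n r‖ = |r| * ‖L n 1‖ := by
    intro n r
    conv_lhs => rw [show r = r • (1 : ℝ) by simp]
    rw [map_smul, norm_smul, Real.norm_eq_abs]
  have hpiece : ∀ n, a * volume (s ∩ u n) ≤ t * μH[1] (Γ '' (s ∩ u n)) ∧
      μH[1] (Γ '' (s ∩ u n)) ≤ t * b * volume (s ∩ u n) := by
    intro n
    have hest : ∀ x ∈ s ∩ u n, ∀ y ∈ s ∩ u n, ‖Γ x - Γ y - L n (x - y)‖ ≤ ε * |x - y| :=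
      fun x hx y hy => happ n x hx y hy
    have hLa : (a : ℝ) ≤ ‖L n 1‖ := by exact_mod_cast (hLn n).1
    have hLb : ‖L n 1‖ ≤ (b : ℝ) := by exact_mod_cast (hLn n).2
    have hle' : (a : ℝ) ≤ b := by exact_mod_cast hle
    have hlip : LipschitzOnWith (t * b) Γ (s ∩ u n) := by
      refine LipschitzOnWith.of_dist_le_mul fun x hx y hy => ?_
      rw [dist_eq_norm, Real.dist_eq]
      have h1 := hest x hx y hy
      have h2 : ‖Γ x - Γ y‖ ≤ ‖Γ x - Γ y - L n (x - y)‖ + ‖L n (x - y)‖ := by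
        simpa using norm_add_le (Γ x - Γ y - L n (x - y)) (L n (x - y))
      rw [hL1] at h2
      have h3 : (ε : ℝ) + b ≤ t * b := by
        rw [hεr]
        have ht1 : (1 : ℝ) ≤ t := by exact_mod_cast ht.le
        have h5 : (a : ℝ) - a / t ≤ b * (t - 1) := by
          have : (a : ℝ) - a / t = (a / t) * (t - 1) := by field_simp
          rw [this]
          have h6 : (a : ℝ) / t ≤ b := (div_le_self a.2 ht1).trans hle'
          exact mul_le_mul_of_nonneg_right h6 (by linarith)
        linarith
      push_cast
      calc ‖Γ x - Γ y‖ ≤ ε * |x - y| + |x - y| * b := by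
            refine h2.trans (add_le_add h1 ?_)
            gcongr
        _ = (ε + b) * |x - y| := by ring
        _ ≤ _ := by gcongr
    have hlip2 : LipschitzOnWith (t * a⁻¹) π (Γ '' (s ∩ u n)) := by
      refine LipschitzOnWith.of_dist_le_mul ?_
      rintro _ ⟨x, hx, rfl⟩ _ ⟨y, hy, rfl⟩
      rw [hπ, hπ, dist_eq_norm (Γ x), Real.dist_eq]
      have h1 := hest x hx y hy
      have h2 : ‖L n (x - y)‖ ≤ ‖Γ x - Γ y‖ + ‖Γ x - Γ y - L n (x - y)‖ := by
        have := norm_sub_le (Γ x - Γ y) (Γ x - Γ y - L n (x - y))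
        simpa using this
      rw [hL1] at h2
      have ha' : (0 : ℝ) < a := by exact_mod_cast ha
      have h3 : |x - y| * (a / t) ≤ ‖Γ x - Γ y‖ := by
        have h4 : |x - y| * a ≤ |x - y| * ‖L n 1‖ := by gcongr
        rw [hεr] at h1
        nlinarith
      push_cast
      calc |x - y| = (t * (a : ℝ)⁻¹) * (|x - y| * (a / t)) := by field_simp
        _ ≤ _ := by gcongr
    have h1 := hlip.hausdorffMeasure_image_le (d := 1) zero_le_one
    have h2 := hlip2.hausdorffMeasure_image_le (d := 1) zero_le_one
    have himg : π '' (Γ '' (s ∩ u n)) = s ∩ u n := by rw [← Set.image_comp, hπ.comp_eq_id, Set.image_id]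
    rw [himg, hausdorffMeasure_real] at h2
    rw [hausdorffMeasure_real] at h1
    simp only [ENNReal.rpow_one, ENNReal.coe_mul] at h1 h2
    refine ⟨?_, h1⟩
    calc (a : ℝ≥0∞) * volume (s ∩ u n)
        ≤ a * (t * ((a⁻¹ : ℝ≥0) : ℝ≥0∞) * μH[1] (Γ '' (s ∩ u n))) := by gcongr
      _ = (a * ((a⁻¹ : ℝ≥0) : ℝ≥0∞)) * (t * μH[1] (Γ '' (s ∩ u n))) := by ring
      _ = _ := by rw [← ENNReal.coe_mul, mul_inv_cancel₀ ha.ne', ENNReal.coe_one, one_mul]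
  have hsU : s = ⋃ n, s ∩ u n := by rw [← Set.inter_iUnion, Set.inter_eq_left.2 hcov]
  have hdisj' : Pairwise (Function.onFun Disjoint fun n => s ∩ u n) := fun i j hij =>
    (hdisj hij).mono Set.inter_subset_right Set.inter_subset_right
  have hv : volume s = ∑' n, volume (s ∩ u n) := by
    conv_lhs => rw [hsU]
    exact measure_iUnion hdisj' fun n => hs.inter (hum n)
  have hH : μH[1] (Γ '' s) = ∑' n, μH[1] (Γ '' (s ∩ u n)) := by
    conv_lhs => rw [hsU, Set.image_iUnion]
    exact measure_iUnion (fun i j hij => Set.disjoint_image_of_injective hπ.injective (hdisj' hij))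
      fun n => hemb.measurableSet_image.2 (hs.inter (hum n))
  rw [hv, hH, ← ENNReal.tsum_mul_left, ← ENNReal.tsum_mul_left, ← ENNReal.tsum_mul_left]
  exact ⟨ENNReal.tsum_le_tsum fun n => (hpiece n).1, ENNReal.tsum_le_tsum fun n => (hpiece n).2⟩

/-- The length formula. The bounds on pieces identify the density where `Γ` is differentiable; the
remaining parameters form a null set, whose image has zero length since `Γ` is Lipschitz. -/
theorem hausdorffMeasure_restrict_range {Γ : ℝ → P} {π : P → ℝ} (hπ : Function.LeftInverse π Γ)
    (hπ1 : LipschitzWith 1 π) {K : ℝ≥0} (hΓ : LipschitzWith K Γ) :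
    (μH[1] : Measure P).restrict (Set.range Γ) =
      (volume.withDensity fun t => ‖deriv Γ t‖ₑ).map Γ := by
  have hemb : MeasurableEmbedding Γ := hΓ.continuous.measurableEmbedding hπ.injective
  set D : Set ℝ := {x | DifferentiableAt ℝ Γ x} with hDdef
  have hDm : MeasurableSet D := measurableSet_of_differentiableAt ℝ Γ
  have hD0 : volume Dᶜ = 0 := hΓ.ae_differentiableAt_real
  -- The left inverse is `1`-Lipschitz, so `Γ` does not contract distances. This keeps the density
  -- away from zero, as the comparison of measures requires.
  have hexp : ∀ x ∈ D, 1 ≤ ‖deriv Γ x‖₊ := by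
    intro x hx
    have hd : HasDerivAt Γ (deriv Γ x) x := hx.hasDerivAt
    have h1 := (hasDerivAt_iff_tendsto_slope.1 hd).norm
    rw [← NNReal.coe_le_coe, NNReal.coe_one, coe_nnnorm]
    refine ge_of_tendsto h1 ?_
    filter_upwards [self_mem_nhdsWithin] with y hy
    have hne : y - x ≠ 0 := sub_ne_zero.2 hy
    have h2 := hπ1.dist_le_mul (Γ y) (Γ x)
    rw [hπ, hπ, NNReal.coe_one, one_mul, Real.dist_eq, dist_eq_norm] at h2
    rw [slope_def_module, norm_smul, norm_inv, Real.norm_eq_abs]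
    exact (one_le_inv_mul₀ (abs_pos.2 hne)).2 h2
  rw [← hemb.map_comap]
  congr 1
  refine withDensity_eq_of_mul_bounds (D := D) (measurable_deriv Γ).enorm hDm hD0 ?_ ?_ ?_ ?_
  · rw [hemb.comap_apply]
    have := hΓ.hausdorffMeasure_image_le (d := 1) zero_le_one Dᶜ
    rw [hausdorffMeasure_real, hD0, mul_zero] at this
    exact le_antisymm this bot_le
  · intro x hx h0
    have := hexp x hx
    rw [enorm_eq_zero] at h0
    simp [h0] at this
  · intro x _
    exact enorm_ne_top
  · intro s hs hsm a b ha hab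
    have hab' : ∀ x ∈ s, a ≤ ‖deriv Γ x‖₊ ∧ ‖deriv Γ x‖₊ ≤ b := fun x hx => by
      have := hab x hx
      simpa only [enorm_eq_nnnorm, ENNReal.coe_le_coe] using this
    rw [hemb.comap_apply]
    have key := fun t ht => hausdorffMeasure_image_bounds hπ hΓ.continuous hsm
      (fun x hx => hs hx) ha hab' (t := t) ht
    refine ⟨le_of_forall_one_lt_le_coe_mul fun t ht => (key t ht).1, le_of_forall_one_lt_le_coe_mul fun t ht => ?_⟩
    rw [← mul_assoc]
    exact (key t ht).2

end Curve

/-! ### The divergence theorem below a Lipschitz graph -/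

section SubgraphIntegral

open scoped NNReal

theorem LipschitzWith.integral_deriv_eq_zero {f : ℝ → ℝ} {K : ℝ≥0} (hf : LipschitzWith K f)
    (hc : HasCompactSupport f) : ∫ t, deriv f t = 0 := by
  -- Integration by parts for Lipschitz functions against the constant `1`, whose derivative
  -- vanishes.
  have h := LipschitzWith.integral_lineDeriv_mul_eq (μ := volume) (C := 0)
    (LipschitzWith.const (α := ℝ) (1 : ℝ)) hf hc (-1)
  have h1 : ∀ x : ℝ, lineDeriv ℝ (fun _ : ℝ => (1 : ℝ)) x (-1) = 0 := fun x => by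
    simp [lineDeriv]
  have h2 : ∀ x : ℝ, lineDeriv ℝ f x 1 = deriv f x := fun x => by
    simp only [lineDeriv, smul_eq_mul, mul_one]
    rw [deriv_comp_const_add (f := f) x 0, add_zero]
  simp only [h1, zero_mul, integral_zero, mul_one, neg_neg, h2] at h
  exact h.symm

variable {g : ℝ → ℝ} {K : ℝ≥0} {F : ℝ × ℝ → ℝ}

/-- The shear `(t, s) ↦ (t, g(t) + s)`. -/
def shear (g : ℝ → ℝ) (q : ℝ × ℝ) : ℝ × ℝ := (q.1, g q.1 + q.2)

theorem continuous_shear (hg : Continuous g) : Continuous (shear g) := by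
  unfold shear; fun_prop

theorem hasCompactSupport_comp_shear {V : Type*} [Zero V] {H : ℝ × ℝ → V} (hg : Continuous g)
    (hc : HasCompactSupport H) : HasCompactSupport (H ∘ shear g) := by
  refine HasCompactSupport.intro (hc.isCompact.image
    (show Continuous fun q : ℝ × ℝ => (q.1, q.2 - g q.1) by fun_prop)) fun q hq => ?_
  refine image_eq_zero_of_notMem_tsupport (f := H) fun h => hq ⟨_, h, ?_⟩
  simp [shear]

theorem setIntegral_Iio_fderiv_shear (g : ℝ → ℝ) (hF : ContDiff ℝ 1 F) (hc : HasCompactSupport F)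
    (t : ℝ) : ∫ s in Set.Iio (0 : ℝ), fderiv ℝ F (shear g (t, s)) (0, 1) = F (t, g t) := by
  set k : ℝ → ℝ := fun s => F (shear g (t, s)) with hk
  have hsC : ContDiff ℝ 1 fun s : ℝ => ((t, g t + s) : ℝ × ℝ) := by fun_prop
  have hkC : ContDiff ℝ 1 k := hF.comp hsC
  have hkc : HasCompactSupport k := by
    refine HasCompactSupport.intro ((hc.isCompact.image continuous_snd).image
      (show Continuous fun x => x - g t by fun_prop)) fun s hs => ?_
    refine image_eq_zero_of_notMem_tsupport (f := F) fun h => hs ⟨_, ⟨_, h, rfl⟩, ?_⟩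
    simp [shear]
  have hkd : ∀ s, deriv k s = fderiv ℝ F (shear g (t, s)) (0, 1) := by
    intro s
    have h1 : HasDerivAt (fun s => shear g (t, s)) (0, 1) s :=
      (hasDerivAt_const s t).prodMk ((hasDerivAt_id s).const_add (g t))
    exact ((hF.differentiable one_ne_zero _).hasFDerivAt.comp_hasDerivAt s h1).deriv
  have := hkc.integral_Iic_deriv_eq hkC 0
  simp only [hkd] at this
  rw [← integral_Iic_eq_integral_Iio, this]
  simp [hk, shear]

theorem setIntegral_subgraph_eq (hg : Continuous g) {H : ℝ × ℝ → ℝ} (hH : Continuous H)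
    (hc : HasCompactSupport H) :
    ∫ q in {q : ℝ × ℝ | q.2 < g q.1}, H q =
      ∫ t, ∫ s in Set.Iio (0 : ℝ), H (shear g (t, s)) := by
  have hm : MeasurableSet {q : ℝ × ℝ | q.2 < g q.1} :=
    (isOpen_lt continuous_snd (hg.comp continuous_fst)).measurableSet
  rw [← integral_indicator hm, Measure.volume_eq_prod, integral_prod _
    ((hH.integrable_of_hasCompactSupport hc).indicator hm)]
  congr 1
  ext1 t
  rw [← integral_indicator measurableSet_Iio,
    ← integral_add_left_eq_self (fun s => Set.indicator {q : ℝ × ℝ | q.2 < g q.1} H (t, s)) (g t)]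
  congr 1
  ext1 s
  by_cases hs : s < 0 <;> simp [Set.indicator, shear, hs]

theorem setIntegral_subgraph_fderiv_snd (hg : Continuous g) (hF : ContDiff ℝ 1 F)
    (hc : HasCompactSupport F) :
    ∫ q in {q : ℝ × ℝ | q.2 < g q.1}, fderiv ℝ F q (0, 1) = ∫ t, F (t, g t) := by
  have hFd := hF.continuous_fderiv one_ne_zero
  have hcd : HasCompactSupport fun q => fderiv ℝ F q (0, 1) := by
    refine (hc.fderiv ℝ).comp_left (g := fun L : ℝ × ℝ →L[ℝ] ℝ => L (0, 1)) rfl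
  rw [setIntegral_subgraph_eq hg (by fun_prop) hcd]
  congr 1
  ext1 t
  exact setIntegral_Iio_fderiv_shear g hF hc t

theorem hasCompactSupport_comp_shear_left {V : Type*} [Zero V] {H : ℝ × ℝ → V} (g : ℝ → ℝ)
    (hH : HasCompactSupport H) (s : ℝ) : HasCompactSupport fun t => H (shear g (t, s)) := by
  refine HasCompactSupport.intro (hH.isCompact.image continuous_fst) fun t ht => ?_
  exact image_eq_zero_of_notMem_tsupport (f := H) fun h => ht ⟨_, h, rfl⟩

theorem hasCompactSupport_fderiv_apply (hc : HasCompactSupport F) (v : ℝ × ℝ) :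
    HasCompactSupport fun q => fderiv ℝ F q v :=
  (hc.fderiv ℝ).comp_left (g := fun L : ℝ × ℝ →L[ℝ] ℝ => L v) rfl

theorem integrable_comp_shear {H : ℝ × ℝ → ℝ} (hg : Continuous g) (hH : Continuous H)
    (hc : HasCompactSupport H) : Integrable (fun q : ℝ × ℝ => H (shear g q))
      ((volume : Measure ℝ).prod (volume.restrict (Set.Iio 0))) := by
  have h1 : Integrable (fun q : ℝ × ℝ => H (shear g q)) volume :=
    (hH.comp (continuous_shear hg)).integrable_of_hasCompactSupport
      (hasCompactSupport_comp_shear hg hc)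
  have h2 := h1.integrableOn (s := Set.univ ×ˢ Set.Iio (0 : ℝ))
  rwa [IntegrableOn, Measure.volume_eq_prod, ← Measure.prod_restrict, Measure.restrict_univ] at h2

/-- The function `t ↦ F(t, g(t) + s)` is Lipschitz with compact support, so its derivative has
integral zero; the chain rule holds wherever `g` is differentiable, hence a.e. -/
theorem integral_fderiv_shear_left (hg : LipschitzWith K g) (hF : ContDiff ℝ 1 F)
    (hc : HasCompactSupport F) (s : ℝ) : ∫ t, fderiv ℝ F (shear g (t, s)) (1, 0) =
      - ∫ t, deriv g t * fderiv ℝ F (shear g (t, s)) (0, 1) := by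
  have hgc := hg.continuous
  have hFd := hF.continuous_fderiv one_ne_zero
  have hshear : Continuous fun t => shear g (t, s) :=
    (continuous_shear hgc).comp (by fun_prop)
  obtain ⟨C, hC⟩ := hF.lipschitzWith_of_hasCompactSupport hc one_ne_zero
  have hsl : LipschitzWith (max 1 (K + 0)) fun t => shear g (t, s) :=
    LipschitzWith.id.prodMk (hg.add (LipschitzWith.const s))
  have h0 := (hC.comp hsl).integral_deriv_eq_zero (hasCompactSupport_comp_shear_left g hc s)
  have hae : ∀ᵐ t, deriv (F ∘ fun t => shear g (t, s)) t = fderiv ℝ F (shear g (t, s)) (1, 0) +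
      deriv g t * fderiv ℝ F (shear g (t, s)) (0, 1) := by
    filter_upwards [hg.ae_differentiableAt_real] with t ht
    have h1 : HasDerivAt (fun t => shear g (t, s)) (1, deriv g t) t :=
      (hasDerivAt_id t).prodMk (ht.hasDerivAt.add_const s)
    rw [((hF.differentiable one_ne_zero _).hasFDerivAt.comp_hasDerivAt t h1).deriv]
    have : ((1, deriv g t) : ℝ × ℝ) = (1, 0) + deriv g t • (0, 1) := by simp
    rw [this, map_add, map_smul, smul_eq_mul]
  have hi : ∀ v, Integrable fun t => fderiv ℝ F (shear g (t, s)) v := fun v =>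
    ((hFd.comp hshear).clm_apply continuous_const).integrable_of_hasCompactSupport
      (hasCompactSupport_comp_shear_left g (hasCompactSupport_fderiv_apply hc v) s)
  have hi3 : Integrable fun t => deriv g t * fderiv ℝ F (shear g (t, s)) (0, 1) :=
    (hi (0, 1)).bdd_mul (c := K) (measurable_deriv g).aestronglyMeasurable
      (.of_forall fun t => norm_deriv_le_of_lipschitz hg)
  rw [integral_congr_ae hae, integral_add (hi (1, 0)) hi3] at h0
  linarith

/-- The region is foliated by vertical translates of the graph. Integrating first along each
translate trades the horizontal derivative for `-g'` times the vertical one, which then integrates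
to the boundary value. -/
theorem setIntegral_subgraph_fderiv_fst (hg : LipschitzWith K g) (hF : ContDiff ℝ 1 F)
    (hc : HasCompactSupport F) :
    ∫ q in {q : ℝ × ℝ | q.2 < g q.1}, fderiv ℝ F q (1, 0) = - ∫ t, deriv g t * F (t, g t) := by
  have hgc := hg.continuous
  have hFd : ∀ v, Continuous fun q => fderiv ℝ F q v := fun v =>
    (hF.continuous_fderiv one_ne_zero).clm_apply continuous_const
  have hI : ∀ v : ℝ × ℝ, Integrable (fun q : ℝ × ℝ => fderiv ℝ F (shear g q) v)
      ((volume : Measure ℝ).prod (volume.restrict (Set.Iio 0))) := fun v =>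
    integrable_comp_shear hgc (hFd v) (hasCompactSupport_fderiv_apply hc v)
  have hI2 : Integrable (fun q : ℝ × ℝ => deriv g q.1 * fderiv ℝ F (shear g q) (0, 1))
      ((volume : Measure ℝ).prod (volume.restrict (Set.Iio 0))) :=
    (hI (0, 1)).bdd_mul (c := K) ((measurable_deriv g).comp measurable_fst).aestronglyMeasurable
      (.of_forall fun q => norm_deriv_le_of_lipschitz hg)
  rw [setIntegral_subgraph_eq hgc (hFd (1, 0)) (hasCompactSupport_fderiv_apply hc (1, 0)),
    integral_integral_swap (f := fun t s => fderiv ℝ F (shear g (t, s)) (1, 0)) (hI (1, 0))]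
  simp only [integral_fderiv_shear_left hg hF hc]
  rw [integral_neg, ← integral_integral_swap
    (f := fun t s => deriv g t * fderiv ℝ F (shear g (t, s)) (0, 1)) hI2]
  congr 2
  ext1 t
  rw [integral_const_mul]
  congr 1
  exact setIntegral_Iio_fderiv_shear g hF hc t

end SubgraphIntegral

/-! ### Outer normals -/

section OuterNormal

variable {V : Type*} [NormedAddCommGroup V] [InnerProductSpace ℝ V] {A B : Set V} {p ν ν' : V}

theorem IsOuterUnitNormal.congr (h : IsOuterUnitNormal A p ν)
    (hAB : ∀ᶠ z in 𝓝 p, (z ∈ A ↔ z ∈ B)) : IsOuterUnitNormal B p ν := by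
  refine ⟨h.1, fun ε hε => ?_⟩
  filter_upwards [h.2 ε hε, hAB] with z hz hz'
  rwa [← hz']

/-- For `w = ν' - ν ≠ 0` one has `⟪w, ν⟫ = -|w|²/2` and `⟪w, ν'⟫ = |w|²/2`. With `ε = |w|/4`, a
point `p + s w` with small `s > 0` would be inside according to `ν` and outside according to `ν'`.
-/
theorem IsOuterUnitNormal.unique (h : IsOuterUnitNormal A p ν) (h' : IsOuterUnitNormal A p ν') :
    ν = ν' := by
  by_contra hne
  set w := ν' - ν with hw
  have hw0 : 0 < ‖w‖ := norm_pos_iff.2 (sub_ne_zero.2 (Ne.symm hne))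
  have e1 : ⟪w, ν⟫ = -(‖w‖ ^ 2 / 2) := by
    rw [hw, norm_sub_sq_real, inner_sub_left, real_inner_self_eq_norm_sq, h.1, h'.1]; ring
  have e2 : ⟪w, ν'⟫ = ‖w‖ ^ 2 / 2 := by
    rw [hw, norm_sub_sq_real, inner_sub_left, real_inner_self_eq_norm_sq, h.1, h'.1,
      real_inner_comm]; ring
  have hlim : Filter.Tendsto (fun s : ℝ => p + s • w) (𝓝[>] 0) (𝓝 p) := by
    have : Filter.Tendsto (fun s : ℝ => p + s • w) (𝓝 0) (𝓝 (p + (0 : ℝ) • w)) :=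
      Continuous.tendsto (by fun_prop) 0
    simp only [zero_smul, add_zero] at this
    exact this.mono_left nhdsWithin_le_nhds
  have h1 := hlim.eventually (h.2 (‖w‖ / 4) (by positivity))
  have h2 := hlim.eventually (h'.2 (‖w‖ / 4) (by positivity))
  obtain ⟨s, ⟨hs1, hs2⟩, hs⟩ := ((h1.and h2).and self_mem_nhdsWithin).exists
  have hs0 : (0 : ℝ) < s := hs
  simp only [add_sub_cancel_left, inner_smul_left, norm_smul, e1, e2, Real.norm_eq_abs,
    abs_of_pos hs0, RCLike.conj_to_real] at hs1 hs2
  have hp : 0 < s * ‖w‖ ^ 2 := by positivity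
  exact hs2.2 (by nlinarith) (hs1.1 (by nlinarith))

theorem IsOuterUnitNormal.outerNormal_eq (h : IsOuterUnitNormal A p ν) : outerNormal A p = ν := by
  have H : ∃ ν, IsOuterUnitNormal A p ν := ⟨ν, h⟩
  rw [outerNormal, dif_pos H]
  exact H.choose_spec.unique h

theorem norm_outerNormal_le (A : Set V) (p : V) : ‖outerNormal A p‖ ≤ 1 := by
  unfold outerNormal
  split_ifs with H
  · exact H.choose_spec.1.le
  · simp

end OuterNormal

/-! ### Regions below Lipschitz graphs in the plane -/

section Subgraph

open scoped NNReal

variable {J : RSPlane ≃ₗᵢ[ℝ] RSPlane} {g : ℝ → ℝ} {K : ℝ≥0}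

/-- The region below the graph of `g` in the coordinates given by the isometry `J`. -/
def subgraph (J : RSPlane ≃ₗᵢ[ℝ] RSPlane) (g : ℝ → ℝ) : Set RSPlane :=
  {z | (J.symm z).snd < g (J.symm z).fst}

/-- The graph parametrization in the coordinates given by `J`. -/
noncomputable def graphMap (J : RSPlane ≃ₗᵢ[ℝ] RSPlane) (g : ℝ → ℝ) (t : ℝ) : RSPlane :=
  J (WithLp.toLp 2 (t, g t))

/-- The upward vector orthogonal to a line of slope `m`, in the coordinates given by `J`. -/
noncomputable def slopeNormal (J : RSPlane ≃ₗᵢ[ℝ] RSPlane) (m : ℝ) : RSPlane :=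
  J (WithLp.toLp 2 (-m, 1))

theorem norm_slopeNormal (m : ℝ) : ‖slopeNormal J m‖ = √(1 + m ^ 2) := by
  rw [slopeNormal, J.norm_map, WithLp.prod_norm_eq_of_L2]
  simp [add_comm]

theorem norm_slopeNormal_pos (m : ℝ) : 0 < ‖slopeNormal J m‖ := by
  rw [norm_slopeNormal]; positivity

theorem one_le_norm_slopeNormal (m : ℝ) : 1 ≤ ‖slopeNormal J m‖ := by
  rw [norm_slopeNormal]; exact Real.one_le_sqrt.2 (by nlinarith [sq_nonneg m])

theorem continuous_slopeNormal : Continuous (slopeNormal J) := by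
  unfold slopeNormal; fun_prop

theorem isOpen_subgraph (hg : Continuous g) : IsOpen (subgraph J g) :=
  isOpen_lt (by fun_prop) (by fun_prop)

theorem graphMap_leftInverse : Function.LeftInverse (fun z => (J.symm z).fst) (graphMap J g) :=
  fun t => by simp [graphMap]

@[simp]
theorem fst_symm_graphMap (t : ℝ) : (J.symm (graphMap J g t)).fst = t :=
  graphMap_leftInverse t

theorem lipschitzWith_fst_symm : LipschitzWith 1 fun z => (J.symm z).fst := by
  refine LipschitzWith.of_dist_le_mul fun z w => ?_
  rw [NNReal.coe_one, one_mul, dist_eq_norm, dist_eq_norm, ← J.symm.norm_map (z - w), map_sub,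
    ← WithLp.sub_fst]
  exact WithLp.norm_fst_le _ _

theorem lipschitzWith_graphMap (hg : LipschitzWith K g) : LipschitzWith (1 + K) (graphMap J g) := by
  refine LipschitzWith.of_dist_le_mul fun t s => ?_
  rw [graphMap, graphMap, J.dist_map, dist_eq_norm]
  have h1 : (WithLp.toLp 2 (t, g t) - WithLp.toLp 2 (s, g s) : RSPlane) =
    WithLp.toLp 2 (t - s, 0) + WithLp.toLp 2 (0, g t - g s) := by
    refine (WithLp.ofLp_injective 2) ?_
    simp
  have h2 : ‖(WithLp.toLp 2 (t - s, 0) : RSPlane)‖ = |t - s| := by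
    rw [WithLp.prod_norm_eq_of_L2]; simp [Real.sqrt_sq_eq_abs]
  have h3 : ‖(WithLp.toLp 2 (0, g t - g s) : RSPlane)‖ = |g t - g s| := by
    rw [WithLp.prod_norm_eq_of_L2]; simp [Real.sqrt_sq_eq_abs]
  have := hg.dist_le_mul t s
  simp only [Real.dist_eq] at this
  rw [h1]
  refine (norm_add_le _ _).trans ?_
  rw [h2, h3, Real.dist_eq, NNReal.coe_add, NNReal.coe_one]
  linarith

theorem hasDerivAt_graphMap {m t : ℝ} (h : HasDerivAt g m t) :
    HasDerivAt (graphMap J g) (J (WithLp.toLp 2 (1, m))) t := by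
  have h1 : HasDerivAt (fun t => (t, g t)) (1, m) t := (hasDerivAt_id t).prodMk h
  have h2 := (WithLp.prodContinuousLinearEquiv 2 ℝ ℝ ℝ).symm.hasFDerivAt.comp_hasDerivAt t h1
  exact J.toContinuousLinearEquiv.hasFDerivAt.comp_hasDerivAt t h2

theorem norm_deriv_graphMap {m t : ℝ} (h : HasDerivAt g m t) :
    ‖deriv (graphMap J g) t‖ = ‖slopeNormal J m‖ := by
  rw [(hasDerivAt_graphMap h).deriv, norm_slopeNormal, J.norm_map, WithLp.prod_norm_eq_of_L2]
  simp

theorem mem_range_graphMap_iff {z : RSPlane} :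
    z ∈ Set.range (graphMap J g) ↔ (J.symm z).snd = g (J.symm z).fst := by
  constructor
  · rintro ⟨t, rfl⟩; simp [graphMap]
  · intro h
    refine ⟨(J.symm z).fst, ?_⟩
    rw [graphMap, ← h]
    exact J.apply_symm_apply z

theorem frontier_subgraph (hg : Continuous g) :
    frontier (subgraph J g) = Set.range (graphMap J g) := by
  refine Set.Subset.antisymm (fun z hz => mem_range_graphMap_iff.2 ?_) ?_
  · exact frontier_lt_subset_eq (f := fun z => (J.symm z).snd) (g := fun z => g (J.symm z).fst)
      (by fun_prop) (by fun_prop) hz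
  · rintro _ ⟨t, rfl⟩
    rw [(isOpen_subgraph hg).frontier_eq]
    refine ⟨?_, by simp [subgraph, graphMap]⟩
    have hlim : Filter.Tendsto (fun s : ℝ => J (WithLp.toLp 2 (t, g t - s))) (𝓝[>] 0)
        (𝓝 (graphMap J g t)) := by
      have : Filter.Tendsto (fun s : ℝ => J (WithLp.toLp 2 (t, g t - s))) (𝓝 0)
          (𝓝 (J (WithLp.toLp 2 (t, g t - 0)))) := Continuous.tendsto (by fun_prop) 0
      rw [sub_zero] at this
      exact this.mono_left nhdsWithin_le_nhds
    refine mem_closure_of_tendsto hlim ?_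
    filter_upwards [self_mem_nhdsWithin] with s hs
    simpa [subgraph] using hs

/-- The pairing of `z - p` with the normal is the height of `z` over the tangent line divided by
`√(1 + m²) ≥ 1`. Off the `ε`-cone this height exceeds the error of the linear approximation of `g`,
so its sign decides membership. -/
theorem isOuterUnitNormal_subgraph {m t : ℝ} (h : HasDerivAt g m t) :
    IsOuterUnitNormal (subgraph J g) (graphMap J g t) (‖slopeNormal J m‖⁻¹ • slopeNormal J m) := by
  have hpos := norm_slopeNormal_pos (J := J) m
  refine ⟨by rw [norm_smul, norm_inv, norm_norm, inv_mul_cancel₀ hpos.ne'], fun ε hε => ?_⟩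
  have hπ : Filter.Tendsto (fun z => (J.symm z).fst) (𝓝 (graphMap J g t)) (𝓝 t) := by
    have : Continuous fun z => (J.symm z).fst := by fun_prop
    simpa [graphMap] using this.tendsto (graphMap J g t)
  filter_upwards [hπ.eventually (h.isLittleO.def hε)] with z hz
  set a := (J.symm z).fst with ha
  have hza : |a - t| ≤ ‖z - graphMap J g t‖ := by
    have := (lipschitzWith_fst_symm (J := J)).dist_le_mul z (graphMap J g t)
    rw [fst_symm_graphMap, NNReal.coe_one, one_mul, Real.dist_eq, dist_eq_norm] at this
    exact this
  have hin : ⟪z - graphMap J g t, ‖slopeNormal J m‖⁻¹ • slopeNormal J m⟫ =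
      ‖slopeNormal J m‖⁻¹ * ((J.symm z).snd - g t - m * (a - t)) := by
    rw [inner_smul_right]
    congr 1
    rw [slopeNormal, ← J.symm.inner_map_map, J.symm_apply_apply, map_sub, graphMap,
      J.symm_apply_apply, WithLp.prod_inner_apply]
    simp [← ha]
    ring
  have hn := one_le_norm_slopeNormal (J := J) m
  rw [hin]
  simp only [smul_eq_mul, Real.norm_eq_abs] at hz
  have hz' : |g a - g t - (a - t) * m| ≤ ε * ‖z - graphMap J g t‖ :=
    hz.trans (mul_le_mul_of_nonneg_left hza hε.le)
  have hD : 0 ≤ ε * ‖z - graphMap J g t‖ := by positivity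
  obtain ⟨hz1, hz2⟩ := abs_le.1 hz'
  constructor
  · intro h1
    rw [inv_mul_lt_iff₀ hpos] at h1
    show (J.symm z).snd < g a
    nlinarith
  · intro h1 h2
    rw [lt_inv_mul_iff₀ hpos] at h1
    have h2' : (J.symm z).snd < g a := h2
    nlinarith

theorem outerNormal_subgraph {m t : ℝ} (h : HasDerivAt g m t) :
    outerNormal (subgraph J g) (graphMap J g t) = ‖slopeNormal J m‖⁻¹ • slopeNormal J m :=
  (isOuterUnitNormal_subgraph h).outerNormal_eq

theorem ae_range_graphMap (J : RSPlane ≃ₗᵢ[ℝ] RSPlane) (hg : LipschitzWith K g) :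
    ∀ᵐ z ∂(μH[1] : Measure RSPlane).restrict (Set.range (graphMap J g)),
      ∃ t, z = graphMap J g t ∧ (J.symm z).fst = t ∧ DifferentiableAt ℝ g t := by
  have hD : MeasurableSet {t | DifferentiableAt ℝ g t} := measurableSet_of_differentiableAt ℝ g
  have hm : MeasurableSet (Set.range (graphMap J g)) :=
    ((lipschitzWith_graphMap hg).continuous.measurableEmbedding
      graphMap_leftInverse.injective).measurableSet_range
  have h1 : ∀ᵐ z ∂(μH[1] : Measure RSPlane).restrict (Set.range (graphMap J g)),
      DifferentiableAt ℝ g (J.symm z).fst := by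
    have hD' : MeasurableSet {z | DifferentiableAt ℝ g (J.symm z).fst} :=
      (lipschitzWith_fst_symm (J := J)).continuous.measurable hD
    rw [hausdorffMeasure_restrict_range graphMap_leftInverse lipschitzWith_fst_symm
      (lipschitzWith_graphMap hg), ae_map_iff (lipschitzWith_graphMap hg).continuous.aemeasurable
      hD']
    refine (withDensity_absolutelyContinuous _ _).ae_le ?_
    filter_upwards [hg.ae_differentiableAt_real] with t ht
    rwa [fst_symm_graphMap]
  filter_upwards [h1, ae_restrict_mem hm] with z hz hz'
  obtain ⟨t, rfl⟩ := hz'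
  exact ⟨t, rfl, graphMap_leftInverse t, by rwa [fst_symm_graphMap] at hz⟩

theorem ae_outerNormal_subgraph (J : RSPlane ≃ₗᵢ[ℝ] RSPlane) (hg : LipschitzWith K g) :
    ∀ᵐ z ∂(μH[1] : Measure RSPlane).restrict (Set.range (graphMap J g)),
      IsOuterUnitNormal (subgraph J g) z
        (‖slopeNormal J (deriv g (J.symm z).fst)‖⁻¹ • slopeNormal J (deriv g (J.symm z).fst)) := by
  filter_upwards [ae_range_graphMap J hg] with z hz
  obtain ⟨t, rfl, ht, hd⟩ := hz
  rw [ht]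
  exact isOuterUnitNormal_subgraph hd.hasDerivAt

theorem aestronglyMeasurable_outerNormal_subgraph (J : RSPlane ≃ₗᵢ[ℝ] RSPlane)
    (hg : LipschitzWith K g) : AEStronglyMeasurable (outerNormal (subgraph J g))
      ((μH[1] : Measure RSPlane).restrict (Set.range (graphMap J g))) := by
  have hm : Measurable fun z => slopeNormal J (deriv g (J.symm z).fst) :=
    continuous_slopeNormal.measurable.comp ((measurable_deriv g).comp
      (lipschitzWith_fst_symm (J := J)).continuous.measurable)
  refine (hm.norm.inv.smul hm).aestronglyMeasurable.congr ?_
  filter_upwards [ae_outerNormal_subgraph J hg] with z hz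
  exact hz.outerNormal_eq.symm

theorem hausdorffMeasure_range_inter_lt_top (J : RSPlane ≃ₗᵢ[ℝ] RSPlane) (hg : LipschitzWith K g)
    {s : Set RSPlane} (hs : Bornology.IsBounded s) :
    (μH[1] : Measure RSPlane) (Set.range (graphMap J g) ∩ s) < ⊤ := by
  have hb : Bornology.IsBounded ((fun z => (J.symm z).fst) '' s) :=
    lipschitzWith_fst_symm.isBounded_image hs
  refine (measure_mono (t := graphMap J g '' ((fun z => (J.symm z).fst) '' s)) ?_).trans_lt ?_
  · rintro _ ⟨⟨t, rfl⟩, hz⟩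
    exact ⟨t, ⟨_, hz, graphMap_leftInverse t⟩, rfl⟩
  · refine ((lipschitzWith_graphMap hg).hausdorffMeasure_image_le zero_le_one _).trans_lt ?_
    rw [hausdorffMeasure_real]
    exact ENNReal.mul_lt_top (by simp) hb.measure_lt_top

theorem setIntegral_subgraph_fderiv (J : RSPlane ≃ₗᵢ[ℝ] RSPlane) (hg : LipschitzWith K g)
    {f : RSPlane → ℝ} (hf : ContDiff ℝ 1 f) (hc : HasCompactSupport f) (e : RSPlane) :
    ∫ z in subgraph J g, fderiv ℝ f z e =
      ∫ t, f (graphMap J g t) * ⟪slopeNormal J (deriv g t), e⟫ := by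
  set L : (ℝ × ℝ) ≃L[ℝ] RSPlane :=
    (WithLp.prodContinuousLinearEquiv 2 ℝ ℝ ℝ).symm.trans J.toContinuousLinearEquiv with hL
  set F : ℝ × ℝ → ℝ := f ∘ L with hF
  have hFc : HasCompactSupport F := hc.comp_homeomorph L.toHomeomorph
  have hF1 : ContDiff ℝ 1 F := hf.comp L.contDiff
  have hmp : MeasurePreserving L := by
    exact J.measurePreserving.comp (WithLp.volume_preserving_toLp ℝ ℝ)
  have hFd : ∀ q v, fderiv ℝ F q v = fderiv ℝ f (L q) (L v) := fun q v => by
    rw [hF, fderiv_comp q (hf.differentiable one_ne_zero _) L.differentiableAt,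
      ContinuousLinearMap.comp_apply, L.hasFDerivAt.fderiv]
    rfl
  set a := (J.symm e).fst
  set b := (J.symm e).snd
  have he : e = L (a, b) := by
    exact (J.apply_symm_apply e).symm
  have hpre : L ⁻¹' subgraph J g = {q : ℝ × ℝ | q.2 < g q.1} := by
    ext q; simp [hL, subgraph]
  have hi : ∀ v, Integrable (fun q => fderiv ℝ F q v) := fun v =>
    ((hF1.continuous_fderiv one_ne_zero).clm_apply continuous_const).integrable_of_hasCompactSupport
      (hasCompactSupport_fderiv_apply hFc v)
  have hab : ((a, b) : ℝ × ℝ) = a • (1, 0) + b • (0, 1) := by simp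
  have hGc : HasCompactSupport fun t => F (t, g t) := by
    refine HasCompactSupport.intro (hFc.isCompact.image continuous_fst) fun t ht => ?_
    exact image_eq_zero_of_notMem_tsupport (f := F) fun h => ht ⟨_, h, rfl⟩
  have hgc := hg.continuous
  have hi1 : Integrable fun t => F (t, g t) :=
    (hF1.continuous.comp (by fun_prop)).integrable_of_hasCompactSupport hGc
  have hi2 : Integrable fun t => deriv g t * F (t, g t) :=
    hi1.bdd_mul (c := K) (measurable_deriv g).aestronglyMeasurable
      (.of_forall fun t => norm_deriv_le_of_lipschitz hg)
  calc ∫ z in subgraph J g, fderiv ℝ f z e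
      = ∫ q in {q : ℝ × ℝ | q.2 < g q.1}, fderiv ℝ F q (a, b) := by
        rw [← hmp.setIntegral_preimage_emb L.toHomeomorph.measurableEmbedding, hpre]
        simp_rw [hFd, ← he]
    _ = a * (-∫ t, deriv g t * F (t, g t)) + b * (∫ t, F (t, g t)) := by
        rw [← setIntegral_subgraph_fderiv_fst hg hF1 hFc,
          ← setIntegral_subgraph_fderiv_snd hgc hF1 hFc, ← integral_const_mul,
          ← integral_const_mul, ← integral_add ((hi _).const_mul a).integrableOn
            ((hi _).const_mul b).integrableOn]
        simp_rw [hab, map_add, map_smul, smul_eq_mul]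
    _ = _ := by
        rw [mul_neg, neg_add_eq_sub, ← integral_const_mul, ← integral_const_mul,
          ← integral_sub (hi1.const_mul b) (hi2.const_mul a)]
        congr 1
        ext1 t
        have : ⟪slopeNormal J (deriv g t), e⟫ = b - deriv g t * a := by
          rw [slopeNormal, ← J.symm.inner_map_map, J.symm_apply_apply, WithLp.prod_inner_apply]
          simp [a, b]
          ring
        rw [this]
        simp only [hF, Function.comp_apply]
        have : L (t, g t) = graphMap J g t := rfl
        rw [this]
        ring

/-- The length element `√(1 + g'²)` cancels the normalization of the normal, leaving `(-g', 1)` in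
the coordinates of `J`. -/
theorem setIntegral_range_eq (J : RSPlane ≃ₗᵢ[ℝ] RSPlane) (hg : LipschitzWith K g)
    (f : RSPlane → ℝ) (e : RSPlane) :
    ∫ z in Set.range (graphMap J g), f z * ⟪outerNormal (subgraph J g) z, e⟫ ∂μH[1] =
      ∫ t, f (graphMap J g t) * ⟪slopeNormal J (deriv g t), e⟫ := by
  have hemb := (lipschitzWith_graphMap (J := J) hg).continuous.measurableEmbedding
    graphMap_leftInverse.injective
  rw [hausdorffMeasure_restrict_range graphMap_leftInverse lipschitzWith_fst_symm
    (lipschitzWith_graphMap hg), hemb.integral_map]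
  have : (fun t => ‖deriv (graphMap J g) t‖ₑ) = fun t => ((‖deriv (graphMap J g) t‖₊ : ℝ≥0) : ℝ≥0∞) :=
    rfl
  rw [this, integral_withDensity_eq_integral_smul (measurable_deriv _).nnnorm]
  refine integral_congr_ae ?_
  filter_upwards [hg.ae_differentiableAt_real] with t ht
  have hpos := norm_slopeNormal_pos (J := J) (deriv g t)
  rw [outerNormal_subgraph ht.hasDerivAt, inner_smul_left, NNReal.smul_def, coe_nnnorm,
    norm_deriv_graphMap ht.hasDerivAt, smul_eq_mul, RCLike.conj_to_real]
  field_simp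

theorem setIntegral_subgraph_fderiv_eq (J : RSPlane ≃ₗᵢ[ℝ] RSPlane) (hg : LipschitzWith K g)
    {f : RSPlane → ℝ} (hf : ContDiff ℝ 1 f) (hc : HasCompactSupport f) (e : RSPlane) :
    ∫ z in subgraph J g, fderiv ℝ f z e =
      ∫ z in frontier (subgraph J g), f z * ⟪outerNormal (subgraph J g) z, e⟫ ∂μH[1] := by
  rw [frontier_subgraph hg.continuous, setIntegral_range_eq J hg,
    setIntegral_subgraph_fderiv J hg hf hc]

end Subgraph

/-! ### The generating set of a symmetric Lipschitz domain lies below Lipschitz graphs -/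

section Cone

open scoped NNReal

/-- A set with Lipschitz boundary is invariant under small translations in a cone. -/
theorem HasLipschitzBoundary.exists_cone {V : Type*} [NormedAddCommGroup V] [InnerProductSpace ℝ V]
    {A : Set V} (hA : HasLipschitzBoundary A) {p : V} (hp : p ∈ frontier A) :
    ∃ (v : V) (η ρ : ℝ), ‖v‖ = 1 ∧ 0 < η ∧ η ≤ 1 ∧ 0 < ρ ∧ ∀ z ∈ A, z ∈ Metric.ball p ρ →
      ∀ (t : ℝ) (b : V), 0 ≤ t → ‖b‖ ≤ η → z - t • (v + b) ∈ Metric.ball p ρ →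
        z - t • (v + b) ∈ A := by
  obtain ⟨v, K, g, hv, hg, hev⟩ := hA p hp
  obtain ⟨ρ, hρ, hball⟩ := Metric.eventually_nhds_iff_ball.1 hev
  have hK : (0 : ℝ) < 1 + K := by positivity
  -- A step `t (v + b)` lowers the height by `t (1 + β)` with `β ≥ -|b|`, while the base point moves
  -- by at most `t |b|`, so the graph drops by at most `K t |b|`. The bound `(1 + K)|b| ≤ 1` makes
  -- the loss of height at least the drop.
  refine ⟨v, (1 + K)⁻¹, ρ, hv, by positivity, inv_le_one_of_one_le₀ (by simp), hρ, ?_⟩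
  intro z hz hzρ t b ht hb hzt
  rw [hball _ hzt]
  have h1 := (hball _ hzρ).1 hz
  have hvv : ⟪v, v⟫ = 1 := by rw [real_inner_self_eq_norm_sq, hv, one_pow]
  set β := ⟪b, v⟫ with hβ
  have e1 : ⟪z - t • (v + b), v⟫ = ⟪z, v⟫ - t * (1 + β) := by
    rw [inner_sub_left, inner_smul_left, inner_add_left, hvv]; rfl
  have hβb : |β| ≤ ‖b‖ := by simpa [hv] using abs_real_inner_le_norm b v
  have e2 : (z - t • (v + b)) - ⟪z - t • (v + b), v⟫ • v =
      (z - ⟪z, v⟫ • v) - t • (b - β • v) := by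
    rw [e1]; module
  have e3 : ‖b - β • v‖ ≤ ‖b‖ := by
    refine abs_le_of_sq_le_sq' ?_ (norm_nonneg _) |>.2
    rw [norm_sub_sq_real, inner_smul_right, norm_smul, hv, Real.norm_eq_abs, mul_one, sq_abs]
    nlinarith [sq_nonneg β]
  have h2 := hg.dist_le_mul (z - ⟪z, v⟫ • v) ((z - ⟪z, v⟫ • v) - t • (b - β • v))
  rw [Real.dist_eq, dist_eq_norm, sub_sub_cancel, norm_smul, Real.norm_eq_abs, abs_of_nonneg ht]
    at h2
  rw [e2, e1]
  have h3 : (1 + K) * ‖b‖ ≤ 1 := by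
    calc (1 + K) * ‖b‖ ≤ (1 + K) * (1 + K : ℝ)⁻¹ := by gcongr
      _ = 1 := mul_inv_cancel₀ hK.ne'
  have h4 := (abs_le.1 h2).2
  have h5 := (abs_le.1 hβb).1
  have h6 : (K : ℝ) * (t * ‖b - β • v‖) ≤ t * (1 + β) := by
    calc (K : ℝ) * (t * ‖b - β • v‖) ≤ K * (t * ‖b‖) := by gcongr
      _ = t * (K * ‖b‖) := by ring
      _ ≤ t * (1 + β) := by gcongr; linarith
  linarith

variable {h k : ℕ} {E : Set (GrushinSpace h k)} {G : Set RSPlane}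

/-- The embedding of the plane as the span of the directions `e` and `e'`. -/
noncomputable def planeEmbedding (e : EuclideanSpace ℝ (Fin h)) (e' : EuclideanSpace ℝ (Fin k))
    (q : RSPlane) : GrushinSpace h k := WithLp.toLp 2 (q.fst • e, q.snd • e')

/-- The reflection of `ℝ^h × ℝ^k` across the span of the directions `e` and `e'`. -/
noncomputable def planeReflection (e : EuclideanSpace ℝ (Fin h)) (e' : EuclideanSpace ℝ (Fin k))
    (z : GrushinSpace h k) : GrushinSpace h k :=
  WithLp.toLp 2 ((ℝ ∙ e).reflection z.fst, (ℝ ∙ e').reflection z.snd)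

variable {e : EuclideanSpace ℝ (Fin h)} {e' : EuclideanSpace ℝ (Fin k)}

theorem planeEmbedding_add (p q : RSPlane) : planeEmbedding e e' (p + q) =
    planeEmbedding e e' p + planeEmbedding e e' q := by
  refine WithLp.ofLp_injective 2 ?_
  simp [planeEmbedding, add_smul]

theorem planeEmbedding_smul (t : ℝ) (q : RSPlane) :
    planeEmbedding e e' (t • q) = t • planeEmbedding e e' q := by
  refine WithLp.ofLp_injective 2 ?_
  simp [planeEmbedding, mul_smul]

theorem planeEmbedding_sub (p q : RSPlane) : planeEmbedding e e' (p - q) =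
    planeEmbedding e e' p - planeEmbedding e e' q := by
  refine WithLp.ofLp_injective 2 ?_
  simp [planeEmbedding, sub_smul]

theorem norm_planeEmbedding (he : ‖e‖ = 1) (he' : ‖e'‖ = 1) (q : RSPlane) :
    ‖planeEmbedding e e' q‖ = ‖q‖ := by
  rw [WithLp.prod_norm_eq_of_L2, WithLp.prod_norm_eq_of_L2]
  simp [planeEmbedding, norm_smul, he, he']

theorem continuous_planeEmbedding : Continuous (planeEmbedding e e') := by
  unfold planeEmbedding; fun_prop

theorem planeEmbedding_mem_iff (he : ‖e‖ = 1) (he' : ‖e'‖ = 1) (hEG : IsXYSymmetricWith E G)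
    {q : RSPlane} (hq : 0 ≤ q.fst) (hq' : 0 ≤ q.snd) : planeEmbedding e e' q ∈ E ↔ q ∈ G := by
  rw [hEG.2]
  show WithLp.toLp 2 (‖q.fst • e‖, ‖q.snd • e'‖) ∈ G ↔ q ∈ G
  rw [norm_smul, norm_smul, he, he', mul_one, mul_one, Real.norm_of_nonneg hq,
    Real.norm_of_nonneg hq']
  exact Iff.rfl

theorem planeReflection_planeReflection (z : GrushinSpace h k) :
    planeReflection e e' (planeReflection e e' z) = z := by
  exact WithLp.ofLp_injective 2
    (Prod.ext (Submodule.reflection_reflection _ _) (Submodule.reflection_reflection _ _))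

theorem planeReflection_sub (z w : GrushinSpace h k) : planeReflection e e' (z - w) =
    planeReflection e e' z - planeReflection e e' w := by
  refine WithLp.ofLp_injective 2 ?_
  simp [planeReflection]

theorem planeReflection_add (z w : GrushinSpace h k) : planeReflection e e' (z + w) =
    planeReflection e e' z + planeReflection e e' w := by
  refine WithLp.ofLp_injective 2 ?_
  simp [planeReflection]

theorem planeReflection_smul (t : ℝ) (z : GrushinSpace h k) : planeReflection e e' (t • z) =
    t • planeReflection e e' z := by
  refine WithLp.ofLp_injective 2 ?_
  simp [planeReflection]

theorem norm_planeReflection (z : GrushinSpace h k) : ‖planeReflection e e' z‖ = ‖z‖ := by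
  rw [WithLp.prod_norm_eq_of_L2, WithLp.prod_norm_eq_of_L2]
  simp [planeReflection]

theorem planeReflection_mem_iff (hEG : IsXYSymmetricWith E G) {z : GrushinSpace h k} :
    planeReflection e e' z ∈ E ↔ z ∈ E := by
  rw [hEG.2]
  simp [planeReflection]

theorem planeReflection_planeEmbedding (q : RSPlane) :
    planeReflection e e' (planeEmbedding e e' q) = planeEmbedding e e' q := by
  refine WithLp.ofLp_injective 2 ?_
  simp [planeReflection, planeEmbedding, Submodule.reflection_mem_subspace_eq_self,
    Submodule.mem_span_singleton_self]

/-- The mean of a vector and its mirror image is its orthogonal projection to the plane. This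
converts the cone axis of `E` into an axis inside the plane of `G`. -/
theorem add_planeReflection (he : ‖e‖ = 1) (he' : ‖e'‖ = 1) (v : GrushinSpace h k) :
    v + planeReflection e e' v =
      (2 : ℝ) • planeEmbedding e e' (WithLp.toLp 2 (⟪e, v.fst⟫, ⟪e', v.snd⟫)) := by
  refine WithLp.ofLp_injective 2 ?_
  simp [planeReflection, planeEmbedding, Submodule.reflection_singleton_apply, he, he', two_smul]
  exact Prod.ext (add_sub_cancel v.fst _) (add_sub_cancel v.snd _)

theorem isOpen_openQuadrant : IsOpen openQuadrant :=
  (isOpen_lt continuous_const (show Continuous fun p : RSPlane => p.fst by fun_prop)).inter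
    (isOpen_lt continuous_const (show Continuous fun p : RSPlane => p.snd by fun_prop))

theorem exists_unit_vector {n : ℕ} (hn : 1 ≤ n) : ∃ e : EuclideanSpace ℝ (Fin n), ‖e‖ = 1 :=
  ⟨EuclideanSpace.single ⟨0, hn⟩ 1, by simp⟩

theorem isOpen_generating_inter (hh : 1 ≤ h) (hk : 1 ≤ k) (hE : IsOpen E)
    (hEG : IsXYSymmetricWith E G) : IsOpen (G ∩ openQuadrant) := by
  obtain ⟨e, he⟩ := exists_unit_vector hh
  obtain ⟨e', he'⟩ := exists_unit_vector hk
  have : G ∩ openQuadrant = planeEmbedding e e' ⁻¹' E ∩ openQuadrant := by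
    ext q
    refine and_congr_left fun hq => ?_
    exact (planeEmbedding_mem_iff he he' hEG hq.1.le hq.2.le).symm
  rw [this]
  exact (hE.preimage continuous_planeEmbedding).inter isOpen_openQuadrant

theorem notMem_of_mem_quadrantBoundary (hG : IsOpen (G ∩ openQuadrant)) {p : RSPlane}
    (hp : p ∈ quadrantBoundary G) : p ∉ G := fun h =>
  hp.1.2 (mem_interior.2 ⟨_, Set.inter_subset_left, hG, h, hp.2⟩)

theorem planeEmbedding_mem_frontier (he : ‖e‖ = 1) (he' : ‖e'‖ = 1) (hE : IsOpen E)
    (hEG : IsXYSymmetricWith E G) (hG : IsOpen (G ∩ openQuadrant)) {p : RSPlane}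
    (hp : p ∈ quadrantBoundary G) : planeEmbedding e e' p ∈ frontier E := by
  rw [hE.frontier_eq]
  refine ⟨?_, fun h => notMem_of_mem_quadrantBoundary hG hp
    ((planeEmbedding_mem_iff he he' hEG hp.2.1.le hp.2.2.le).1 h)⟩
  have h1 : p ∈ closure (G ∩ openQuadrant) := isOpen_openQuadrant.closure_inter ⟨hp.1.1, hp.2⟩
  refine closure_mono ?_ (mem_closure_image continuous_planeEmbedding.continuousAt h1)
  rintro _ ⟨q, hq, rfl⟩
  exact (planeEmbedding_mem_iff he he' hEG hq.2.1.le hq.2.2.le).2 hq.1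

/-- Near a boundary point in the open quadrant, the generating set of a symmetric set with
Lipschitz boundary is invariant under small translations in a cone. -/
theorem exists_cone_generating (hh : 1 ≤ h) (hk : 1 ≤ k) (hE : IsOpen E)
    (hEG : IsXYSymmetricWith E G) (hL : HasLipschitzBoundary E) {p : RSPlane}
    (hp : p ∈ quadrantBoundary G) :
    ∃ (a : RSPlane) (η δ : ℝ), a ≠ 0 ∧ 0 < η ∧ 0 < δ ∧
      Metric.ball p δ ⊆ openQuadrant ∧ ∀ q ∈ G, q ∈ Metric.ball p δ →
      ∀ (t : ℝ) (b : RSPlane), 0 ≤ t → t ≤ δ → ‖b‖ ≤ η → q - t • (a + b) ∈ G := by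
  obtain ⟨e, he⟩ := exists_unit_vector hh
  obtain ⟨e', he'⟩ := exists_unit_vector hk
  have hG := isOpen_generating_inter hh hk hE hEG
  obtain ⟨v, η, ρ, hv, hη, hη1, hρ, hcone⟩ :=
    hL.exists_cone (planeEmbedding_mem_frontier he he' hE hEG hG hp)
  obtain ⟨ρ', hρ', hQ⟩ := Metric.isOpen_iff.1 isOpen_openQuadrant p hp.2
  -- The path below makes two half steps of length at most `δ`, starting within `δ` of `p`, so all
  -- its points stay within `3δ`.
  set δ := min ρ ρ' / 4 with hδdef
  have hδ : 0 < δ := by positivity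
  have hδρ : 4 * δ ≤ ρ := by linarith [min_le_left ρ ρ']
  have hδρ' : 4 * δ ≤ ρ' := by linarith [min_le_right ρ ρ']
  set a : RSPlane := WithLp.toLp 2 (⟪e, v.fst⟫, ⟪e', v.snd⟫) with ha
  have key : ∀ q ∈ G, q ∈ Metric.ball p δ →
      ∀ (t : ℝ) (b : RSPlane), 0 ≤ t → t ≤ δ → ‖b‖ ≤ η → q - t • (a + b) ∈ G := by
    intro q hq hqp t b ht htδ hb
    set ι := planeEmbedding e e' with hι
    set R := planeReflection e e' with hR
    have hqQ : q ∈ openQuadrant := hQ (Metric.ball_subset_ball (by linarith) hqp)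
    have hιq : ι q ∈ E := (planeEmbedding_mem_iff he he' hEG hqQ.1.le hqQ.2.le).2 hq
    have hιb : ‖ι b‖ ≤ η := (norm_planeEmbedding he he' b).trans_le hb
    have hιd : ‖ι q - ι p‖ < δ := by
      rw [hι, ← planeEmbedding_sub, norm_planeEmbedding he he']
      rwa [mem_ball_iff_norm] at hqp
    have hvb : ‖(t / 2) • (v + ι b)‖ ≤ δ := by
      rw [norm_smul, Real.norm_of_nonneg (by positivity)]
      have : ‖v + ι b‖ ≤ 2 := (norm_add_le _ _).trans (by linarith)
      nlinarith [norm_nonneg (v + ι b)]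
    -- A half step along `v + b` followed by a half step along its mirror image stays in `E`, by the
    -- reflection symmetry. Together they amount to a translation by `t (a + b)` inside the plane,
    -- even though the intermediate point leaves the plane.
    set z1 := ι q - (t / 2) • (v + ι b) with hz1
    have hz1p : ‖z1 - ι p‖ < 2 * δ := by
      have : z1 - ι p = (ι q - ι p) - (t / 2) • (v + ι b) := by rw [hz1]; abel
      rw [this]
      exact (norm_sub_le _ _).trans_lt (by linarith)
    have hz1E : z1 ∈ E := hcone _ hιq (by rw [mem_ball_iff_norm]; linarith) _ _ (by positivity) hιb
      (by rw [mem_ball_iff_norm]; linarith)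
    have hRp : R (ι p) = ι p := planeReflection_planeEmbedding p
    have hRb : R (ι b) = ι b := planeReflection_planeEmbedding b
    have hRz1 : ‖R z1 - ι p‖ < 2 * δ := by
      rw [← hRp, hR, ← planeReflection_sub, norm_planeReflection]
      exact hz1p
    have hz2 : R z1 - (t / 2) • (v + ι b) ∈ E := by
      refine hcone _ ((planeReflection_mem_iff hEG).2 hz1E) (by rw [mem_ball_iff_norm]; linarith)
        _ _ (by positivity) hιb ?_
      rw [mem_ball_iff_norm]
      have : R z1 - (t / 2) • (v + ι b) - ι p = (R z1 - ι p) - (t / 2) • (v + ι b) := by abel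
      rw [this]
      exact (norm_sub_le _ _).trans_lt (by linarith)
    have h3 : R (R z1 - (t / 2) • (v + ι b)) = ι (q - t • (a + b)) := by
      have hsum := add_planeReflection he he' v
      rw [← hι, ← hR, ← ha] at hsum
      have hRv : R v = (2 : ℝ) • ι a - v := eq_sub_of_add_eq' hsum
      rw [hR, planeReflection_sub, planeReflection_planeReflection, planeReflection_smul,
        planeReflection_add, ← hR, hRb, hRv, hz1, hι, planeEmbedding_sub, planeEmbedding_smul,
        planeEmbedding_add]
      module
    have h4 : ι (q - t • (a + b)) ∈ E := h3 ▸ (planeReflection_mem_iff hEG).2 hz2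
    have h5 : q - t • (a + b) ∈ openQuadrant := by
      refine hQ ?_
      rw [mem_ball_iff_norm, ← norm_planeEmbedding he he', planeEmbedding_sub, ← hι, ← h3]
      rw [← hRp, hR, ← planeReflection_sub, norm_planeReflection, ← hR]
      have : R z1 - (t / 2) • (v + ι b) - ι p = (R z1 - ι p) - (t / 2) • (v + ι b) := by abel
      rw [this]
      exact (norm_sub_le _ _).trans_lt (by linarith)
    exact (planeEmbedding_mem_iff he he' hEG h5.1.le h5.2.le).1 h4
  refine ⟨a, η, δ, ?_, hη, hδ, (Metric.ball_subset_ball (by linarith)).trans hQ, key⟩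
  -- If the projected axis were zero, `G` would be invariant near `p` under all small translations.
  -- Taking `t = δ` and `b = (q - p)/δ` would move a point `q ∈ G` close to `p` onto `p`, which is
  -- not in `G`.
  intro ha0
  obtain ⟨q, hqG, hqp⟩ := Metric.mem_closure_iff.1 hp.1.1 (min δ (δ * η)) (by positivity)
  have hqp' : ‖q - p‖ < min δ (δ * η) := by rwa [← dist_eq_norm, dist_comm]
  have := key q hqG (mem_ball_iff_norm.2 (hqp'.trans_le (min_le_left _ _))) δ (δ⁻¹ • (q - p)) hδ.le
    le_rfl ?_
  · rw [ha0, zero_add, smul_inv_smul₀ hδ.ne', sub_sub_cancel] at this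
    exact notMem_of_mem_quadrantBoundary hG hp this
  · rw [norm_smul, norm_inv, Real.norm_of_nonneg hδ.le, inv_mul_le_iff₀ hδ]
    exact (hqp'.trans_le (min_le_right _ _)).le

/-- Near a boundary point in the open quadrant, the generating set of a symmetric set with
Lipschitz boundary is the region below the graph of a Lipschitz function. -/
theorem exists_subgraph_generating (hh : 1 ≤ h) (hk : 1 ≤ k) (hE : IsOpen E)
    (hEG : IsXYSymmetricWith E G) (hL : HasLipschitzBoundary E) {p : RSPlane}
    (hp : p ∈ quadrantBoundary G) :
    ∃ (J : RSPlane ≃ₗᵢ[ℝ] RSPlane) (L : ℝ≥0) (g : ℝ → ℝ) (ρ : ℝ), LipschitzWith L g ∧ 0 < ρ ∧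
      Metric.ball p ρ ⊆ openQuadrant ∧ G ∩ Metric.ball p ρ = subgraph J g ∩ Metric.ball p ρ := by
  obtain ⟨a, η, δ, ha, hη, hδ, hQ, hcone⟩ := exists_cone_generating hh hk hE hEG hL hp
  have hG := isOpen_generating_inter hh hk hE hEG
  have ha' : 0 < ‖a‖ := norm_pos_iff.2 ha
  set e₂ : RSPlane := WithLp.toLp 2 (0, 1) with he₂
  have he₂n : ‖e₂‖ = ‖‖a‖⁻¹ • a‖ := by
    rw [norm_smul, norm_inv, norm_norm, inv_mul_cancel₀ ha'.ne', WithLp.prod_norm_eq_of_L2]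
    simp [he₂]
  -- The reflection exchanging the vertical unit vector with the direction of `a`.
  set J : RSPlane ≃ₗᵢ[ℝ] RSPlane := (ℝ ∙ (e₂ - ‖a‖⁻¹ • a))ᗮ.reflection with hJ
  have hJe : J e₂ = ‖a‖⁻¹ • a := Submodule.reflection_sub he₂n
  -- Horizontal perturbations `b` of size at most `η` tilt `a` by slopes up to `η / |a|`, so the
  -- admissible downward directions are those with `L |d₁| ≤ d₂`.
  set L : ℝ≥0 := Real.toNNReal (‖a‖ / η) with hLdef
  have hLr : (L : ℝ) = ‖a‖ / η := Real.coe_toNNReal _ (by positivity)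
  set ρ := min δ (δ * ‖a‖) / 2 with hρdef
  have hρ : 0 < ρ := by positivity
  have hρδ : ρ ≤ δ := by linarith [min_le_left δ (δ * ‖a‖)]
  have hρa : 2 * ρ ≤ δ * ‖a‖ := by linarith [min_le_right δ (δ * ‖a‖)]
  have hball : Metric.ball p ρ ⊆ openQuadrant := (Metric.ball_subset_ball hρδ).trans hQ
  -- translations in the cone, in coordinates
  have hcone' : ∀ q ∈ G, q ∈ Metric.ball p ρ → ∀ d : RSPlane, ‖d‖ ≤ 2 * ρ →
      L * |d.fst| ≤ d.snd → q - J d ∈ G := by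
    intro q hq hqp d hd hLd
    have hd2 : |d.snd| ≤ ‖d‖ := WithLp.norm_snd_le _ d
    have hdn : 0 ≤ d.snd := le_trans (by positivity) hLd
    rw [abs_of_nonneg hdn] at hd2
    rcases hdn.eq_or_lt with h0 | h0
    · have h1 : d.fst = 0 := by
        rw [← h0, hLr] at hLd
        have : |d.fst| ≤ 0 := nonpos_of_mul_nonpos_right hLd (by positivity)
        exact abs_nonpos_iff.1 this
      have : d = 0 := by
        refine WithLp.ofLp_injective 2 (Prod.ext h1 h0.symm)
      simpa [this] using hq
    · set b : RSPlane := J (WithLp.toLp 2 (‖a‖ * d.fst / d.snd, 0)) with hb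
      have hdecomp : J d = (d.snd / ‖a‖) • (a + b) := by
        have h1 : a = J (‖a‖ • e₂) := by rw [map_smul, hJe, smul_inv_smul₀ ha'.ne']
        have h2 : a + b = J (‖a‖ • e₂ + WithLp.toLp 2 (‖a‖ * d.fst / d.snd, 0)) := by
          rw [map_add, ← h1]
        rw [h2, ← map_smul]
        congr 1
        refine WithLp.ofLp_injective 2 (Prod.ext ?_ ?_)
        · simp [he₂]; field_simp
        · simp [he₂]; field_simp
      rw [hdecomp]
      refine hcone q hq (Metric.ball_subset_ball hρδ hqp) _ _ (by positivity) ?_ ?_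
      · rw [div_le_iff₀ ha']; linarith
      · rw [hb, J.norm_map, WithLp.prod_norm_eq_of_L2]
        simp only [Real.norm_eq_abs, sq_abs]
        rw [hLr] at hLd
        simp [Real.sqrt_sq_eq_abs, abs_div, abs_mul, abs_of_pos h0]
        rw [div_le_iff₀ h0]
        rw [div_mul_eq_mul_div, div_le_iff₀ hη] at hLd
        linarith
  set S := G ∩ Metric.ball p ρ with hS
  have hSne : S.Nonempty := by
    obtain ⟨q, hq, hqp⟩ := Metric.mem_closure_iff.1 hp.1.1 ρ hρ
    exact ⟨q, hq, by rwa [Metric.mem_ball, dist_comm]⟩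
  have : Nonempty S := hSne.to_subtype
  -- Each point of `G` in the ball carries the downward cone below it; the graph is the upper
  -- envelope of these `L`-Lipschitz cones.
  set φ : S → ℝ → ℝ := fun q t => (J.symm q.1).snd - L * |t - (J.symm q.1).fst| with hφ
  have hbdd : ∀ t, BddAbove (Set.range fun q => φ q t) := by
    intro t
    refine ⟨‖p‖ + ρ, ?_⟩
    rintro _ ⟨q, rfl⟩
    have h1 : (J.symm q.1).snd ≤ ‖q.1‖ :=
      (le_abs_self _).trans ((WithLp.norm_snd_le _ (J.symm q.1)).trans_eq (J.symm.norm_map _))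
    have h2 : ‖q.1‖ ≤ ‖p‖ + ρ := by
      have := mem_ball_iff_norm.1 q.2.2
      have := norm_le_norm_add_norm_sub' q.1 p
      linarith
    have h3 : 0 ≤ L * |t - (J.symm q.1).fst| := by positivity
    simp only [hφ]
    linarith
  set g : ℝ → ℝ := fun t => ⨆ q, φ q t with hg
  have hgL : LipschitzWith L g := by
    refine LipschitzWith.of_le_add_mul L fun s t => ?_
    refine ciSup_le fun q => ?_
    have h1 : φ q t ≤ g t := le_ciSup (hbdd t) q
    have h2 : φ q s ≤ φ q t + L * dist s t := by
      simp only [hφ, Real.dist_eq]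
      have : |t - (J.symm q.1).fst| ≤ |s - (J.symm q.1).fst| + |s - t| := by
        have := abs_sub_le t s (J.symm q.1).fst
        rw [abs_sub_comm t s] at this
        linarith
      nlinarith [L.2]
    linarith
  refine ⟨J, L, g, ρ, hgL, hρ, hball, ?_⟩
  ext z
  refine and_congr_left fun hz => ⟨fun hzG => ?_, fun hzg => ?_⟩
  -- Openness allows a small upward move inside `G`, which makes the inequality with the envelope
  -- strict.
  · have hopen : IsOpen S := by
      have : S = (G ∩ openQuadrant) ∩ Metric.ball p ρ := by
        rw [hS, Set.inter_assoc, Set.inter_eq_right.2 hball]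
      rw [this]
      exact hG.inter Metric.isOpen_ball
    have hlim : Filter.Tendsto (fun s : ℝ => z + s • J e₂) (𝓝[>] 0) (𝓝 z) := by
      have : Filter.Tendsto (fun s : ℝ => z + s • J e₂) (𝓝 0) (𝓝 (z + (0 : ℝ) • J e₂)) :=
        Continuous.tendsto (by fun_prop) 0
      simp only [zero_smul, add_zero] at this
      exact this.mono_left nhdsWithin_le_nhds
    obtain ⟨s, hs, hs0⟩ := ((hlim.eventually (hopen.mem_nhds ⟨hzG, hz⟩)).and
      self_mem_nhdsWithin).exists
    have hs0' : (0 : ℝ) < s := hs0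
    have h1 : φ ⟨_, hs⟩ (J.symm z).fst ≤ g (J.symm z).fst := le_ciSup (hbdd _) _
    have h2 : φ ⟨_, hs⟩ (J.symm z).fst = (J.symm z).snd + s := by
      simp [hφ, he₂]
    show (J.symm z).snd < g (J.symm z).fst
    linarith
  -- A point below the envelope lies in the cone under some `q ∈ G`, and is reached from `q` by an
  -- admissible translation.
  · obtain ⟨q, hq⟩ := exists_lt_of_lt_ciSup (show (J.symm z).snd < ⨆ q, φ q (J.symm z).fst from hzg)
    have h1 := hcone' q.1 q.2.1 q.2.2 (J.symm (q.1 - z)) ?_ ?_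
    · rwa [J.apply_symm_apply, sub_sub_cancel] at h1
    · rw [J.symm.norm_map, ← dist_eq_norm]
      have h2 := dist_triangle_right q.1 z p
      have h3 := Metric.mem_ball.1 q.2.2
      have h4 := Metric.mem_ball.1 hz
      linarith
    · simp only [hφ] at hq
      rw [map_sub, WithLp.sub_fst, WithLp.sub_snd, abs_sub_comm]
      linarith

end Cone

/-! ### The Gauss–Green formula in the open quadrant -/

section GaussGreen

open scoped NNReal

theorem outerNormal_congr {V : Type*} [NormedAddCommGroup V] [InnerProductSpace ℝ V] {A B : Set V}
    {p : V} (hAB : ∀ᶠ z in 𝓝 p, (z ∈ A ↔ z ∈ B)) : outerNormal A p = outerNormal B p := by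
  by_cases H : ∃ ν, IsOuterUnitNormal A p ν
  · obtain ⟨ν, hν⟩ := H
    rw [hν.outerNormal_eq, (hν.congr hAB).outerNormal_eq]
  · have H' : ¬∃ ν, IsOuterUnitNormal B p ν := fun ⟨ν, hν⟩ =>
      H ⟨ν, hν.congr (hAB.mono fun z hz => hz.symm)⟩
    rw [outerNormal, dif_neg H, outerNormal, dif_neg H']

theorem eventually_mem_iff_of_inter_eq {X : Type*} [TopologicalSpace X] {A B U : Set X}
    (hU : IsOpen U) (hAB : A ∩ U = B ∩ U) {p : X} (hp : p ∈ U) :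
    ∀ᶠ z in 𝓝 p, (z ∈ A ↔ z ∈ B) := by
  filter_upwards [hU.mem_nhds hp] with z hz
  have := Set.ext_iff.1 hAB z
  simpa [hz] using this

theorem frontier_inter_eq_of_inter_eq {X : Type*} [TopologicalSpace X] {A B U : Set X}
    (hU : IsOpen U) (hAB : A ∩ U = B ∩ U) : frontier A ∩ U = frontier B ∩ U := by
  rw [← frontier_inter_open_inter hU, hAB, frontier_inter_open_inter hU]

theorem setIntegral_inter_eq {X : Type*} [MeasurableSpace X] {μ : Measure X} {A U : Set X}
    (hU : MeasurableSet U) {F : X → ℝ} (hF : ∀ z, z ∉ U → F z = 0) :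
    ∫ z in A ∩ U, F z ∂μ = ∫ z in A, F z ∂μ := by
  rw [← setIntegral_indicator hU, Set.indicator_eq_self.2]
  intro z hz
  by_contra h
  exact hz (hF z h)

theorem integral_fderiv_apply_eq_zero {V : Type*} [NormedAddCommGroup V] [NormedSpace ℝ V]
    [FiniteDimensional ℝ V] [MeasurableSpace V] [BorelSpace V] {μ : Measure V}
    [μ.IsAddHaarMeasure] {f : V → ℝ} (hf : ContDiff ℝ 1 f) (hc : HasCompactSupport f) (e : V) :
    ∫ z, fderiv ℝ f z e ∂μ = 0 := by
  have hfd : Integrable (fun z => fderiv ℝ f z e) μ :=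
    ((hf.continuous_fderiv one_ne_zero).clm_apply continuous_const).integrable_of_hasCompactSupport
      ((hc.fderiv ℝ).comp_left (g := fun L : V →L[ℝ] ℝ => L e) rfl)
  have := integral_mul_fderiv_eq_neg_fderiv_mul_of_integrable (μ := μ) (𝕜 := ℝ)
    (f := fun _ : V => (1 : ℝ)) (g := f) (v := e) (by simp) (by simpa using hfd)
    (by simpa using hf.continuous.integrable_of_hasCompactSupport hc) (by simp)
    (fun x _ => hf.differentiable one_ne_zero x)
  simpa using this

/-- The Gauss–Green formula holds for `G` on the open set `U`, and the part of the boundary in `U`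
has finite length and a measurable outer normal. -/
structure GaussGreenOn (G U : Set RSPlane) : Prop where
  isOpen : IsOpen U
  hausdorffMeasure_lt_top : (μH[1] : Measure RSPlane) (frontier G ∩ U) < ⊤
  ae_exists_normal : ∀ᵐ z ∂(μH[1] : Measure RSPlane).restrict (frontier G ∩ U),
    ∃ ν, IsOuterUnitNormal G z ν
  aestronglyMeasurable : AEStronglyMeasurable (outerNormal G)
    ((μH[1] : Measure RSPlane).restrict (frontier G ∩ U))
  setIntegral_fderiv : ∀ f : RSPlane → ℝ, ContDiff ℝ 1 f → HasCompactSupport f → tsupport f ⊆ U →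
    ∀ e, ∫ z in G, fderiv ℝ f z e = ∫ z in frontier G ∩ U, f z * ⟪outerNormal G z, e⟫ ∂μH[1]

variable {G A U : Set RSPlane}

theorem fderiv_apply_eq_zero_of_notMem {f : RSPlane → ℝ} (hfU : tsupport f ⊆ U) (e : RSPlane)
    {z : RSPlane} (hz : z ∉ U) : fderiv ℝ f z e = 0 := by
  rw [fderiv_of_notMem_tsupport ℝ fun h => hz (hfU h)]
  rfl

theorem GaussGreenOn.congr (h : GaussGreenOn A U) (hGA : G ∩ U = A ∩ U) : GaussGreenOn G U := by
  have hf := frontier_inter_eq_of_inter_eq h.isOpen hGA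
  have hm' : MeasurableSet (frontier A ∩ U) :=
    isClosed_frontier.measurableSet.inter h.isOpen.measurableSet
  refine ⟨h.isOpen, hf ▸ h.hausdorffMeasure_lt_top, ?_, ?_, ?_⟩
  · rw [hf]
    filter_upwards [h.ae_exists_normal, ae_restrict_mem hm'] with z hz hzU
    obtain ⟨ν, hν⟩ := hz
    exact ⟨ν, hν.congr (eventually_mem_iff_of_inter_eq h.isOpen hGA.symm hzU.2)⟩
  · rw [hf]
    refine h.aestronglyMeasurable.congr ?_
    filter_upwards [ae_restrict_mem hm'] with z hz
    exact outerNormal_congr (eventually_mem_iff_of_inter_eq h.isOpen hGA.symm hz.2)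
  · intro f hf1 hfc hfU e
    rw [hf, ← setIntegral_inter_eq h.isOpen.measurableSet
      fun z hz => fderiv_apply_eq_zero_of_notMem hfU e hz, hGA, setIntegral_inter_eq
      h.isOpen.measurableSet fun z hz => fderiv_apply_eq_zero_of_notMem hfU e hz,
      h.setIntegral_fderiv f hf1 hfc hfU e]
    refine setIntegral_congr_fun hm' fun z hz => ?_
    simp only [outerNormal_congr (eventually_mem_iff_of_inter_eq h.isOpen hGA hz.2)]

theorem gaussGreenOn_univ (hU : IsOpen U) : GaussGreenOn Set.univ U := by
  refine ⟨hU, by simp, by simp, by simp, fun f hf hfc _ e => ?_⟩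
  simp [integral_fderiv_apply_eq_zero hf hfc e]

theorem gaussGreenOn_empty (hU : IsOpen U) : GaussGreenOn ∅ U :=
  ⟨hU, by simp, by simp, by simp, fun f hf hfc _ e => by simp⟩

theorem gaussGreenOn_subgraph (J : RSPlane ≃ₗᵢ[ℝ] RSPlane) {g : ℝ → ℝ} {K : ℝ≥0}
    (hg : LipschitzWith K g) (hU : IsOpen U) (hUb : Bornology.IsBounded U) :
    GaussGreenOn (subgraph J g) U := by
  have hr := frontier_subgraph (J := J) hg.continuous
  refine ⟨hU, hr ▸ hausdorffMeasure_range_inter_lt_top J hg hUb, ?_, ?_, ?_⟩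
  · rw [hr]
    refine ae_restrict_of_ae_restrict_of_subset Set.inter_subset_left ?_
    filter_upwards [ae_outerNormal_subgraph J hg] with z hz
    exact ⟨_, hz⟩
  · rw [hr]
    exact (aestronglyMeasurable_outerNormal_subgraph J hg).mono_measure
      (Measure.restrict_mono Set.inter_subset_left le_rfl)
  · intro f hf hfc hfU e
    rw [setIntegral_subgraph_fderiv_eq J hg hf hfc, setIntegral_inter_eq hU.measurableSet]
    intro z hz
    rw [image_eq_zero_of_notMem_tsupport fun h => hz (hfU h), zero_mul]

/-- Boundary points are handled by the local graph. Elsewhere `G` is locally everything or nothing,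
and both sides of the formula vanish. -/
theorem exists_gaussGreenOn {h k : ℕ} {E : Set (GrushinSpace h k)} (hh : 1 ≤ h) (hk : 1 ≤ k)
    (hE : IsOpen E) (hEG : IsXYSymmetricWith E G) (hL : HasLipschitzBoundary E) {p : RSPlane}
    (hp : p ∈ openQuadrant) : ∃ U, p ∈ U ∧ U ⊆ openQuadrant ∧ GaussGreenOn G U := by
  by_cases hpf : p ∈ frontier G
  · obtain ⟨J, L, g, ρ, hg, hρ, hQ, heq⟩ := exists_subgraph_generating hh hk hE hEG hL ⟨hpf, hp⟩
    exact ⟨Metric.ball p ρ, Metric.mem_ball_self hρ, hQ,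
      (gaussGreenOn_subgraph J hg Metric.isOpen_ball Metric.isBounded_ball).congr heq⟩
  · by_cases hpi : p ∈ interior G
    · refine ⟨interior G ∩ openQuadrant, ⟨hpi, hp⟩, Set.inter_subset_right,
        (gaussGreenOn_univ (isOpen_interior.inter isOpen_openQuadrant)).congr ?_⟩
      rw [Set.univ_inter]
      exact Set.inter_eq_right.2 (Set.inter_subset_left.trans interior_subset)
    · have hpc : p ∉ closure G := fun h => hpf ⟨h, hpi⟩
      refine ⟨(closure G)ᶜ ∩ openQuadrant, ⟨hpc, hp⟩, Set.inter_subset_right,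
        (gaussGreenOn_empty (isClosed_closure.isOpen_compl.inter isOpen_openQuadrant)).congr ?_⟩
      rw [Set.empty_inter, Set.eq_empty_iff_forall_notMem]
      exact fun z hz => hz.2.1 (subset_closure hz.1)

variable {Q : Set RSPlane}

theorem locallyIntegrableOn_outerNormal
    (hloc : ∀ p ∈ Q, ∃ U, p ∈ U ∧ U ⊆ Q ∧ GaussGreenOn G U) :
    LocallyIntegrableOn (outerNormal G) Q ((μH[1] : Measure RSPlane).restrict (frontier G)) := by
  intro p hp
  obtain ⟨U, hpU, hUQ, hU⟩ := hloc p hp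
  refine ⟨U, mem_nhdsWithin_of_mem_nhds (hU.isOpen.mem_nhds hpU), ?_⟩
  rw [IntegrableOn, Measure.restrict_restrict hU.isOpen.measurableSet, Set.inter_comm]
  have : IsFiniteMeasure ((μH[1] : Measure RSPlane).restrict (frontier G ∩ U)) :=
    ⟨by simpa using hU.hausdorffMeasure_lt_top⟩
  exact Integrable.of_bound hU.aestronglyMeasurable 1 (.of_forall fun z => norm_outerNormal_le G z)

theorem ae_exists_normal
    (hloc : ∀ p ∈ Q, ∃ U, p ∈ U ∧ U ⊆ Q ∧ GaussGreenOn G U) :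
    ∀ᵐ z ∂(μH[1] : Measure RSPlane).restrict (frontier G ∩ Q), ∃ ν, IsOuterUnitNormal G z ν := by
  choose! U hpU hUQ hU using hloc
  -- A countable subcover suffices, since the assertion is an almost everywhere one.
  obtain ⟨T, hTQ, hT, hTU⟩ := TopologicalSpace.isOpen_biUnion_countable Q U
    fun p hp => (hU p hp).isOpen
  have hQT : frontier G ∩ Q ⊆ ⋃ p ∈ T, frontier G ∩ U p := by
    rw [← Set.inter_iUnion₂, hTU]
    exact Set.inter_subset_inter_right _ fun p hp => Set.mem_biUnion hp (hpU p hp)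
  refine ae_restrict_of_ae_restrict_of_subset hQT ?_
  rw [ae_restrict_biUnion_iff _ hT]
  exact fun p hp => (hU p (hTQ hp)).ae_exists_normal

theorem integrableOn_mul_inner_outerNormal
    (hloc : ∀ p ∈ Q, ∃ U, p ∈ U ∧ U ⊆ Q ∧ GaussGreenOn G U) (hQ : IsOpen Q)
    {f : RSPlane → ℝ} (hf : Continuous f) (hfc : HasCompactSupport f) (hfQ : tsupport f ⊆ Q)
    (e : RSPlane) : IntegrableOn (fun z => f z * ⟪outerNormal G z, e⟫) (frontier G ∩ Q) μH[1] := by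
  have h1 := (locallyIntegrableOn_outerNormal hloc).integrableOn_compact_subset hfQ hfc
  rw [IntegrableOn, Measure.restrict_restrict (isClosed_tsupport f).measurableSet,
    Set.inter_comm] at h1
  have h2 : IntegrableOn (fun z => f z * ⟪outerNormal G z, e⟫) (frontier G ∩ tsupport f) μH[1] := by
    obtain ⟨C, hC⟩ := hf.bounded_above_of_compact_support hfc
    have : Integrable (fun z => ⟪outerNormal G z, e⟫)
        ((μH[1] : Measure RSPlane).restrict (frontier G ∩ tsupport f)) := h1.inner_const e
    exact this.bdd_mul hf.aestronglyMeasurable (.of_forall hC)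
  refine h2.of_forall_sdiff_eq_zero (isClosed_frontier.measurableSet.inter hQ.measurableSet) ?_
  intro z hz
  rw [image_eq_zero_of_notMem_tsupport fun h => hz.2 ⟨hz.1.1, h⟩, zero_mul]

/-- The local Gauss–Green formulas add up to a formula on the whole open set. -/
theorem setIntegral_fderiv_eq_setIntegral_frontier
    (hloc : ∀ p ∈ Q, ∃ U, p ∈ U ∧ U ⊆ Q ∧ GaussGreenOn G U) (hQ : IsOpen Q)
    {f : RSPlane → ℝ} (hf : ContDiff ℝ 1 f) (hfc : HasCompactSupport f) (hfQ : tsupport f ⊆ Q)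
    (e : RSPlane) : ∫ z in G, fderiv ℝ f z e =
      ∫ z in frontier G ∩ Q, f z * ⟪outerNormal G z, e⟫ ∂μH[1] := by
  have hloc' := hloc
  choose! U hpU hUQ hU using hloc'
  obtain ⟨T, hTK, hKT⟩ := hfc.isCompact.elim_nhds_subcover U fun p hp =>
    (hU p (hfQ hp)).isOpen.mem_nhds (hpU p (hfQ hp))
  -- The partition splits `f` into finitely many pieces, each supported in one set where the local
  -- formula holds.
  obtain ⟨ρ, hρ⟩ := SmoothPartitionOfUnity.exists_isSubordinate (modelWithCornersSelf ℝ RSPlane)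
    (isClosed_tsupport f) (fun i : T => U i.1) (fun i => (hU _ (hfQ (hTK _ i.2))).isOpen) (by
      intro z hz
      obtain ⟨i, hi, hzi⟩ := Set.mem_iUnion₂.1 (hKT hz)
      exact Set.mem_iUnion.2 ⟨⟨i, hi⟩, hzi⟩)
  have hρ1 : ∀ i, ContDiff ℝ 1 (ρ i) := fun i =>
    (contMDiff_iff_contDiff.1 (ρ i).contMDiff).of_le (by norm_cast)
  set F : T → RSPlane → ℝ := fun i z => ρ i z * f z with hF
  have hF1 : ∀ i, ContDiff ℝ 1 (F i) := fun i => (hρ1 i).mul hf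
  have hFc : ∀ i, HasCompactSupport (F i) := fun i => hfc.mul_left
  have hFU : ∀ i : T, tsupport (F i) ⊆ U i.1 := fun i =>
    (tsupport_mul_subset_left).trans (hρ i)
  have hFQ : ∀ i, tsupport (F i) ⊆ Q := fun i => (hFU i).trans (hUQ _ (hfQ (hTK _ i.2)))
  have hsum : f = fun z => ∑ i, F i z := by
    ext z
    rw [hF, ← Finset.sum_mul]
    by_cases hz : z ∈ tsupport f
    · have := ρ.sum_eq_one hz
      rw [finsum_eq_sum_of_fintype] at this
      rw [this, one_mul]
    · rw [image_eq_zero_of_notMem_tsupport hz, mul_zero]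
  have hi : ∀ i, Integrable (fun z => fderiv ℝ (F i) z e) := fun i =>
    (((hF1 i).continuous_fderiv one_ne_zero).clm_apply
      continuous_const).integrable_of_hasCompactSupport
      (((hFc i).fderiv ℝ).comp_left (g := fun L : RSPlane →L[ℝ] ℝ => L e) rfl)
  have hd : ∀ z, fderiv ℝ f z e = ∑ i, fderiv ℝ (F i) z e := by
    intro z
    rw [hsum, fderiv_fun_sum fun i _ => (hF1 i).differentiable one_ne_zero z]
    simp
  have hl : ∀ i, ∫ z in G, fderiv ℝ (F i) z e =
      ∫ z in frontier G ∩ Q, F i z * ⟪outerNormal G z, e⟫ ∂μH[1] := by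
    intro i
    have hUi := hU _ (hfQ (hTK _ i.2))
    rw [hUi.setIntegral_fderiv _ (hF1 i) (hFc i) (hFU i) e,
      ← Set.inter_eq_right.2 (hUQ _ (hfQ (hTK _ i.2))), ← Set.inter_assoc,
      setIntegral_inter_eq hUi.isOpen.measurableSet]
    intro z hz
    rw [image_eq_zero_of_notMem_tsupport fun h => hz (hFU i h), zero_mul]
  simp_rw [hd]
  rw [integral_finsetSum _ fun i _ => (hi i).integrableOn]
  simp_rw [hl]
  rw [← integral_finsetSum _ fun i _ =>
    integrableOn_mul_inner_outerNormal hloc hQ (hF1 i).continuous (hFc i) (hFQ i) e]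
  congr 1
  ext1 z
  rw [← Finset.sum_mul]
  congr 1
  exact (congrFun hsum z).symm

end GaussGreen

/-! ### Duality between vector measures and test fields -/

section Duality

variable {X : Type*} [NormedAddCommGroup X] [InnerProductSpace ℝ X]

/-- The smooth map `w ↦ lw / √(1 + l²|w|²)` into the unit ball. -/
noncomputable def saturate (l : ℝ) (w : X) : X := (l / √(1 + l ^ 2 * ‖w‖ ^ 2)) • w

theorem contDiff_saturate (l : ℝ) : ContDiff ℝ 1 (saturate l : X → X) := by
  have h1 : ∀ w : X, 1 + l ^ 2 * ‖w‖ ^ 2 ≠ 0 := fun w => by positivity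
  have h2 : ContDiff ℝ 1 fun w : X => √(1 + l ^ 2 * ‖w‖ ^ 2) :=
    (contDiff_const.add (contDiff_const.mul (contDiff_norm_sq ℝ))).sqrt h1
  exact (contDiff_const.div h2 fun w => by positivity).smul contDiff_id

theorem norm_saturate_le {l : ℝ} (hl : 0 ≤ l) (w : X) : ‖saturate l w‖ ≤ 1 := by
  have h1 : 0 < √(1 + l ^ 2 * ‖w‖ ^ 2) := by positivity
  rw [saturate, norm_smul, norm_div, Real.norm_of_nonneg hl, Real.norm_of_nonneg h1.le,
    div_mul_eq_mul_div, div_le_one h1]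
  refine Real.le_sqrt_of_sq_le ?_
  nlinarith

theorem inner_saturate (l : ℝ) (w : X) :
    ⟪saturate l w, w⟫ = l / √(1 + l ^ 2 * ‖w‖ ^ 2) * ‖w‖ ^ 2 := by
  rw [saturate, inner_smul_left, real_inner_self_eq_norm_sq]
  rfl

theorem tendsto_inner_saturate (w : X) :
    Filter.Tendsto (fun n : ℕ => ⟪saturate (n : ℝ) w, w⟫) Filter.atTop (𝓝 ‖w‖) := by
  rcases eq_or_ne w 0 with rfl | hw
  · simp
  have hw' : 0 < ‖w‖ := norm_pos_iff.2 hw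
  have h1 : Filter.Tendsto (fun n : ℕ => ‖w‖ ^ 2 / √((1 / (n : ℝ)) ^ 2 + ‖w‖ ^ 2)) Filter.atTop
      (𝓝 (‖w‖ ^ 2 / √(0 ^ 2 + ‖w‖ ^ 2))) :=
    tendsto_const_nhds.div ((Real.continuous_sqrt.tendsto _).comp
      ((tendsto_one_div_atTop_nhds_zero_nat.pow 2).add tendsto_const_nhds)) (by positivity)
  have h2 : ‖w‖ ^ 2 / √(0 ^ 2 + ‖w‖ ^ 2) = ‖w‖ := by
    rw [zero_pow two_ne_zero, zero_add, Real.sqrt_sq hw'.le]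
    field_simp
  rw [h2] at h1
  refine h1.congr' ?_
  filter_upwards [Filter.eventually_gt_atTop 0] with n hn
  have hn' : (0 : ℝ) < n := by exact_mod_cast hn
  have h3 : 1 + (n : ℝ) ^ 2 * ‖w‖ ^ 2 = (n : ℝ) ^ 2 * ((1 / (n : ℝ)) ^ 2 + ‖w‖ ^ 2) := by
    field_simp
  rw [inner_saturate, h3, Real.sqrt_mul (by positivity), Real.sqrt_sq hn'.le]
  field_simp

variable [FiniteDimensional ℝ X]

theorem exists_cutoff {K Q : Set X} (hK : IsCompact K) (hQ : IsOpen Q) (hKQ : K ⊆ Q) :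
    ∃ χ : X → ℝ, ContDiff ℝ 1 χ ∧ HasCompactSupport χ ∧ tsupport χ ⊆ Q ∧ (∀ x ∈ K, χ x = 1) ∧
      ∀ x, 0 ≤ χ x ∧ χ x ≤ 1 := by
  obtain ⟨L, hL, hKL, hLQ⟩ := exists_compact_between hK hQ hKQ
  obtain ⟨f, h0, h1, h01⟩ := exists_contMDiffMap_zero_one_of_isClosed (n := 1)
    (modelWithCornersSelf ℝ X) (s := (interior L)ᶜ) (t := K) isOpen_interior.isClosed_compl
    hK.isClosed (Set.disjoint_left.2 fun x hx hx' => hx (hKL hx'))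
  have hs : tsupport f ⊆ L := by
    refine closure_minimal (fun x hx => ?_) hL.isClosed
    by_contra h
    exact hx (h0 fun h' => h (interior_subset h'))
  exact ⟨f, contMDiff_iff_contDiff.1 f.contMDiff, hL.of_isClosed_subset (isClosed_tsupport _) hs,
    hs.trans hLQ, fun x hx => h1 hx, h01⟩

variable [MeasurableSpace X] [BorelSpace X] {m : Measure X} {Q : Set X} {V : X → X}

theorem exists_seq_contDiff_tendsto_ae [IsFiniteMeasure m] (hV : Integrable V m) :
    ∃ f : ℕ → X → X, (∀ n, ContDiff ℝ 1 (f n)) ∧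
      ∀ᵐ x ∂m, Filter.Tendsto (fun n => f n x) Filter.atTop (𝓝 (V x)) := by
  have hV1 : MemLp V 1 m := memLp_one_iff_integrable.2 hV
  have := fun n : ℕ => hV1.exist_eLpNorm_sub_le ENNReal.one_ne_top le_rfl
    (show (0 : ℝ) < 1 / ((n : ℝ) + 1) by positivity)
  choose f hfc hf1 hfn using this
  have hlim : Filter.Tendsto (fun n => eLpNorm (f n - V) 1 m) Filter.atTop (𝓝 0) := by
    have h1 : Filter.Tendsto (fun n : ℕ => ENNReal.ofReal (1 / ((n : ℝ) + 1))) Filter.atTop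
        (𝓝 0) := by
      rw [← ENNReal.ofReal_zero]
      exact ENNReal.tendsto_ofReal tendsto_one_div_add_atTop_nhds_zero_nat
    refine tendsto_of_tendsto_of_tendsto_of_le_of_le tendsto_const_nhds h1 (fun n => bot_le)
      fun n => ?_
    rw [eLpNorm_sub_comm]
    exact hfn n
  obtain ⟨ns, -, hns⟩ := (tendstoInMeasure_of_tendsto_eLpNorm one_ne_zero
    (fun n => (hf1 n).continuous.aestronglyMeasurable) hV.1 hlim).exists_seq_tendsto_ae
  exact ⟨fun n => f (ns n), fun n => (hf1 _).of_le (by norm_cast), hns⟩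

/-- The ideal competitor `V/|V|` is not smooth. Smooth `f n → V` a.e. give the admissible fields `χ
· saturate l (f n)`; first `n → ∞` and then `l → ∞`, both by dominated convergence with majorant
`|V|`, recover `χ |V|`. -/
theorem ofReal_integral_cutoff_le {χ : X → ℝ} (hχ : ContDiff ℝ 1 χ) (hχc : HasCompactSupport χ)
    (hχQ : tsupport χ ⊆ Q) (hχ1 : ∀ x, 0 ≤ χ x ∧ χ x ≤ 1) (hm : m (tsupport χ) < ⊤)
    (hV : IntegrableOn V (tsupport χ) m) :
    ENNReal.ofReal (∫ x in tsupport χ, χ x * ‖V x‖ ∂m) ≤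
      ⨆ ψ ∈ testFields (W := X) Q, ENNReal.ofReal (∫ x, ⟪ψ x, V x⟫ ∂m) := by
  have hK : MeasurableSet (tsupport χ) := (isClosed_tsupport χ).measurableSet
  have : IsFiniteMeasure (m.restrict (tsupport χ)) := ⟨by simpa using hm⟩
  obtain ⟨f, hf, hlim⟩ := exists_seq_contDiff_tendsto_ae (m := m.restrict (tsupport χ)) hV
  set S := ⨆ ψ ∈ testFields (W := X) Q, ENNReal.ofReal (∫ x, ⟪ψ x, V x⟫ ∂m) with hS
  have hsat : ∀ l : ℝ, Continuous (saturate l : X → X) := fun l => (contDiff_saturate l).continuous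
  have habs : ∀ x, |χ x| ≤ 1 := fun x => abs_le.2 ⟨by linarith [(hχ1 x).1], (hχ1 x).2⟩
  have hbound : ∀ (l : ℝ), 0 ≤ l → ∀ x w, ‖χ x * ⟪saturate l w, V x⟫‖ ≤ ‖V x‖ := by
    intro l hl x w
    rw [norm_mul]
    calc ‖χ x‖ * ‖⟪saturate l w, V x⟫‖ ≤ 1 * (‖saturate l w‖ * ‖V x‖) := by
          gcongr
          · exact habs x
          · exact norm_inner_le_norm _ _
      _ ≤ 1 * (1 * ‖V x‖) := by gcongr; exact norm_saturate_le hl w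
      _ = ‖V x‖ := by ring
  have h1 : ∀ l : ℝ, 0 ≤ l →
      ENNReal.ofReal (∫ x in tsupport χ, χ x * ⟪saturate l (V x), V x⟫ ∂m) ≤ S := by
    intro l hl
    have hconv : Filter.Tendsto
        (fun n => ∫ x in tsupport χ, χ x * ⟪saturate l (f n x), V x⟫ ∂m) Filter.atTop
        (𝓝 (∫ x in tsupport χ, χ x * ⟪saturate l (V x), V x⟫ ∂m)) := by
      refine tendsto_integral_of_dominated_convergence (fun x => ‖V x‖) (fun n => ?_) hV.norm
        (fun n => .of_forall fun x => hbound l hl x _) ?_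
      · exact hχ.continuous.aestronglyMeasurable.mul
          (((hsat l).comp (hf n).continuous).aestronglyMeasurable.inner hV.1)
      · filter_upwards [hlim] with x hx
        exact (((hsat l).tendsto _).comp hx |>.inner tendsto_const_nhds).const_mul _
    refine le_of_tendsto' (ENNReal.tendsto_ofReal hconv) fun n => ?_
    set ψ : X → X := fun x => χ x • saturate l (f n x) with hψ
    have hψs : tsupport ψ ⊆ tsupport χ := tsupport_smul_subset_left χ _
    have hψt : ψ ∈ testFields (W := X) Q := by
      refine ⟨hχ.smul ((contDiff_saturate l).comp (hf n)), hχc.smul_right, hψs.trans hχQ,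
        fun x => ?_⟩
      rw [hψ, norm_smul]
      exact mul_le_one₀ (habs x) (norm_nonneg _) (norm_saturate_le hl _)
    have heq : ∫ x in tsupport χ, χ x * ⟪saturate l (f n x), V x⟫ ∂m = ∫ x, ⟪ψ x, V x⟫ ∂m := by
      simp only [hψ, inner_smul_left, RCLike.conj_to_real]
      refine setIntegral_eq_integral_of_forall_compl_eq_zero fun x hx => ?_
      rw [image_eq_zero_of_notMem_tsupport hx, zero_mul]
    rw [heq]
    exact le_iSup₂ (f := fun ψ _ => ENNReal.ofReal (∫ x, ⟪ψ x, V x⟫ ∂m)) ψ hψt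
  have hconv : Filter.Tendsto
      (fun n : ℕ => ∫ x in tsupport χ, χ x * ⟪saturate (n : ℝ) (V x), V x⟫ ∂m) Filter.atTop
      (𝓝 (∫ x in tsupport χ, χ x * ‖V x‖ ∂m)) := by
    refine tendsto_integral_of_dominated_convergence (fun x => ‖V x‖) (fun n => ?_) hV.norm
      (fun n => .of_forall fun x => hbound n n.cast_nonneg x _)
      (.of_forall fun x => (tendsto_inner_saturate (V x)).const_mul _)
    exact hχ.continuous.aestronglyMeasurable.mul
      (((hsat n).comp_aestronglyMeasurable hV.1).inner hV.1)
  exact le_of_tendsto' (ENNReal.tendsto_ofReal hconv) fun n => h1 n n.cast_nonneg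

theorem setLIntegral_compact_le (hQ : IsOpen Q) (hfin : ∀ K ⊆ Q, IsCompact K → m K < ⊤)
    (hV : LocallyIntegrableOn V Q m) {K : Set X} (hK : IsCompact K) (hKQ : K ⊆ Q) :
    ∫⁻ x in K, ‖V x‖ₑ ∂m ≤
      ⨆ ψ ∈ testFields (W := X) Q, ENNReal.ofReal (∫ x, ⟪ψ x, V x⟫ ∂m) := by
  obtain ⟨χ, hχ, hχc, hχQ, hχK, hχ1⟩ := exists_cutoff hK hQ hKQ
  have hVi := hV.integrableOn_compact_subset hχQ hχc
  refine le_trans ?_ (ofReal_integral_cutoff_le hχ hχc hχQ hχ1 (hfin _ hχQ hχc) hVi)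
  have hi : Integrable (fun x => χ x * ‖V x‖) (m.restrict (tsupport χ)) :=
    hVi.norm.bdd_mul (c := 1) hχ.continuous.aestronglyMeasurable (.of_forall fun x =>
      abs_le.2 ⟨by linarith [(hχ1 x).1], (hχ1 x).2⟩)
  rw [ofReal_integral_eq_lintegral_ofReal hi
    (.of_forall fun x => mul_nonneg (hχ1 x).1 (norm_nonneg _))]
  have hKs : K ⊆ tsupport χ := fun x hx => subset_tsupport χ (by simp [hχK x hx])
  calc ∫⁻ x in K, ‖V x‖ₑ ∂m = ∫⁻ x in K, ENNReal.ofReal (χ x * ‖V x‖) ∂m := by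
        refine setLIntegral_congr_fun hK.measurableSet fun x hx => ?_
        simp only [hχK x hx, one_mul, ofReal_norm]
    _ ≤ _ := lintegral_mono_set hKs

/-- The total variation of a locally integrable field is the supremum of its pairings with
test fields. -/
theorem lintegral_enorm_eq_iSup_testFields (hQ : IsOpen Q) (hmQ : m Qᶜ = 0)
    (hfin : ∀ K ⊆ Q, IsCompact K → m K < ⊤) (hV : LocallyIntegrableOn V Q m) :
    ∫⁻ x, ‖V x‖ₑ ∂m =
      ⨆ ψ ∈ testFields (W := X) Q, ENNReal.ofReal (∫ x, ⟪ψ x, V x⟫ ∂m) := by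
  refine le_antisymm ?_ (iSup₂_le fun ψ hψ => ?_)
  -- An increasing exhaustion of `Q` by compact sets; monotone convergence passes from these to the
  -- whole of `Q`.
  · obtain ⟨F, hF, hFQ, hFU, hFm⟩ := hQ.exists_iUnion_isClosed
    have hcov : ⋃ n : ℕ, F n ∩ Metric.closedBall 0 n = Q := by
      refine Set.Subset.antisymm (Set.iUnion_subset fun n => Set.inter_subset_left.trans (hFQ n))
        fun x hx => ?_
      rw [← hFU] at hx
      obtain ⟨n, hn⟩ := Set.mem_iUnion.1 hx
      obtain ⟨k, hk⟩ := exists_nat_ge ‖x‖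
      refine Set.mem_iUnion.2 ⟨max n k, hFm (le_max_left _ _) hn, ?_⟩
      rw [mem_closedBall_zero_iff]
      exact hk.trans (by exact_mod_cast le_max_right n k)
    have hmono : Monotone fun n : ℕ => F n ∩ Metric.closedBall (0 : X) n := fun i j hij =>
      Set.inter_subset_inter (hFm hij) (Metric.closedBall_subset_closedBall (by exact_mod_cast hij))
    have hres : m.restrict Q = m := Measure.restrict_eq_self_of_ae_mem (mem_ae_iff.2 hmQ)
    rw [← hres, ← hcov, setLIntegral_iUnion_of_directed _ hmono.directed_le, hcov, hres]
    exact iSup_le fun n => setLIntegral_compact_le hQ hfin hV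
      ((isCompact_closedBall 0 _).inter_left (hF n)) (Set.inter_subset_left.trans (hFQ n))
  · refine (ENNReal.ofReal_le_ofReal (le_abs_self _)).trans ?_
    rw [← Real.norm_eq_abs, ofReal_norm]
    refine (enorm_integral_le_lintegral_enorm _).trans (lintegral_mono fun x => ?_)
    rw [← ofReal_norm, ← ofReal_norm]
    refine ENNReal.ofReal_le_ofReal ((norm_inner_le_norm _ _).trans ?_)
    exact mul_le_of_le_one_left (norm_nonneg _) (hψ.2.2.2 x)

end Duality

/-! ### The boundary formula -/

section BoundaryFormula

variable {h k : ℕ} {α : ℝ} {G : Set RSPlane}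

theorem contDiff_mul_of_tsupport_subset {V : Type*} [NormedAddCommGroup V] [NormedSpace ℝ V]
    {Q : Set V} (hQ : IsOpen Q) {w u : V → ℝ} (hw : ContDiffOn ℝ 1 w Q) (hu : ContDiff ℝ 1 u)
    (huQ : tsupport u ⊆ Q) : ContDiff ℝ 1 fun z => w z * u z := by
  refine contDiff_iff_contDiffAt.2 fun z => ?_
  by_cases hz : z ∈ tsupport u
  · exact (hw.contDiffAt (hQ.mem_nhds (huQ hz))).mul hu.contDiffAt
  · refine (contDiffAt_const (c := (0 : ℝ))).congr_of_eventuallyEq ?_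
    filter_upwards [notMem_tsupport_iff_eventuallyEq.1 hz] with x hx
    simp [hx]

theorem LocallyIntegrableOn.clm_comp {X E F : Type*} [TopologicalSpace X] [MeasurableSpace X]
    [NormedAddCommGroup E] [NormedSpace ℝ E] [NormedAddCommGroup F] [NormedSpace ℝ F]
    {μ : Measure X} {f : X → E} {s : Set X} (hf : LocallyIntegrableOn f s μ) (L : E →L[ℝ] F) :
    LocallyIntegrableOn (fun x => L (f x)) s μ := fun x hx =>
  let ⟨u, hu, hi⟩ := hf x hx
  ⟨u, hu, L.integrable_comp hi⟩

/-- The weight `r^{h-1} s^{k-1}`. -/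
noncomputable def fstWeight (h k : ℕ) (p : RSPlane) : ℝ := p.fst ^ (h - 1) * p.snd ^ (k - 1)

/-- The weight `r^{h-1+α} s^{k-1}`. -/
noncomputable def sndWeight (h k : ℕ) (α : ℝ) (p : RSPlane) : ℝ :=
  p.fst ^ ((h : ℝ) - 1 + α) * p.snd ^ (k - 1)

theorem contDiff_planeFst : ContDiff ℝ 1 fun p : RSPlane => p.fst :=
  (WithLp.fstL 2 ℝ ℝ ℝ).contDiff

theorem contDiff_planeSnd : ContDiff ℝ 1 fun p : RSPlane => p.snd :=
  (WithLp.sndL 2 ℝ ℝ ℝ).contDiff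

theorem contDiff_fstWeight : ContDiff ℝ 1 (fstWeight h k) :=
  (contDiff_planeFst.pow _).mul (contDiff_planeSnd.pow _)

theorem contDiffOn_sndWeight : ContDiffOn ℝ 1 (sndWeight h k α) openQuadrant := by
  have h1 : ContDiffOn ℝ 1 (fun p : RSPlane => p.fst ^ ((h : ℝ) - 1 + α)) openQuadrant :=
    contDiff_planeFst.contDiffOn.rpow_const_of_ne fun p (hp : p ∈ openQuadrant) => hp.1.ne'
  exact h1.mul (contDiff_planeSnd.pow _).contDiffOn

/-- The outer normal of `G` weighted by the coefficients of `planeDiv`. -/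
noncomputable def weightedNormal (h k : ℕ) (α : ℝ) (G : Set RSPlane) (p : RSPlane) : RSPlane :=
  WithLp.toLp 2 (fstWeight h k p * (outerNormal G p).fst,
    sndWeight h k α p * (outerNormal G p).snd)

theorem norm_weightedNormal (hh : 1 ≤ h) {p : RSPlane} (hp : p ∈ openQuadrant) :
    ‖weightedNormal h k α G p‖ = boundaryIntegrand h k α G p := by
  have hr := hp.1
  have hs := hp.2
  have hw : 0 < fstWeight h k p := mul_pos (pow_pos hr _) (pow_pos hs _)
  have h1 : weightedNormal h k α G p = fstWeight h k p •
      (WithLp.toLp 2 ((outerNormal G p).fst, p.fst ^ α * (outerNormal G p).snd) : RSPlane) := by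
    refine WithLp.ofLp_injective 2 (Prod.ext rfl ?_)
    show sndWeight h k α p * (outerNormal G p).snd =
      fstWeight h k p * (p.fst ^ α * (outerNormal G p).snd)
    rw [sndWeight, fstWeight, rpow_natCast_sub_one_add hh hr]
    ring
  rw [h1, norm_smul, Real.norm_of_nonneg hw.le, boundaryIntegrand, fstWeight]
  ring

theorem weightedNormal_eq (p : RSPlane) : weightedNormal h k α G p =
    fstWeight h k p • (WithLp.toLp 2 ((outerNormal G p).fst, 0) : RSPlane) +
      sndWeight h k α p • (WithLp.toLp 2 (0, (outerNormal G p).snd) : RSPlane) := by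
  refine WithLp.ofLp_injective 2 (Prod.ext ?_ ?_) <;> simp [weightedNormal]

theorem locallyIntegrableOn_weightedNormal
    (hloc : ∀ p ∈ openQuadrant, ∃ U, p ∈ U ∧ U ⊆ openQuadrant ∧ GaussGreenOn G U) :
    LocallyIntegrableOn (weightedNormal h k α G) openQuadrant
      ((μH[1] : Measure RSPlane).restrict (quadrantBoundary G)) := by
  have h0 : LocallyIntegrableOn (outerNormal G) openQuadrant
      ((μH[1] : Measure RSPlane).restrict (quadrantBoundary G)) := fun x hx =>
    let ⟨u, hu, hi⟩ := locallyIntegrableOn_outerNormal hloc x hx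
    ⟨u, hu, IntegrableOn.mono_measure hi (Measure.restrict_mono Set.inter_subset_left le_rfl)⟩
  let L := (WithLp.prodContinuousLinearEquiv 2 ℝ ℝ ℝ).symm.toContinuousLinearMap
  have h1 := LocallyIntegrableOn.clm_comp h0 (L.comp ((WithLp.fstL 2 ℝ ℝ ℝ).prod 0))
  have h2 := LocallyIntegrableOn.clm_comp h0
    (L.comp ((0 : RSPlane →L[ℝ] ℝ).prod (WithLp.sndL 2 ℝ ℝ ℝ)))
  have hQ : IsLocallyClosed openQuadrant := isOpen_openQuadrant.isLocallyClosed
  rw [funext weightedNormal_eq]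
  exact (h1.continuousOn_smul hQ contDiff_fstWeight.continuous.continuousOn).add
    (h2.continuousOn_smul hQ contDiffOn_sndWeight.continuousOn)

theorem deriv_comp_toLp_left {f : RSPlane → ℝ} (hf : ContDiff ℝ 1 f) (p : RSPlane) :
    deriv (fun r : ℝ => f (WithLp.toLp 2 (r, p.snd))) p.fst =
      fderiv ℝ f p (WithLp.toLp 2 (1, 0)) := by
  have h1 : HasDerivAt (fun r : ℝ => (WithLp.toLp 2 (r, p.snd) : RSPlane)) (WithLp.toLp 2 (1, 0))
      p.fst := (WithLp.prodContinuousLinearEquiv 2 ℝ ℝ ℝ).symm.hasFDerivAt.comp_hasDerivAt p.fst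
    ((hasDerivAt_id p.fst).prodMk (hasDerivAt_const p.fst p.snd))
  exact ((hf.differentiable one_ne_zero p).hasFDerivAt.comp_hasDerivAt p.fst h1).deriv

theorem deriv_comp_toLp_right {f : RSPlane → ℝ} (hf : ContDiff ℝ 1 f) (p : RSPlane) :
    deriv (fun s : ℝ => f (WithLp.toLp 2 (p.fst, s))) p.snd =
      fderiv ℝ f p (WithLp.toLp 2 (0, 1)) := by
  have h1 : HasDerivAt (fun s : ℝ => (WithLp.toLp 2 (p.fst, s) : RSPlane)) (WithLp.toLp 2 (0, 1))
      p.snd := (WithLp.prodContinuousLinearEquiv 2 ℝ ℝ ℝ).symm.hasFDerivAt.comp_hasDerivAt p.snd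
    ((hasDerivAt_const p.snd p.fst).prodMk (hasDerivAt_id p.snd))
  exact ((hf.differentiable one_ne_zero p).hasFDerivAt.comp_hasDerivAt p.snd h1).deriv

section TestField

variable {ψ : RSPlane → RSPlane}

theorem tsupport_fst_subset (hψ : ψ ∈ testFields (W := RSPlane) openQuadrant) :
    tsupport (fun z => (ψ z).fst) ⊆ openQuadrant :=
  (tsupport_comp_subset (g := fun z : RSPlane => z.fst) rfl ψ).trans hψ.2.2.1

theorem contDiff_fstWeight_mul (hψ : ψ ∈ testFields (W := RSPlane) openQuadrant) :
    ContDiff ℝ 1 fun z => fstWeight h k z * (ψ z).fst :=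
  contDiff_fstWeight.mul (contDiff_planeFst.comp hψ.1)

theorem tsupport_snd_subset (hψ : ψ ∈ testFields (W := RSPlane) openQuadrant) :
    tsupport (fun z => (ψ z).snd) ⊆ openQuadrant :=
  (tsupport_comp_subset (g := fun z : RSPlane => z.snd) rfl ψ).trans hψ.2.2.1

/-- The power `r^{h-1+α}` may fail to be `C¹` at `r = 0`, so the compact support inside the quadrant
is needed. -/
theorem contDiff_sndWeight_mul (hψ : ψ ∈ testFields (W := RSPlane) openQuadrant) :
    ContDiff ℝ 1 fun z => sndWeight h k α z * (ψ z).snd :=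
  contDiff_mul_of_tsupport_subset isOpen_openQuadrant contDiffOn_sndWeight
    (contDiff_planeSnd.comp hψ.1) (tsupport_snd_subset hψ)

/-- The factor outside each derivative does not depend on the variable of differentiation. Moved
inside, it turns the operator into the ordinary divergence of the weighted field, to which
Gauss–Green applies. -/
theorem planeDiv_eq (hψ : ψ ∈ testFields (W := RSPlane) openQuadrant)
    (p : RSPlane) : planeDiv h k α ψ p =
      fderiv ℝ (fun z => fstWeight h k z * (ψ z).fst) p (WithLp.toLp 2 (1, 0)) +
      fderiv ℝ (fun z => sndWeight h k α z * (ψ z).snd) p (WithLp.toLp 2 (0, 1)) := by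
  rw [← deriv_comp_toLp_left (contDiff_fstWeight_mul hψ) p,
    ← deriv_comp_toLp_right (contDiff_sndWeight_mul hψ) p, planeDiv, ← deriv_const_mul_field,
    ← deriv_const_mul_field]
  congr 2
  · ext1 r
    show _ = r ^ (h - 1) * p.snd ^ (k - 1) * _
    ring
  · ext1 s
    show _ = p.fst ^ ((h : ℝ) - 1 + α) * s ^ (k - 1) * _
    ring

theorem setIntegral_planeDiv (hψ : ψ ∈ testFields (W := RSPlane) openQuadrant)
    (hloc : ∀ p ∈ openQuadrant, ∃ U, p ∈ U ∧ U ⊆ openQuadrant ∧ GaussGreenOn G U) :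
    ∫ p in G, planeDiv h k α ψ p =
      ∫ p in quadrantBoundary G, ⟪ψ p, weightedNormal h k α G p⟫ ∂μH[1] := by
  have hc1 : HasCompactSupport fun z => fstWeight h k z * (ψ z).fst :=
    (hψ.2.1.comp_left (g := fun z : RSPlane => z.fst) rfl).mul_left
  have hc2 : HasCompactSupport fun z => sndWeight h k α z * (ψ z).snd :=
    (hψ.2.1.comp_left (g := fun z : RSPlane => z.snd) rfl).mul_left
  have hs1 : tsupport (fun z => fstWeight h k z * (ψ z).fst) ⊆ openQuadrant :=
    tsupport_mul_subset_right.trans (tsupport_fst_subset hψ)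
  have hs2 : tsupport (fun z => sndWeight h k α z * (ψ z).snd) ⊆ openQuadrant :=
    tsupport_mul_subset_right.trans (tsupport_snd_subset hψ)
  have h1 := contDiff_fstWeight_mul (h := h) (k := k) hψ
  have h2 := contDiff_sndWeight_mul (h := h) (k := k) (α := α) hψ
  have hi : ∀ {f : RSPlane → ℝ}, ContDiff ℝ 1 f → HasCompactSupport f → ∀ e,
      Integrable fun z => fderiv ℝ f z e := fun hf hc e =>
    ((hf.continuous_fderiv one_ne_zero).clm_apply continuous_const).integrable_of_hasCompactSupport
      ((hc.fderiv ℝ).comp_left (g := fun L : RSPlane →L[ℝ] ℝ => L e) rfl)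
  simp_rw [planeDiv_eq hψ]
  rw [integral_add (hi h1 hc1 _).integrableOn (hi h2 hc2 _).integrableOn,
    setIntegral_fderiv_eq_setIntegral_frontier hloc isOpen_openQuadrant h1 hc1 hs1,
    setIntegral_fderiv_eq_setIntegral_frontier hloc isOpen_openQuadrant h2 hc2 hs2,
    ← integral_add
      (integrableOn_mul_inner_outerNormal hloc isOpen_openQuadrant h1.continuous hc1 hs1 _)
      (integrableOn_mul_inner_outerNormal hloc isOpen_openQuadrant h2.continuous hc2 hs2 _)]
  congr 1
  ext1 z
  simp only [weightedNormal, WithLp.prod_inner_apply]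
  simp
  ring

end TestField

theorem hausdorffMeasure_compact_lt_top
    (hloc : ∀ p ∈ openQuadrant, ∃ U, p ∈ U ∧ U ⊆ openQuadrant ∧ GaussGreenOn G U)
    {K : Set RSPlane} (hKQ : K ⊆ openQuadrant) (hK : IsCompact K) :
    (μH[1] : Measure RSPlane).restrict (quadrantBoundary G) K < ⊤ := by
  refine hK.measure_lt_top_of_nhdsWithin fun p hp => ?_
  obtain ⟨U, hpU, -, hU⟩ := hloc p (hKQ hp)
  refine ⟨U, mem_nhdsWithin_of_mem_nhds (hU.isOpen.mem_nhds hpU), ?_⟩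
  rw [Measure.restrict_apply hU.isOpen.measurableSet]
  exact (measure_mono (t := frontier G ∩ U) fun z hz => ⟨hz.2.1, hz.1⟩).trans_lt hU.hausdorffMeasure_lt_top

theorem iSup_planeDiv_eq_lintegral
    (hloc : ∀ p ∈ openQuadrant, ∃ U, p ∈ U ∧ U ⊆ openQuadrant ∧ GaussGreenOn G U) :
    ⨆ ψ ∈ testFields (W := RSPlane) openQuadrant, ENNReal.ofReal (∫ p in G, planeDiv h k α ψ p) =
      ∫⁻ p in quadrantBoundary G, ‖weightedNormal h k α G p‖ₑ ∂μH[1] := by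
  rw [lintegral_enorm_eq_iSup_testFields isOpen_openQuadrant ?_
    (fun K hKQ hK => hausdorffMeasure_compact_lt_top hloc hKQ hK)
    (locallyIntegrableOn_weightedNormal hloc)]
  · exact iSup_congr fun ψ => iSup_congr fun hψ => by rw [setIntegral_planeDiv hψ hloc]
  · rw [Measure.restrict_apply isOpen_openQuadrant.measurableSet.compl]
    refine measure_mono_null (t := ∅) (fun z hz => hz.1 hz.2.2) measure_empty

theorem symmConst_pos (hh : 1 ≤ h) (hk : 1 ≤ k) : 0 < symmConst h k := by
  have hω : ∀ m, 0 < unitBallVolume m := fun m =>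
    ENNReal.toReal_pos (Metric.measure_ball_pos volume _ one_pos).ne' measure_ball_lt_top.ne
  have := hω h
  have := hω k
  unfold symmConst
  positivity

theorem integrableOn_boundaryIntegrand_and_alphaPerimeter_eq (hh : 1 ≤ h) (hk : 1 ≤ k)
    (hα : 0 < α) {E : Set (GrushinSpace h k)} (hE : IsOpen E) (hP : alphaPerimeter α E < ⊤)
    (hEG : IsXYSymmetricWith E G) (hL : HasLipschitzBoundary E) :
    IntegrableOn (boundaryIntegrand h k α G) (quadrantBoundary G) μH[1] ∧
      alphaPerimeter α E = ENNReal.ofReal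
        (symmConst h k * ∫ p in quadrantBoundary G, boundaryIntegrand h k α G p ∂μH[1]) := by
  have hloc : ∀ p ∈ openQuadrant, ∃ U, p ∈ U ∧ U ⊆ openQuadrant ∧ GaussGreenOn G U :=
    fun p hp => exists_gaussGreenOn hh hk hE hEG hL hp
  have hc := symmConst_pos hh hk
  have hB : MeasurableSet (quadrantBoundary G) :=
    isClosed_frontier.measurableSet.inter isOpen_openQuadrant.measurableSet
  have heq := alphaPerimeter_eq_of_isXYSymmetricWith hh hk hα hE hEG
  rw [iSup_planeDiv_eq_lintegral hloc] at heq
  -- Finite perimeter and a positive constant force finite total variation; this supplies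
  -- integrability up to the axes, where the local theory gives no control.
  have hfin : ∫⁻ p in quadrantBoundary G, ‖weightedNormal h k α G p‖ₑ ∂μH[1] < ⊤ := by
    rw [heq] at hP
    exact ENNReal.lt_top_of_mul_ne_top_right hP.ne (ENNReal.ofReal_pos.2 hc).ne'
  have hm : AEStronglyMeasurable (weightedNormal h k α G)
      ((μH[1] : Measure RSPlane).restrict (quadrantBoundary G)) := by
    have := (locallyIntegrableOn_weightedNormal (h := h) (k := k) (α := α)
      hloc).aestronglyMeasurable
    rwa [Measure.restrict_restrict isOpen_openQuadrant.measurableSet,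
      Set.inter_eq_right.2 (show quadrantBoundary G ⊆ openQuadrant from
        Set.inter_subset_right)] at this
  have hi : IntegrableOn (weightedNormal h k α G) (quadrantBoundary G) μH[1] := ⟨hm, hfin⟩
  have hn : ∀ p ∈ quadrantBoundary G, ‖weightedNormal h k α G p‖ = boundaryIntegrand h k α G p :=
    fun p hp => norm_weightedNormal hh hp.2
  refine ⟨(integrableOn_congr_fun hn hB).1 hi.norm, ?_⟩
  rw [heq, ← ofReal_integral_norm_eq_lintegral_enorm hi, ENNReal.ofReal_mul hc.le,
    setIntegral_congr_fun hB hn]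

theorem ae_exists_isOuterUnitNormal (hh : 1 ≤ h) (hk : 1 ≤ k)
    {E : Set (GrushinSpace h k)} (hE : IsOpen E)
    (hEG : IsXYSymmetricWith E G) (hL : HasLipschitzBoundary E) :
    ∀ᵐ p ∂((μH[1] : Measure RSPlane).restrict (quadrantBoundary G)),
      ∃ ν, IsOuterUnitNormal G p ν :=
  ae_exists_normal fun _ hp => exists_gaussGreenOn hh hk hE hEG hL hp

end BoundaryFormula

theorem proposition2p3 (h k : ℕ) (hh : 1 ≤ h) (hk : 1 ≤ k) (α : ℝ) (hα : 0 < α) :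
    (∀ (E : Set (GrushinSpace h k)) (G : Set RSPlane),
      Bornology.IsBounded E → IsOpen E → alphaPerimeter α E < ⊤ → IsXYSymmetricWith E G →
        (alphaPerimeter α E = ENNReal.ofReal (symmConst h k) *
          ⨆ ψ ∈ testFields (W := RSPlane) openQuadrant,
            ENNReal.ofReal (∫ p in G, planeDiv h k α ψ p)) ∧
        (HasLipschitzBoundary E →
          (∀ᵐ p ∂((μH[1] : Measure RSPlane).restrict (quadrantBoundary G)),
            ∃ ν, IsOuterUnitNormal G p ν) ∧
          IntegrableOn (boundaryIntegrand h k α G) (quadrantBoundary G) μH[1] ∧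
          alphaPerimeter α E = ENNReal.ofReal
            (symmConst h k * ∫ p in quadrantBoundary G, boundaryIntegrand h k α G p ∂μH[1]))) ∧
    (∀ (E : Set (GrushinSpace h k)) (F : Set (HalfReduced k)),
      NullMeasurableSet E volume → alphaPerimeter α E < ⊤ → IsXSymmetricWith E F →
        alphaPerimeter α E = ENNReal.ofReal (h * unitBallVolume h) *
          ⨆ ψ ∈ testFields (W := HalfReduced k) (openHalf k),
            ENNReal.ofReal (∫ p in F, halfDiv h α ψ p)) := by
  refine ⟨fun E G _ hE hP hEG => ⟨alphaPerimeter_eq_of_isXYSymmetricWith hh hk hα hE hEG,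
    fun hL => ⟨ae_exists_isOuterUnitNormal hh hk hE hEG hL,
      integrableOn_boundaryIntegrand_and_alphaPerimeter_eq hh hk hα hE hP hEG hL⟩⟩,
    fun E F hE _ hEF => alphaPerimeter_eq_of_isXSymmetricWith hh hα hE hEF⟩
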